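/- Let $k$ be a commutative ring and let $\mathcal B,\mathcal C$ be (small, $\mathbb Z$-graded, $k$-linear) $A_\infty$-categories with codifferentials $b$ on $Ts\mathcal B$, $Ts\mathcal C$, where $(s\mathcal A)^d=\mathcal A^{d+1}$; maps act on the right and the Koszul sign rule is used. Let $f:\mathcal B\to\mathcal C$ be an $A_\infty$-functor, let $g:\operatorname{Ob}\mathcal B\to\operatorname{Ob}\mathcal C$ be a map, and for every $X\in\operatorname{Ob}\mathcal B$ let $r_X\in\mathcal C^0(Xf,Xg)$ be an element with $r_Xs\,b_1=0$. Assume that for all objects $X,Y$ of $\mathcal B$ and every complex $N=s\mathcal B(X_0,X_1)\otimes_k\dots\otimes_k s\mathcal B(X_{n-1},X_n)$, $n\ge 0$ ($N=k$ for $n=0$), the chain map $$\operatorname{Hom}(N,(r_Xs\otimes1)b_2):\operatorname{Hom}^\bullet_k(N,s\mathcal C(Xg,Yg))\to\operatorname{Hom}^\bullet_k(N,s\mathcal C(Xf,Yg))$$ is a quasi-isomorphism. A natural $A_\infty$-transformation $q:h\to h'$ of $A_\infty$-functors $\mathcal B\to\mathcal C$ is an $(h,h')$-coderivation $Ts\mathcal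 B\to Ts\mathcal C$ of degree $-1$ with $qB_1:=qb+bq=0$. Two of them are equivalent, $q\equiv q'$, if $q-q'=vB_1:=vb-bv$ for some $(h,h')$-coderivation $v$ of degree $-2$. The composite $q\cdot p:h\to h''$ of $q:h\to h'$ and $p:h'\to h''$ is represented by $(q\otimes p)B_2$, the $(h,h'')$-coderivation whose $n$-th component is $\sum (h_{a_1}\otimes\dots\otimes h_{a_\alpha}\otimes q_j\otimes h'_{c_1}\otimes\dots\otimes h'_{c_\beta}\otimes p_t\otimes h''_{e_1}\otimes\dots\otimes h''_{e_\gamma})\,b_{\alpha+\beta+\gamma+2}$, summed over $a_1+\dots+a_\alpha+j+c_1+\dots+c_\beta+t+e_1+\dots+e_\gamma=n$. (So natural transformations modulo $\equiv$ are the 2-morphisms of the 2-category $A_\infty$.) An $A_\infty$-category $\mathcal C$ is unital if it has a unit transformation, i.e. a natural $A_\infty$-transformation $\mathbf i:\mathrm{id}_{\mathcal C}\to\mathrm{id}_{\mathcal C}$ such that $(\mathbf i\otimes\mathbf i)B_2\equiv\mathbf i$ and the chain maps $({}_X\mathbf i_0\otimes1)b_2$, $(1\otimes{}_Y\mathbf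 i_0)b_2$ of $s\mathcal C(X,Y)$ to itself are homotopy invertible for all $X,Y$. Let $g,g':\mathcal B\to\mathcal C$ be two $A_\infty$-functors with the given underlying map of objects $g$, and let $r:f\to g$, $r':f\to g'$ be natural $A_\infty$-transformations whose $0$-th components are both given by $1\mapsto r_Xs$. Then: 1. there is a natural $A_\infty$-transformation $p:g\to g'$ with $r\cdot p\equiv r'$, and it is unique up to equivalence: if $p,q:g\to g'$ are natural $A_\infty$-transformations with $r\cdot p\equiv r'$ and $r\cdot q\equiv r'$, then $p\equiv q$; 2. if $\mathcal C$ is unital with a unit transformation $\mathbf i$, then every natural $A_\infty$-transformation $p:g\to g'$ with $r\cdot p\equiv r'$ is invertible in $A_\infty$: there is a natural $A_\infty$-transformation $t:g'\to g$ with $p\cdot t\equiv g\mathbf i$ and $t\cdot p\equiv g'\mathbf i$. -/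

import Mathlib

open scoped TensorProduct DirectSum

universe u v w

noncomputable section

/-! ## Graded quivers -/

/-- A graded `k`-linear quiver `A`. The graded `k`-module `A(X,Y)` is given by its total module
`Hom X Y = ⊕_d A^d(X,Y)` together with the submodules `gr X Y d = A^d(X,Y)`. -/
structure GradedQuiver (k : Type u) [CommRing k] where
  Ob : Type v
  Hom : Ob → Ob → Type u
  [grp : ∀ X Y, AddCommGroup (Hom X Y)]
  [mod : ∀ X Y, Module k (Hom X Y)]
  gr : ∀ X Y, ℤ → Submodule k (Hom X Y)
  [dec : ∀ X Y, DirectSum.Decomposition (gr X Y)]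

attribute [instance] GradedQuiver.grp GradedQuiver.mod GradedQuiver.dec

/-- Finite sequences `X = X₀, X₁, …, Xₙ = Y` (`n ≥ 0`) of elements of `S`. -/
inductive ObPath {S : Type v} : S → S → Type v
  | nil (X : S) : ObPath X X
  | cons (X : S) {Z Y : S} (p : ObPath Z Y) : ObPath X Y

/-- The number `n` of steps of `X₀, X₁, …, Xₙ`. -/
def ObPath.length {S : Type v} : {X Y : S} → ObPath X Y → ℕ
  | _, _, .nil _ => 0
  | _, _, .cons _ p => p.length + 1

namespace GradedQuiver

variable {k : Type u} [CommRing k] (A : GradedQuiver.{u, v} k)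

/-- The suspended grading on `Hom X Y`: `(sA)^d(X,Y) = A^{d+1}(X,Y)`. The modules underlying `A(X,Y)`
and `sA(X,Y)` coincide and the shift map `s` is the identity on elements; from here on `Hom X Y`
is regarded as `sA(X,Y)`. -/
def sgr (X Y : A.Ob) (d : ℤ) : Submodule k (A.Hom X Y) := A.gr X Y (d + 1)

/-- The Koszul sign operator on `sA(X,Y)`: multiplication by `(-1)^{m e}` on `(sA)^e(X,Y)`. -/
def sgn (m : ℤ) (X Y : A.Ob) : A.Hom X Y →ₗ[k] A.Hom X Y :=
  (DirectSum.toModule k ℤ (A.Hom X Y)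
      (fun j => ((m * (j - 1)).negOnePow : ℤ) • (A.gr X Y j).subtype)) ∘ₗ
    (DirectSum.decomposeLinearEquiv (A.gr X Y)).toLinearMap

/-- `sA(X₀,X₁) ⊗ sA(X₁,X₂) ⊗ … ⊗ sA(Xₙ₋₁,Xₙ)`; this is `k` for `n = 0`. -/
def Tens : {X Y : A.Ob} → ObPath X Y → ModuleCat.{u} k
  | _, _, .nil _ => ModuleCat.of k k
  | _, _, .cons X (Z := Z) p => ModuleCat.of k (A.Hom X Z ⊗[k] (Tens p))

/-- The identification of the tensor product over the sequence `X` (`n = 0`) with `k`. -/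
def tensNil (X : A.Ob) : k ≃ₗ[k] A.Tens (.nil X) := LinearEquiv.refl k k

/-- The identification `sA(X₀,X₁) ⊗ (sA(X₁,X₂) ⊗ …) = sA(X₀,X₁) ⊗ sA(X₁,X₂) ⊗ …`. -/
def tensCons (X : A.Ob) {Z Y : A.Ob} (p : ObPath Z Y) :
    A.Hom X Z ⊗[k] A.Tens p ≃ₗ[k] A.Tens (.cons X p) :=
  LinearEquiv.refl k (A.Hom X Z ⊗[k] A.Tens p)

/-- The elements of degree `d` of `sA(X₀,X₁) ⊗ … ⊗ sA(Xₙ₋₁,Xₙ)`. -/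
def tgr : {X Y : A.Ob} → (p : ObPath X Y) → ℤ → Submodule k (A.Tens p)
  | _, _, .nil _, d => if d = 0 then ⊤ else ⊥
  | _, _, .cons X (Z := Z) p, d =>
      ⨆ i : ℤ, Submodule.map₂
        ((TensorProduct.mk k (A.Hom X Z) (A.Tens p)).compr₂ (A.tensCons X p).toLinearMap)
        (A.sgr X Z i) (tgr p (d - i))

/-- The sign operator on a tensor product: multiplication by `(-1)^{m e}` in degree `e`. -/
def tsgn (m : ℤ) : {X Y : A.Ob} → (p : ObPath X Y) → (A.Tens p →ₗ[k] A.Tens p)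
  | _, _, .nil _ => LinearMap.id
  | _, _, .cons X (Z := Z) p =>
      (A.tensCons X p).conj (TensorProduct.map (A.sgn m X Z) (tsgn m p))

open Classical in
/-- The tensor quiver `TsA = ⊕_{n ≥ 0} TⁿsA`:
`TsA(X,Y) = ⊕ sA(X₀,X₁) ⊗ … ⊗ sA(Xₙ₋₁,Xₙ)`, over all `n ≥ 0` and all sequences
`X = X₀, X₁, …, Xₙ = Y` of objects. -/
abbrev Bar (X Y : A.Ob) : Type (max u v) := ⨁ p : ObPath X Y, (A.Tens p : Type u)

open Classical in
/-- The inclusion of a direct summand of `TsA(X,Y)`. -/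
def ι {X Y : A.Ob} (p : ObPath X Y) : A.Tens p →ₗ[k] A.Bar X Y :=
  DirectSum.lof k (ObPath X Y) (fun p => (A.Tens p : Type u)) p

open Classical in
/-- The linear map out of `TsA(X,Y)` with given restrictions to the direct summands. -/
def ofSummands {X Y : A.Ob} {M : Type w} [AddCommMonoid M] [Module k M]
    (φ : (p : ObPath X Y) → (A.Tens p →ₗ[k] M)) : A.Bar X Y →ₗ[k] M :=
  DirectSum.toModule k (ObPath X Y) M φ

/-- The generator `1_X` of `T⁰sA(X,X) = k`. -/
def one (X : A.Ob) : A.Bar X X := A.ι (.nil X) (A.tensNil X 1)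

/-- `x ⊗ t ↦ x ⊗ t`, `sA(X,Z) ⊗ TsA(Z,Y) → TsA(X,Y)`. -/
def consT {X Z Y : A.Ob} : A.Hom X Z →ₗ[k] A.Bar Z Y →ₗ[k] A.Bar X Y :=
  LinearMap.flip (A.ofSummands fun p =>
    LinearMap.flip ((TensorProduct.mk k (A.Hom X Z) (A.Tens p)).compr₂
      ((A.ι (.cons X p)) ∘ₗ (A.tensCons X p).toLinearMap)))

/-- Multiplication (concatenation of tensors) by elements of one direct summand of `TsA(X,Z)`. -/
def concatAux : {X Z : A.Ob} → (p : ObPath X Z) → (Y : A.Ob) →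
    (A.Tens p →ₗ[k] A.Bar Z Y →ₗ[k] A.Bar X Y)
  | _, _, .nil X, Y => (LinearMap.lsmul k (A.Bar X Y)) ∘ₗ (A.tensNil X).symm.toLinearMap
  | _, _, .cons X (Z := Z) p, Y =>
      TensorProduct.lift
        (((LinearMap.llcomp k _ _ _).comp (A.consT (X := X) (Z := Z))).compl₂ (concatAux p Y)) ∘ₗ
        (A.tensCons X p).symm.toLinearMap

/-- The multiplication `μ : TsA(X,Z) ⊗ TsA(Z,Y) → TsA(X,Y)` of the tensor algebra. -/
def concat (X Z Y : A.Ob) : A.Bar X Z ⊗[k] A.Bar Z Y →ₗ[k] A.Bar X Y :=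
  TensorProduct.lift (A.ofSummands fun p => A.concatAux p Y)

open Classical in
/-- `(TsA ⊗ TsA)(X,Y) = ⊕_Z TsA(X,Z) ⊗ TsA(Z,Y)`. -/
abbrev BarBar (X Y : A.Ob) : Type (max u v) := ⨁ Z : A.Ob, A.Bar X Z ⊗[k] A.Bar Z Y

open Classical in
/-- The map `y ↦ 1_X ⨂ y`, `TsA(X,Y) → (TsA ⊗ TsA)(X,Y)`. -/
def oneT (X Y : A.Ob) : A.Bar X Y →ₗ[k] A.BarBar X Y :=
  (DirectSum.lof k A.Ob (fun Z => A.Bar X Z ⊗[k] A.Bar Z Y) X) ∘ₗ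
    (TensorProduct.mk k (A.Bar X X) (A.Bar X Y) (A.one X))

open Classical in
/-- `x ⊗ (t ⨂ y) ↦ (x ⊗ t) ⨂ y`, `sA(X,Z) ⊗ (TsA ⊗ TsA)(Z,Y) → (TsA ⊗ TsA)(X,Y)`. -/
def consTT {X Z Y : A.Ob} : A.Hom X Z →ₗ[k] A.BarBar Z Y →ₗ[k] A.BarBar X Y :=
  LinearMap.flip (DirectSum.toModule k A.Ob (A.Hom X Z →ₗ[k] A.BarBar X Y) fun W =>
    LinearMap.flip
      (((LinearMap.rTensorHom (A.Bar W Y)).comp (A.consT (X := X) (Z := Z) (Y := W))).compr₂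
        (DirectSum.lof k A.Ob (fun W => A.Bar X W ⊗[k] A.Bar W Y) W)))

/-- The cut comultiplication
`(h₁ ⊗ … ⊗ hₙ)Δ = ∑_{0 ≤ m ≤ n} (h₁ ⊗ … ⊗ hₘ) ⨂ (hₘ₊₁ ⊗ … ⊗ hₙ)` on a direct summand: the
term `m = 0`, plus the result of multiplying `(h₂ ⊗ … ⊗ hₙ)Δ` by `h₁` from the left. -/
def cutAux : {X Y : A.Ob} → (p : ObPath X Y) → (A.Tens p →ₗ[k] A.BarBar X Y)
  | _, _, .nil X => (A.oneT X X) ∘ₗ (A.ι (.nil X))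
  | _, _, .cons X (Z := Z) (Y := Y) p =>
      (A.oneT X Y) ∘ₗ (A.ι (.cons X p)) +
        TensorProduct.lift ((A.consTT (X := X) (Z := Z)).compl₂ (cutAux p)) ∘ₗ
          (A.tensCons X p).symm.toLinearMap

/-- The cut comultiplication `Δ : TsA → TsA ⊗ TsA`. -/
def cut (X Y : A.Ob) : A.Bar X Y →ₗ[k] A.BarBar X Y := A.ofSummands fun p => A.cutAux p

/-- The sign operator on `TsA(X,Y)`: multiplication by `(-1)^{m e}` in degree `e`. -/
def barSgn (m : ℤ) (X Y : A.Ob) : A.Bar X Y →ₗ[k] A.Bar X Y :=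
  A.ofSummands fun p => (A.ι p) ∘ₗ (A.tsgn m p)

/-- The inclusion of `sA = T¹sA` into `TsA`. -/
def inc (X Y : A.Ob) : A.Hom X Y →ₗ[k] A.Bar X Y := (A.consT (X := X)).flip (A.one Y)

end GradedQuiver

section Coalgebra

variable {k : Type u} [CommRing k]

/-- Families of `k`-linear maps `TsA(X,Y) → TsC(XF,YG)`. -/
abbrev BarMap (A : GradedQuiver.{u, v} k) (C : GradedQuiver.{u, w} k) (F G : A.Ob → C.Ob) :=
  ∀ X Y : A.Ob, A.Bar X Y →ₗ[k] C.Bar (F X) (G Y)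

/-- Families of `k`-linear maps `TsA(X,Y) → sC(XF,YG)`. The restrictions of such a family `r`
to `TⁿsA` are the components `r₀, r₁, r₂, …` of a coderivation or of a cocategory homomorphism. -/
abbrev Comps (A : GradedQuiver.{u, v} k) (C : GradedQuiver.{u, w} k) (F G : A.Ob → C.Ob) :=
  ∀ X Y : A.Ob, A.Bar X Y →ₗ[k] C.Hom (F X) (G Y)

variable {A : GradedQuiver.{u, v} k} {C : GradedQuiver.{u, w} k}

/-- All the components are homogeneous of degree `d` (for the gradings of `TⁿsA` and `sC`). -/
def Comps.HasDegree {F G : A.Ob → C.Ob} (r : Comps A C F G) (d : ℤ) : Prop :=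
  ∀ (X Y : A.Ob) (p : ObPath X Y) (e : ℤ), ∀ x ∈ A.tgr p e,
    r X Y (A.ι p x) ∈ C.sgr (F X) (G Y) (e + d)

/-- A family with values in `sC`, viewed as a family with values in `T¹sC ⊆ TsC`. -/
def Comps.toBar {F G : A.Ob → C.Ob} (r : Comps A C F G) : BarMap A C F G :=
  fun X Y => (C.inc (F X) (G Y)) ∘ₗ (r X Y)

/-- The family `Δ(φ ⊗ ψ)μ`, where `φ` has degree `d`. By the Koszul rule for right operators,
`(x ⊗ y)(φ ⊗ ψ) = (-1)^{d · deg y} xφ ⊗ yψ`. -/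
def BarMap.conv {F G H : A.Ob → C.Ob} (d : ℤ) (φ : BarMap A C F G) (ψ : BarMap A C G H) :
    BarMap A C F H := fun X Y => by
  classical
  exact (DirectSum.toModule k A.Ob (C.Bar (F X) (H Y)) fun Z =>
    (C.concat (F X) (G Z) (H Y)) ∘ₗ
      TensorProduct.map (φ X Z) ((ψ Z Y) ∘ₗ (A.barSgn d Z Y))) ∘ₗ (A.cut X Y)

/-- The identity map of `TsA`. -/
def BarMap.ident (A : GradedQuiver.{u, v} k) : BarMap A A (fun X => X) (fun X => X) :=
  fun _ _ => LinearMap.id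

/-- The map `TsA → T⁰sA → T⁰sC` determined by the map `F` of objects. -/
def BarMap.unit (C : GradedQuiver.{u, w} k) (F : A.Ob → C.Ob) : BarMap A C F F :=
  fun _ _ => A.ofSummands fun p => match p with
    | .nil X =>
      C.ι (.nil (F X)) ∘ₗ (C.tensNil (F X)).toLinearMap ∘ₗ (A.tensNil X).symm.toLinearMap
    | .cons _ _ => 0

/-- `f^{⊗ l}` for the components `f` of a cocategory homomorphism: the sum of all
`f_{i₁} ⊗ f_{i₂} ⊗ … ⊗ f_{i_l} : TsA → TˡsC`. -/
def Comps.power {F : A.Ob → C.Ob} (f : Comps A C F F) : ℕ → BarMap A C F F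
  | 0 => BarMap.unit C F
  | l + 1 => BarMap.conv 0 f.toBar (f.power l)

/-- The cocategory homomorphism `TsA → TsC` with components `f` such that `f₀ = 0`: its restriction
to `TⁿsA` is `∑_{l} ∑_{i₁ + … + i_l = n} f_{i₁} ⊗ … ⊗ f_{i_l}`, where `l ≤ n` because `f₀ = 0`. -/
def Comps.hom {F : A.Ob → C.Ob} (f : Comps A C F F) : BarMap A C F F :=
  fun X Y => A.ofSummands fun p =>
    ∑ l ∈ Finset.range (p.length + 1), (f.power l X Y) ∘ₗ (A.ι p)

/-- The `(φ, ψ)`-coderivation of degree `d` with components `r`: the sum of all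
`φ_{a α} ⊗ r_j ⊗ ψ_{c β}`. -/
def Comps.coder {F G : A.Ob → C.Ob} (φ : BarMap A C F F) (d : ℤ) (r : Comps A C F G)
    (ψ : BarMap A C G G) : BarMap A C F G :=
  BarMap.conv 0 φ (BarMap.conv d r.toBar ψ)

/-- The map `(r ⊗ p)θ`: the sum of all
`f_{a α} ⊗ r_j ⊗ g_{c β} ⊗ p_t ⊗ h_{e γ}`, where `r`, `p` have degrees `d`, `e`. -/
def thetaMap {F G H : A.Ob → C.Ob} (f : BarMap A C F F) (d : ℤ) (r : Comps A C F G)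
    (g : BarMap A C G G) (e : ℤ) (p : Comps A C G H) (h : BarMap A C H H) : BarMap A C F H :=
  BarMap.conv 0 f (BarMap.conv d r.toBar (BarMap.conv 0 g (BarMap.conv e p.toBar h)))

end Coalgebra

/-! ## `A∞`-categories, functors and transformations -/

/-- An `A∞`-category over `k`: a graded quiver with operations `bₙ : TⁿsA → sA`, `n ≥ 1`, of
degree `1` such that `∑_{r+n+t=m} (1^{⊗r} ⊗ bₙ ⊗ 1^{⊗t}) b_{r+1+t} = 0` for all `m`. -/
structure AInfCat (k : Type u) [CommRing k] extends GradedQuiver.{u, v} k where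
  b : Comps toGradedQuiver toGradedQuiver (fun X => X) (fun X => X)
  b_zero : ∀ X, b X X (toGradedQuiver.one X) = 0
  b_degree : b.HasDegree 1
  b_sq : ∀ X Y, (b X Y) ∘ₗ (b.coder (BarMap.ident _) 1 (BarMap.ident _) X Y) = 0

variable {k : Type u} [CommRing k]

namespace AInfCat

variable (A : AInfCat.{u, v} k)

/-- The codifferential `b : TsA → TsA`. -/
def codiff : BarMap A.toGradedQuiver A.toGradedQuiver (fun X => X) (fun X => X) :=
  A.b.coder (BarMap.ident _) 1 (BarMap.ident _)

/-- The component `b₁`. -/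
def b₁ (X Y : A.Ob) : A.Hom X Y →ₗ[k] A.Hom X Y := (A.b X Y) ∘ₗ (A.inc X Y)

/-- The component `b₂`. -/
def b₂ (X Y Z : A.Ob) : A.Hom X Y →ₗ[k] A.Hom Y Z →ₗ[k] A.Hom X Z :=
  (A.consT (X := X) (Z := Y) (Y := Z)).compl₁₂ LinearMap.id (A.inc Y Z) |>.compr₂ (A.b X Z)

/-- The differential `∑_{q+1+t=n} 1^{⊗q} ⊗ b₁ ⊗ 1^{⊗t}` of the complex
`N = sA(X₀,X₁) ⊗ … ⊗ sA(Xₙ₋₁,Xₙ)`, with Koszul signs `(x ⊗ y)(b₁ ⊗ 1) = (-1)^{deg y} xb₁ ⊗ y`. -/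
def tensD : {X Y : A.Ob} → (p : ObPath X Y) → (A.Tens p →ₗ[k] A.Tens p)
  | _, _, .nil _ => 0
  | _, _, .cons X (Z := Z) p =>
      (A.tensCons X p).conj
        (TensorProduct.map (A.b₁ X Z) (A.tsgn 1 p) + TensorProduct.map LinearMap.id (tensD p))

end AInfCat

/-- The components of an `A∞`-functor `B → C` with map of objects `F`: they have degree `0`,
`f₀ = 0`, and `∑ (f_{i₁} ⊗ … ⊗ f_{i_l}) b_l = ∑ (1^{⊗r} ⊗ bₙ ⊗ 1^{⊗t}) f_{r+1+t}`. -/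
structure AInfFunctor (B : AInfCat.{u, v} k) (C : AInfCat.{u, w} k) (F : B.Ob → C.Ob) where
  comps : Comps B.toGradedQuiver C.toGradedQuiver F F
  zero : ∀ X, comps X X (B.one X) = 0
  degree : comps.HasDegree 0
  comm : ∀ X Y, (C.b (F X) (F Y)) ∘ₗ (comps.hom X Y) = (comps X Y) ∘ₗ (B.codiff X Y)

section Transformations

variable {B : AInfCat.{u, v} k} {C : AInfCat.{u, w} k} {F G H : B.Ob → C.Ob}

/-- The cocategory homomorphism `TsB → TsC` of an `A∞`-functor. -/
def AInfFunctor.hom (f : AInfFunctor B C F) :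
    BarMap B.toGradedQuiver C.toGradedQuiver F F := f.comps.hom

/-- The components of `vB₁ = vb - (-1)^d bv` for an `(f,g)`-coderivation `v` of degree `d`, where
`f`, `g` are cocategory homomorphisms. -/
def transfB₁ (f : BarMap B.toGradedQuiver C.toGradedQuiver F F)
    (g : BarMap B.toGradedQuiver C.toGradedQuiver G G) (d : ℤ)
    (v : Comps B.toGradedQuiver C.toGradedQuiver F G) :
    Comps B.toGradedQuiver C.toGradedQuiver F G := fun X Y =>
  (C.b (F X) (G Y)) ∘ₗ (v.coder f d g X Y) - (d.negOnePow : ℤ) • ((v X Y) ∘ₗ (B.codiff X Y))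

/-- The components `∑_l (r ⊗ p)θ_{nl} b_l` of `(r ⊗ p)B₂`, for an `(f,g)`-coderivation `r` and
a `(g,h)`-coderivation `p`, both of degree `-1`. -/
def transfB₂ (f : BarMap B.toGradedQuiver C.toGradedQuiver F F)
    (g : BarMap B.toGradedQuiver C.toGradedQuiver G G)
    (h : BarMap B.toGradedQuiver C.toGradedQuiver H H)
    (r : Comps B.toGradedQuiver C.toGradedQuiver F G)
    (p : Comps B.toGradedQuiver C.toGradedQuiver G H) :
    Comps B.toGradedQuiver C.toGradedQuiver F H := fun X Y =>
  (C.b (F X) (H Y)) ∘ₗ (thetaMap f (-1) r g (-1) p h X Y)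

/-- `r : f → g` is a natural `A∞`-transformation: an `(f,g)`-coderivation of degree `-1` such
that `rB₁ = rb + br = 0`. -/
def IsNatTransf (f : BarMap B.toGradedQuiver C.toGradedQuiver F F)
    (g : BarMap B.toGradedQuiver C.toGradedQuiver G G)
    (r : Comps B.toGradedQuiver C.toGradedQuiver F G) : Prop :=
  r.HasDegree (-1) ∧ transfB₁ f g (-1) r = 0

/-- `r ≡ q : f → g`: there is an `(f,g)`-coderivation `v` of degree `-2` with `r - q = vB₁`.
The 2-morphisms of the 2-category `A∞` are the natural `A∞`-transformations modulo `≡`, and the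
composition `f → g → h` of `r` and `p` is represented by `(r ⊗ p)B₂`. -/
def TransfEquiv (f : BarMap B.toGradedQuiver C.toGradedQuiver F F)
    (g : BarMap B.toGradedQuiver C.toGradedQuiver G G)
    (r q : Comps B.toGradedQuiver C.toGradedQuiver F G) : Prop :=
  ∃ v : Comps B.toGradedQuiver C.toGradedQuiver F G,
    v.HasDegree (-2) ∧ r - q = transfB₁ f g (-2) v

/-- The components of the composite of an `A∞`-functor `g : B → C` with a transformation
`i : id → id : C → C`. -/
def whisker (g : AInfFunctor B C G)
    (i : Comps C.toGradedQuiver C.toGradedQuiver (fun X => X) (fun X => X)) :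
    Comps B.toGradedQuiver C.toGradedQuiver G G := fun X Y =>
  (i (G X) (G Y)) ∘ₗ (g.hom X Y)

end Transformations

section Unital

variable (C : AInfCat.{u, v} k)

/-- A chain map of degree `0` of the complex `(sC(X,Y), b₁)` into itself which is invertible up to
homotopy. -/
def IsHtpyInvertible {X Y : C.Ob} (a : C.Hom X Y →ₗ[k] C.Hom X Y) : Prop :=
  (∀ d, ∀ x ∈ C.sgr X Y d, a x ∈ C.sgr X Y d) ∧ C.b₁ X Y ∘ₗ a = a ∘ₗ C.b₁ X Y ∧
  ∃ c h h' : C.Hom X Y →ₗ[k] C.Hom X Y,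
    (∀ d, ∀ x ∈ C.sgr X Y d, c x ∈ C.sgr X Y d) ∧ C.b₁ X Y ∘ₗ c = c ∘ₗ C.b₁ X Y ∧
    (∀ d, ∀ x ∈ C.sgr X Y d, h x ∈ C.sgr X Y (d - 1)) ∧
    (∀ d, ∀ x ∈ C.sgr X Y d, h' x ∈ C.sgr X Y (d - 1)) ∧
    c ∘ₗ a - LinearMap.id = h ∘ₗ C.b₁ X Y + C.b₁ X Y ∘ₗ h ∧
    a ∘ₗ c - LinearMap.id = h' ∘ₗ C.b₁ X Y + C.b₁ X Y ∘ₗ h'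

/-- `i` is a unit transformation of `C`: a natural `A∞`-transformation `i : id → id : C → C` with
`(i ⊗ i)B₂ ≡ i`, such that for all objects `X`, `Y` the maps `(i₀ ⊗ 1)b₂`, `(1 ⊗ i₀)b₂` of
`sC(X,Y)` into itself are homotopy invertible. The `A∞`-category `C` is unital if it has a unit
transformation. -/
def IsUnitTransf (i : Comps C.toGradedQuiver C.toGradedQuiver (fun X => X) (fun X => X)) : Prop :=
  IsNatTransf (B := C) (C := C) (BarMap.ident _) (BarMap.ident _) i ∧
  TransfEquiv (B := C) (C := C) (BarMap.ident _) (BarMap.ident _)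
    (transfB₂ (B := C) (C := C) (BarMap.ident _) (BarMap.ident _) (BarMap.ident _) i i) i ∧
  ∀ X Y : C.Ob,
    IsHtpyInvertible C (C.b₂ X X Y (i X X (C.one X)) ∘ₗ C.sgn (-1) X Y) ∧
    IsHtpyInvertible C ((C.b₂ X Y Y).flip (i Y Y (C.one Y)))

end Unital

section HomComplex

variable {B : AInfCat.{u, v} k} (C : AInfCat.{u, w} k) {X₀ Xₙ : B.Ob} (N : ObPath X₀ Xₙ)

/-- `Hom_k^d(N, sC(U,V))`, where `N` stands for `sB(X₀,X₁) ⊗ … ⊗ sB(Xₙ₋₁,Xₙ)`: the `k`-linear maps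
of degree `d`. -/
def homDeg (U V : C.Ob) (d : ℤ) : Set (B.Tens N →ₗ[k] C.Hom U V) :=
  {y | ∀ e, ∀ x ∈ B.tgr N e, y x ∈ C.sgr U V (e + d)}

/-- The differential `y ↦ yb₁ - (-1)^d ∑ (1^{⊗q} ⊗ b₁ ⊗ 1^{⊗t}) y` of the complex
`Hom_k^•(N, sC(U,V))` on elements of degree `d`. -/
def homD (U V : C.Ob) (d : ℤ) (y : B.Tens N →ₗ[k] C.Hom U V) : B.Tens N →ₗ[k] C.Hom U V :=
  C.b₁ U V ∘ₗ y - (d.negOnePow : ℤ) • (y ∘ₗ B.tensD N)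

/-- `Hom(N, a) : Hom_k^•(N, sC(U,V)) → Hom_k^•(N, sC(U',V'))` is a quasi-isomorphism: in each
degree the induced map on cohomology is surjective and injective. -/
def IsHomQuasiIso {U V U' V' : C.Ob} (a : C.Hom U V →ₗ[k] C.Hom U' V') : Prop :=
  ∀ d : ℤ,
    (∀ y ∈ homDeg C N U' V' d, homD C N U' V' d y = 0 →
      ∃ x ∈ homDeg C N U V d, homD C N U V d x = 0 ∧
        ∃ z ∈ homDeg C N U' V' (d - 1), a ∘ₗ x - y = homD C N U' V' (d - 1) z) ∧
    (∀ x ∈ homDeg C N U V d, homD C N U V d x = 0 →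
      (∃ z ∈ homDeg C N U' V' (d - 1), a ∘ₗ x = homD C N U' V' (d - 1) z) →
        ∃ y ∈ homDeg C N U V (d - 1), x = homD C N U V (d - 1) y)

end HomComplex

end

noncomputable section

set_option maxSynthPendingDepth 3

namespace GradedQuiver

variable {k : Type u} [CommRing k] (A : GradedQuiver.{u, v} k)

/-! ### Elements of the tensor quiver -/

/-! For fixed functors the coderivations form a complex under B₁, filtered by the number of
arguments that their components need before they can be nonzero. The filtration is separated and
complete, because on a given tensor only finitely many components act. On the n-th graded piece B₁
is the differential of Hom(N, sC(-,-)) with N a product of n factors (`transfB₁_comp_ι`), and the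
operation p ↦ (r ⊗ p)B₂ is, up to sign, composition with (r₀ ⊗ 1)b₂ (`postB_theta_left_comp_ι`), a
quasi-isomorphism by hypothesis. Since rB₁ = 0, this operation anticommutes with B₁
(`mulLeft_transfB₁`), so it has a cone, and correcting leading terms one length at a time shows that
every cycle of the cone is a boundary (`exists_of_cone_cycle`). Applied to the cycle (0, r') this
produces p; applied to (p - q, y), where y realises r·p ≡ r·q, it gives p ≡ q. Thus r can be
cancelled on the left.

For invertibility, exchanging r and r' gives t with r'·t ≡ r. Then r·(p·t) ≡ r'·t ≡ r ≡ r·(g𝐢), and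
cancelling r gives p·t ≡ g𝐢; the other composite is symmetric. This needs associativity up to
equivalence, witnessed by the composite of three coderivations (`transfB₂_assoc`), and that g𝐢 is a
right unit. The latter follows from (r·g𝐢)·g𝐢 ≡ r·g𝐢 by cancelling g𝐢 on the right, which the same
cone argument allows because (1 ⊗ 𝐢₀)b₂ is homotopy invertible.

The identities between coderivations are proved through the convolution product `conv` of maps on
the tensor coalgebra. A cocategory homomorphism f with components φ satisfies f = unit + φ * f, and
since φ₀ = 0 such a recursion has only one solution. Formulas for comultiplications and
codifferentials are therefore obtained by checking that both sides solve the same recursion. -/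

lemma ofSummands_ι {X Y : A.Ob} {M : Type w} [AddCommMonoid M] [Module k M]
    (φ : (p : ObPath X Y) → (A.Tens p →ₗ[k] M)) (p : ObPath X Y) (t : A.Tens p) :
    A.ofSummands φ (A.ι p t) = φ p t := by
  classical
  exact DirectSum.toModule_lof (M := fun p => (A.Tens p : Type u)) k p t

lemma bar_induction {X Y : A.Ob} {P : A.Bar X Y → Prop} (zero : P 0)
    (add : ∀ s t, P s → P t → P (s + t)) (ι : ∀ p t, P (A.ι p t)) (t : A.Bar X Y) : P t := by
  classical
  induction t using DirectSum.induction_on with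
  | zero => exact zero
  | of p t => exact ι p t
  | add s t hs ht => exact add s t hs ht

lemma bar_hom_ext {X Y : A.Ob} {M : Type w} [AddCommMonoid M] [Module k M]
    {φ ψ : A.Bar X Y →ₗ[k] M} (h : ∀ p t, φ (A.ι p t) = ψ (A.ι p t)) : φ = ψ := by
  ext t
  induction t using A.bar_induction with
  | zero => simp
  | add s t hs ht => simp [hs, ht]
  | ι p t => exact h p t

lemma consT_ι {X Z Y : A.Ob} (x : A.Hom X Z) (p : ObPath Z Y) (t : A.Tens p) :
    A.consT x (A.ι p t) = A.ι (.cons X p) (A.tensCons X p (x ⊗ₜ t)) := by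
  simp only [consT, LinearMap.flip_apply, ofSummands_ι]
  rfl

/-- Induction on the number of tensor factors. -/
lemma tens_induction {Y : A.Ob} {P : ∀ {X} (p : ObPath X Y), A.Tens p → Prop}
    (zero : ∀ X (p : ObPath X Y), P p 0)
    (add : ∀ X (p : ObPath X Y) s t, P p s → P p t → P p (s + t))
    (nil : ∀ c : k, P (.nil Y) (A.tensNil Y c))
    (cons : ∀ X Z (x : A.Hom X Z) (p : ObPath Z Y) t, P p t →
      P (.cons X p) (A.tensCons X p (x ⊗ₜ t)))
    {X : A.Ob} (p : ObPath X Y) (t : A.Tens p) : P p t := by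
  induction p with
  | nil X => exact nil t
  | cons X p ih =>
    obtain ⟨t, rfl⟩ := (A.tensCons X p).surjective t
    induction t using TensorProduct.induction_on with
    | zero => rw [map_zero]; exact zero _ _
    | add s t hs ht => rw [map_add]; exact add _ _ _ _ hs ht
    | tmul x t => exact cons _ _ x p t (ih zero add nil cons t)

lemma ι_nil (X : A.Ob) (c : k) : A.ι (.nil X) (A.tensNil X c) = c • A.one X := by
  rw [one, ← map_smul, ← map_smul, smul_eq_mul, mul_one]

/-- Induction on tensors, adding factors from the left. -/
lemma bar_cons_induction {Y : A.Ob} {P : ∀ X, A.Bar X Y → Prop} (zero : ∀ X, P X 0)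
    (add : ∀ X s t, P X s → P X t → P X (s + t)) (smul : ∀ c : k, P Y (c • A.one Y))
    (cons : ∀ X Z (x : A.Hom X Z) t, P Z t → P X (A.consT x t)) {X : A.Ob} (t : A.Bar X Y) :
    P X t := by
  induction t using A.bar_induction with
  | zero => exact zero X
  | add s t hs ht => exact add X s t hs ht
  | ι p t =>
    refine A.tens_induction (P := fun {X} p t => P X (A.ι p t)) ?_ ?_ ?_ ?_ p t
    · intro X p; rw [map_zero]; exact zero X
    · intro X p s t hs ht; rw [map_add]; exact add X _ _ hs ht
    · intro c; rw [ι_nil]; exact smul c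
    · intro X Z x p t h; rw [← consT_ι]; exact cons X Z x _ h

/-- Concatenation of tensors as a bilinear map. -/
def mul (X Z Y : A.Ob) : A.Bar X Z →ₗ[k] A.Bar Z Y →ₗ[k] A.Bar X Y :=
  (TensorProduct.mk k _ _).compr₂ (A.concat X Z Y)

lemma one_mul {X Y : A.Ob} (t : A.Bar X Y) : A.mul X X Y (A.one X) t = t := by
  simp only [mul, concat, LinearMap.compr₂_apply, TensorProduct.mk_apply, TensorProduct.lift.tmul,
    one, ofSummands_ι, concatAux, LinearMap.comp_apply, LinearEquiv.coe_coe,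
    LinearEquiv.symm_apply_apply, LinearMap.lsmul_apply, one_smul]

lemma cons_mul {X Z W Y : A.Ob} (x : A.Hom X Z) (s : A.Bar Z W) (t : A.Bar W Y) :
    A.mul X W Y (A.consT x s) t = A.consT x (A.mul Z W Y s t) := by
  induction s using A.bar_induction with
  | zero => simp
  | add s s' hs hs' => simp only [map_add, LinearMap.add_apply, hs, hs']
  | ι p s =>
    rw [consT_ι]
    simp only [mul, concat, LinearMap.compr₂_apply, TensorProduct.mk_apply,
      TensorProduct.lift.tmul, ofSummands_ι, concatAux, LinearMap.comp_apply, LinearEquiv.coe_coe,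
      LinearEquiv.symm_apply_apply]
    rfl

lemma mul_assoc {X Z W Y : A.Ob} (r : A.Bar X Z) (s : A.Bar Z W) (t : A.Bar W Y) :
    A.mul X W Y (A.mul X Z W r s) t = A.mul X Z Y r (A.mul Z W Y s t) := by
  refine A.bar_cons_induction
    (P := fun X r => A.mul X W Y (A.mul X Z W r s) t = A.mul X Z Y r (A.mul Z W Y s t))
    ?_ ?_ ?_ ?_ r
  · simp
  · intro X r r' h h'; simp only [map_add, LinearMap.add_apply, h, h']
  · intro c; simp [one_mul]
  · intro X Z x t h; simp only [cons_mul, h]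

lemma inc_mul {X Z Y : A.Ob} (x : A.Hom X Z) (t : A.Bar Z Y) :
    A.mul X Z Y (A.inc X Z x) t = A.consT x t := by
  simp [inc, cons_mul, one_mul]

/-- `s ↦ t ↦ s ⨂ t` as a bilinear map into `TsA ⊗ TsA`. -/
def pair (X Z Y : A.Ob) : A.Bar X Z →ₗ[k] A.Bar Z Y →ₗ[k] A.BarBar X Y := by
  classical
  exact (TensorProduct.mk k _ _).compr₂
    (DirectSum.lof k A.Ob (fun Z => A.Bar X Z ⊗[k] A.Bar Z Y) Z)

lemma oneT_apply {X Y : A.Ob} (t : A.Bar X Y) : A.oneT X Y t = A.pair X X Y (A.one X) t := rfl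

lemma consTT_pair {X Z W Y : A.Ob} (x : A.Hom X Z) (s : A.Bar Z W) (t : A.Bar W Y) :
    A.consTT x (A.pair Z W Y s t) = A.pair X W Y (A.consT x s) t := by
  classical
  simp only [consTT, pair, LinearMap.flip_apply, LinearMap.compr₂_apply, TensorProduct.mk_apply]
  erw [DirectSum.toModule_lof]
  simp

lemma cut_one (X : A.Ob) : A.cut X X (A.one X) = A.pair X X X (A.one X) (A.one X) := by
  rw [cut]
  conv_lhs => rw [one]
  rw [ofSummands_ι]
  rfl

lemma cut_cons {X Z Y : A.Ob} (x : A.Hom X Z) (t : A.Bar Z Y) :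
    A.cut X Y (A.consT x t) =
      A.pair X X Y (A.one X) (A.consT x t) + A.consTT x (A.cut Z Y t) := by
  induction t using A.bar_induction with
  | zero => simp
  | add s t hs ht => simp only [map_add, hs, ht]; abel
  | ι p t =>
    rw [consT_ι]
    simp only [cut, ofSummands_ι, cutAux, LinearMap.add_apply, LinearMap.comp_apply,
      LinearEquiv.coe_coe, LinearEquiv.symm_apply_apply, oneT_apply]
    rfl

/-- The linear map out of `TsA ⊗ TsA` determined by bilinear maps. -/
def ofPairs {X Y : A.Ob} {T : Type w} [AddCommGroup T] [Module k T]
    (β : ∀ Z, A.Bar X Z →ₗ[k] A.Bar Z Y →ₗ[k] T) : A.BarBar X Y →ₗ[k] T := by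
  classical
  exact DirectSum.toModule k A.Ob T fun Z => TensorProduct.lift (β Z)

lemma ofPairs_pair {X Y : A.Ob} {T : Type w} [AddCommGroup T] [Module k T]
    (β : ∀ Z, A.Bar X Z →ₗ[k] A.Bar Z Y →ₗ[k] T) (Z : A.Ob) (s : A.Bar X Z) (t : A.Bar Z Y) :
    A.ofPairs β (A.pair X Z Y s t) = β Z s t := by
  classical
  simp only [ofPairs, pair, LinearMap.compr₂_apply, TensorProduct.mk_apply]
  erw [DirectSum.toModule_lof]
  simp

lemma barBar_hom_ext {X Y : A.Ob} {T : Type w} [AddCommMonoid T] [Module k T]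
    {φ ψ : A.BarBar X Y →ₗ[k] T}
    (h : ∀ Z s t, φ (A.pair X Z Y s t) = ψ (A.pair X Z Y s t)) : φ = ψ := by
  classical
  apply DirectSum.linearMap_ext
  intro Z
  apply TensorProduct.ext'
  intro s t
  exact h Z s t

/-- `t ↦ tΔβ`: the sum of the values of `β` over all the ways to cut `t` in two. -/
def sweep {X Y : A.Ob} {T : Type w} [AddCommGroup T] [Module k T]
    (β : ∀ Z, A.Bar X Z →ₗ[k] A.Bar Z Y →ₗ[k] T) : A.Bar X Y →ₗ[k] T :=
  A.ofPairs β ∘ₗ A.cut X Y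

/-! ### Sums over all cuts of a tensor -/

section sweep

variable {X Y : A.Ob} {T : Type w} [AddCommGroup T] [Module k T]
  (β : ∀ Z, A.Bar X Z →ₗ[k] A.Bar Z Y →ₗ[k] T)

lemma sweep_one {X : A.Ob} (β : ∀ Z, A.Bar X Z →ₗ[k] A.Bar Z X →ₗ[k] T) :
    A.sweep β (A.one X) = β X (A.one X) (A.one X) := by
  rw [sweep, LinearMap.comp_apply, cut_one, ofPairs_pair]

lemma sweep_cons {Z : A.Ob} (x : A.Hom X Z) (t : A.Bar Z Y) :
    A.sweep β (A.consT x t) =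
      β X (A.one X) (A.consT x t) + A.sweep (fun W => β W ∘ₗ A.consT x) t := by
  have : A.ofPairs β ∘ₗ A.consTT x = A.ofPairs (X := Z) (fun W => β W ∘ₗ A.consT x) := by
    apply A.barBar_hom_ext
    intro W s t
    rw [LinearMap.comp_apply, consTT_pair, ofPairs_pair, ofPairs_pair, LinearMap.comp_apply]
  rw [sweep, LinearMap.comp_apply, cut_cons, map_add, ofPairs_pair,
    ← LinearMap.comp_apply (A.ofPairs β), this]
  rfl

lemma map_ofPairs {T' : Type*} [AddCommGroup T'] [Module k T'] (L : T →ₗ[k] T') (t : A.BarBar X Y) :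
    L (A.ofPairs β t) = A.ofPairs (fun Z => (β Z).compr₂ L) t := by
  rw [← LinearMap.comp_apply]
  congr 1
  apply A.barBar_hom_ext
  intro Z s t
  rw [LinearMap.comp_apply, ofPairs_pair, ofPairs_pair, LinearMap.compr₂_apply]

lemma map_sweep {T' : Type*} [AddCommGroup T'] [Module k T'] (L : T →ₗ[k] T') (t : A.Bar X Y) :
    L (A.sweep β t) = A.sweep (fun Z => (β Z).compr₂ L) t :=
  A.map_ofPairs β L _

lemma sweep_add (β' : ∀ Z, A.Bar X Z →ₗ[k] A.Bar Z Y →ₗ[k] T) (t : A.Bar X Y) :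
    A.sweep (fun Z => β Z + β' Z) t = A.sweep β t + A.sweep β' t := by
  rw [sweep, sweep, sweep, ← LinearMap.add_apply, ← LinearMap.add_comp]
  congr 2
  apply A.barBar_hom_ext
  intro Z s t
  simp only [LinearMap.add_apply, ofPairs_pair]

lemma sweep_smul {R : Type*} [Monoid R] [DistribMulAction R T] [SMulCommClass k R T] (c : R)
    (t : A.Bar X Y) :
    A.sweep (fun Z => c • β Z) t = c • A.sweep β t := by
  rw [sweep, sweep, LinearMap.comp_apply, LinearMap.comp_apply, ← LinearMap.smul_apply]
  congr 1
  apply A.barBar_hom_ext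
  intro Z s t
  simp only [LinearMap.smul_apply, ofPairs_pair]

variable {β} in
lemma sweep_congr {β' : ∀ Z, A.Bar X Z →ₗ[k] A.Bar Z Y →ₗ[k] T}
    (h : ∀ Z s t, β Z s t = β' Z s t) : A.sweep β = A.sweep β' := by
  have : β = β' := by ext Z : 1; exact LinearMap.ext₂ (h Z)
  rw [this]

lemma sweep_congr_apply {β β' : ∀ Z, A.Bar X Z →ₗ[k] A.Bar Z Y →ₗ[k] T}
    (h : ∀ Z s t, β Z s t = β' Z s t) (t : A.Bar X Y) : A.sweep β t = A.sweep β' t := by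
  rw [A.sweep_congr h]

/-- Coassociativity of the cut comultiplication. -/
lemma sweep_assoc (γ : ∀ Z W, A.Bar X Z →ₗ[k] A.Bar Z W →ₗ[k] A.Bar W Y →ₗ[k] T)
    (β₁ β₂ : ∀ Z, A.Bar X Z →ₗ[k] A.Bar Z Y →ₗ[k] T)
    (h₁ : ∀ W u w, β₁ W u w =
      A.sweep (fun Z => (γ Z W).compr₂ (LinearMap.applyₗ (R := k) (M₂ := T) w)) u)
    (h₂ : ∀ Z u v, β₂ Z u v = A.sweep (fun W => γ Z W u) v) (t : A.Bar X Y) :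
    A.sweep β₁ t = A.sweep β₂ t := by
  revert γ β₁ β₂
  refine A.bar_cons_induction (Y := Y) (P := fun X t => ∀
    (γ : ∀ Z W, A.Bar X Z →ₗ[k] A.Bar Z W →ₗ[k] A.Bar W Y →ₗ[k] T)
    (β₁ β₂ : ∀ Z, A.Bar X Z →ₗ[k] A.Bar Z Y →ₗ[k] T),
    (∀ W u w, β₁ W u w = A.sweep (fun Z => (γ Z W).compr₂ (LinearMap.applyₗ (R := k) (M₂ := T) w)) u)
    → (∀ Z u v, β₂ Z u v = A.sweep (fun W => γ Z W u) v) → A.sweep β₁ t = A.sweep β₂ t)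
    ?_ ?_ ?_ ?_ t
  · intros; simp
  · intro X s t hs ht γ β₁ β₂ h₁ h₂
    rw [map_add, map_add, hs γ β₁ β₂ h₁ h₂, ht γ β₁ β₂ h₁ h₂]
  · intro c γ β₁ β₂ h₁ h₂
    rw [map_smul, map_smul, sweep_one, sweep_one, h₁, h₂, sweep_one, sweep_one]
    rfl
  · intro X Z x t ih γ β₁ β₂ h₁ h₂
    -- In x ⊗ t the cuts with an empty first piece are not of the form x ⊗ (cut of t). They are
    -- subtracted from `β₁` so that the induction hypothesis applies; on the other side they make up
    -- the first summand of `sweep_cons`.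
    have key := ih (fun Z W => γ Z W ∘ₗ A.consT x)
      (fun W => β₁ W ∘ₗ A.consT x - (γ X W (A.one X)) ∘ₗ A.consT x)
      (fun W => β₂ W ∘ₗ A.consT x) ?_ ?_
    · have e : (fun W => β₁ W ∘ₗ A.consT x) = fun W =>
          (β₁ W ∘ₗ A.consT x - (γ X W (A.one X)) ∘ₗ A.consT x) +
          (γ X W (A.one X)) ∘ₗ A.consT x := by
        ext W : 1; abel
      rw [sweep_cons, sweep_cons, ← key, e, sweep_add, h₁, h₂, sweep_one, sweep_cons]
      simp only [LinearMap.compr₂_apply, LinearMap.applyₗ_apply_apply]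
      abel
    · intro W u w
      simp only [LinearMap.sub_apply, LinearMap.comp_apply, h₁, sweep_cons,
        LinearMap.compr₂_apply, LinearMap.applyₗ_apply_apply, add_sub_cancel_left]
      rfl
    · intro W u v
      simp only [LinearMap.comp_apply, h₂]

end sweep

end GradedQuiver

namespace GradedQuiver

variable {k : Type u} [CommRing k] (A : GradedQuiver.{u, v} k)

/-! ### Signs -/

lemma sgn_of_mem_gr (m : ℤ) {X Y : A.Ob} {j : ℤ} {x : A.Hom X Y} (hx : x ∈ A.gr X Y j) :
    A.sgn m X Y x = ((m * (j - 1)).negOnePow : ℤ) • x := by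
  rw [sgn, LinearMap.comp_apply, LinearEquiv.coe_coe, DirectSum.decomposeLinearEquiv_apply,
    DirectSum.decompose_of_mem _ hx]
  erw [DirectSum.toModule_lof]
  rfl

lemma sgn_of_mem (m : ℤ) {X Y : A.Ob} {d : ℤ} {x : A.Hom X Y} (hx : x ∈ A.sgr X Y d) :
    A.sgn m X Y x = ((m * d).negOnePow : ℤ) • x := by
  rw [A.sgn_of_mem_gr m hx, add_sub_cancel_right]

lemma hom_induction {X Y : A.Ob} {P : A.Hom X Y → Prop} (zero : P 0)
    (add : ∀ x y, P x → P y → P (x + y)) (homog : ∀ d, ∀ x ∈ A.sgr X Y d, P x) (x : A.Hom X Y) :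
    P x := by
  induction x using DirectSum.Decomposition.inductionOn (A.gr X Y) with
  | zero => exact zero
  | @homogeneous i x =>
    refine homog (i - 1) x ?_
    rw [sgr, sub_add_cancel]
    exact x.2
  | add x y hx hy => exact add x y hx hy

lemma sgn_zero {X Y : A.Ob} (x : A.Hom X Y) : A.sgn 0 X Y x = x := by
  induction x using A.hom_induction with
  | zero => simp
  | add x y hx hy => simp [hx, hy]
  | homog d x hx => simp [A.sgn_of_mem 0 hx]

lemma sgn_add (m n : ℤ) {X Y : A.Ob} (x : A.Hom X Y) :
    A.sgn (m + n) X Y x = A.sgn m X Y (A.sgn n X Y x) := by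
  induction x using A.hom_induction with
  | zero => simp
  | add x y hx hy => simp [hx, hy]
  | homog d x hx =>
    rw [A.sgn_of_mem _ hx, A.sgn_of_mem _ hx, map_zsmul, A.sgn_of_mem _ hx, smul_smul, add_mul,
      Int.negOnePow_add, Units.val_mul, mul_comm]

lemma barSgn_ι (m : ℤ) {X Y : A.Ob} (p : ObPath X Y) (t : A.Tens p) :
    A.barSgn m X Y (A.ι p t) = A.ι p (A.tsgn m p t) := by
  rw [barSgn, ofSummands_ι, LinearMap.comp_apply]

lemma barSgn_one (m : ℤ) (X : A.Ob) : A.barSgn m X X (A.one X) = A.one X := by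
  rw [one, barSgn_ι]; rfl

lemma barSgn_cons (m : ℤ) {X Z Y : A.Ob} (x : A.Hom X Z) (t : A.Bar Z Y) :
    A.barSgn m X Y (A.consT x t) = A.consT (A.sgn m X Z x) (A.barSgn m Z Y t) := by
  induction t using A.bar_induction with
  | zero => simp
  | add s t hs ht => simp only [map_add, hs, ht]
  | ι p t =>
    rw [consT_ι, barSgn_ι, barSgn_ι, consT_ι]
    congr 1

lemma barSgn_zero {X Y : A.Ob} (t : A.Bar X Y) : A.barSgn 0 X Y t = t := by
  refine A.bar_cons_induction (P := fun X t => A.barSgn 0 X Y t = t) ?_ ?_ ?_ ?_ t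
  · simp
  · intro X s t hs ht; rw [map_add, hs, ht]
  · intro c; rw [map_smul, barSgn_one]
  · intro X Z x t h; rw [barSgn_cons, h, sgn_zero]

lemma barSgn_add (m n : ℤ) {X Y : A.Ob} (t : A.Bar X Y) :
    A.barSgn (m + n) X Y t = A.barSgn m X Y (A.barSgn n X Y t) := by
  refine A.bar_cons_induction
    (P := fun X t => A.barSgn (m + n) X Y t = A.barSgn m X Y (A.barSgn n X Y t)) ?_ ?_ ?_ ?_ t
  · simp
  · intro X s t hs ht; simp only [map_add, hs, ht]
  · intro c; simp only [map_smul, barSgn_one]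
  · intro X Z x t h; simp only [barSgn_cons, h, sgn_add]

/-- The sign (-1)^{m·deg} is multiplicative along tensors, so it may be applied to the two pieces of
a cut separately. -/
lemma sweep_barSgn (m : ℤ) {X Y : A.Ob} {T : Type w} [AddCommGroup T] [Module k T]
    (β : ∀ Z, A.Bar X Z →ₗ[k] A.Bar Z Y →ₗ[k] T) (t : A.Bar X Y) :
    A.sweep β (A.barSgn m X Y t) =
      A.sweep (fun Z => (β Z).compl₁₂ (A.barSgn m X Z) (A.barSgn m Z Y)) t := by
  revert β
  refine A.bar_cons_induction (Y := Y) (P := fun X t => ∀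
    (β : ∀ Z, A.Bar X Z →ₗ[k] A.Bar Z Y →ₗ[k] T), A.sweep β (A.barSgn m X Y t) =
      A.sweep (fun Z => (β Z).compl₁₂ (A.barSgn m X Z) (A.barSgn m Z Y)) t) ?_ ?_ ?_ ?_ t
  · simp
  · intro X s t hs ht β; simp only [map_add, hs, ht]
  · intro c β
    simp only [map_smul, barSgn_one, sweep_one, LinearMap.compl₁₂_apply]
  · intro X Z x t h β
    simp only [barSgn_cons, sweep_cons, h, LinearMap.compl₁₂_apply, barSgn_one]
    congr 2
    apply sweep_congr
    intro W s t
    simp only [LinearMap.compl₁₂_apply, LinearMap.comp_apply, barSgn_cons]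

/-! ### Gradings -/

/-- The elements of degree `d` of `TsA(X,Y)`. -/
def bgr (X Y : A.Ob) (d : ℤ) : Submodule k (A.Bar X Y) := ⨆ p, (A.tgr p d).map (A.ι p)

variable {A}

lemma ι_mem_bgr {X Y : A.Ob} {p : ObPath X Y} {d : ℤ} {t : A.Tens p} (ht : t ∈ A.tgr p d) :
    A.ι p t ∈ A.bgr X Y d :=
  Submodule.mem_iSup_of_mem p (Submodule.mem_map_of_mem ht)

lemma bgr_le {X Y : A.Ob} {d : ℤ} {N : Submodule k (A.Bar X Y)}
    (h : ∀ p, ∀ t ∈ A.tgr p d, A.ι p t ∈ N) : A.bgr X Y d ≤ N :=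
  iSup_le fun p => Submodule.map_le_iff_le_comap.2 fun t ht => h p t ht

lemma tgr_cons_le {X Z Y : A.Ob} {p : ObPath Z Y} {d : ℤ} {N : Submodule k (A.Tens (.cons X p))}
    (h : ∀ i, ∀ x ∈ A.sgr X Z i, ∀ t ∈ A.tgr p (d - i), A.tensCons X p (x ⊗ₜ t) ∈ N) :
    A.tgr (.cons X p) d ≤ N :=
  iSup_le fun i => Submodule.map₂_le.2 fun x hx t ht => h i x hx t ht

lemma tensCons_mem_tgr {X Z Y : A.Ob} {p : ObPath Z Y} {d i : ℤ} {x : A.Hom X Z} {t : A.Tens p}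
    (hx : x ∈ A.sgr X Z i) (ht : t ∈ A.tgr p (d - i)) :
    A.tensCons X p (x ⊗ₜ t) ∈ A.tgr (.cons X p) d :=
  Submodule.mem_iSup_of_mem i (Submodule.apply_mem_map₂ _ hx ht)

lemma one_mem_bgr (X : A.Ob) : A.one X ∈ A.bgr X X 0 := by
  apply ι_mem_bgr
  simp [tgr]

lemma consT_mem_bgr {X Z Y : A.Ob} {i j d : ℤ} (h : i + j = d) {x : A.Hom X Z} {t : A.Bar Z Y}
    (hx : x ∈ A.sgr X Z i) (ht : t ∈ A.bgr Z Y j) : A.consT x t ∈ A.bgr X Y d := by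
  have : A.bgr Z Y j ≤ (A.bgr X Y d).comap (A.consT x) := by
    apply bgr_le
    intro p t ht
    rw [Submodule.mem_comap, consT_ι]
    apply ι_mem_bgr
    apply tensCons_mem_tgr hx
    rwa [← h, add_sub_cancel_left]
  exact this ht

/-- Cutting preserves total degree. In the induction the first factor is absorbed into `β`, which is
why `β` and `d` both vary. -/
lemma sweep_mem_of_degree {X Y : A.Ob} {T : Type w} [AddCommGroup T] [Module k T]
    {N : Submodule k T} {β : ∀ Z, A.Bar X Z →ₗ[k] A.Bar Z Y →ₗ[k] T} {d : ℤ}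
    (h : ∀ Z i j, i + j = d → ∀ s ∈ A.bgr X Z i, ∀ t ∈ A.bgr Z Y j, β Z s t ∈ N)
    {t : A.Bar X Y} (ht : t ∈ A.bgr X Y d) : A.sweep β t ∈ N := by
  suffices H : ∀ p : ObPath X Y, ∀ t ∈ A.tgr p d, A.sweep β (A.ι p t) ∈ N from
    (bgr_le (N := N.comap (A.sweep β)) H) ht
  intro p
  clear ht t
  induction p generalizing d with
  | nil X =>
    intro t ht
    obtain ⟨c, rfl⟩ := (A.tensNil X).surjective t
    rw [ι_nil, map_smul, sweep_one]
    by_cases hd : d = 0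
    · subst hd
      exact N.smul_mem c (h X 0 0 rfl _ (one_mem_bgr X) _ (one_mem_bgr X))
    · rw [tgr, if_neg hd, Submodule.mem_bot] at ht
      have : c = 0 := ht
      rw [this, zero_smul]
      exact N.zero_mem
  | @cons X Z Y p ih =>
    intro t ht
    refine (tgr_cons_le (N := N.comap (A.sweep β ∘ₗ A.ι _)) ?_) ht
    intro i x hx t ht
    rw [Submodule.mem_comap, LinearMap.comp_apply, ← consT_ι, sweep_cons]
    refine N.add_mem ?_ ?_
    · exact h X 0 d (zero_add d) _ (one_mem_bgr X) _
        (consT_mem_bgr (add_sub_cancel i d) hx (ι_mem_bgr ht))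
    · refine ih (d := d - i) ?_ t ht
      intro W a b hab s hs t ht
      exact h W (i + a) b (by omega) _ (consT_mem_bgr rfl hx hs) t ht

lemma mul_mem_bgr {X Z Y : A.Ob} {i j d : ℤ} (h : i + j = d) {s : A.Bar X Z} {t : A.Bar Z Y}
    (hs : s ∈ A.bgr X Z i) (ht : t ∈ A.bgr Z Y j) : A.mul X Z Y s t ∈ A.bgr X Y d := by
  suffices H : ∀ p : ObPath X Z, ∀ d i, i + j = d → ∀ s ∈ A.tgr p i,
      A.mul X Z Y (A.ι p s) t ∈ A.bgr X Y d from
    (bgr_le (N := (A.bgr X Y d).comap ((A.mul X Z Y).flip t)) (fun p s hs => H p d i h s hs)) hs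
  intro p
  clear hs s h d i
  induction p with
  | nil X =>
    intro d i h s hs
    obtain ⟨c, rfl⟩ := (A.tensNil X).surjective s
    rw [ι_nil, map_smul, LinearMap.smul_apply, one_mul]
    by_cases hi : i = 0
    · subst hi
      rw [← h, zero_add]
      exact Submodule.smul_mem _ c ht
    · rw [tgr, if_neg hi, Submodule.mem_bot] at hs
      have : c = 0 := hs
      rw [this, zero_smul]
      exact Submodule.zero_mem _
  | @cons X W Z p ih =>
    intro d i h s hs
    refine (tgr_cons_le (N := (A.bgr X Y d).comap ((A.mul X Z Y).flip t ∘ₗ A.ι _)) ?_) hs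
    intro i' x hx s hs
    rw [Submodule.mem_comap, LinearMap.comp_apply, ← consT_ι, LinearMap.flip_apply, cons_mul]
    exact consT_mem_bgr (by omega) hx (ih ht (i - i' + j) (i - i') rfl s hs)

lemma barSgn_of_mem (m : ℤ) {X Y : A.Ob} {d : ℤ} {t : A.Bar X Y} (ht : t ∈ A.bgr X Y d) :
    A.barSgn m X Y t = ((m * d).negOnePow : ℤ) • t := by
  suffices H : ∀ p : ObPath X Y, ∀ d, ∀ t ∈ A.tgr p d,
      A.barSgn m X Y (A.ι p t) = ((m * d).negOnePow : ℤ) • A.ι p t by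
    have := (bgr_le (N := LinearMap.ker (A.barSgn m X Y - ((m * d).negOnePow : ℤ) • LinearMap.id))
      (fun p t ht => by
        rw [LinearMap.mem_ker, LinearMap.sub_apply, sub_eq_zero, H p d t ht]; rfl)) ht
    rw [LinearMap.mem_ker, LinearMap.sub_apply, sub_eq_zero] at this
    rw [this]; rfl
  intro p
  clear ht t d
  induction p with
  | nil X =>
    intro d t ht
    obtain ⟨c, rfl⟩ := (A.tensNil X).surjective t
    by_cases hd : d = 0
    · subst hd
      rw [ι_nil, map_smul, barSgn_one]
      simp
    · rw [tgr, if_neg hd, Submodule.mem_bot] at ht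
      rw [ht]; simp
  | @cons X Z Y p ih =>
    intro d t ht
    have := (tgr_cons_le (N := LinearMap.ker
      ((A.barSgn m X Y - ((m * d).negOnePow : ℤ) • LinearMap.id) ∘ₗ A.ι _)) ?_) ht
    · rw [LinearMap.mem_ker, LinearMap.comp_apply, LinearMap.sub_apply, sub_eq_zero] at this
      rw [this]; rfl
    · intro i x hx t ht
      rw [LinearMap.mem_ker, LinearMap.comp_apply, LinearMap.sub_apply, sub_eq_zero, ← consT_ι,
        barSgn_cons, ih _ t ht, A.sgn_of_mem m hx]
      simp only [map_zsmul, LinearMap.smul_apply, LinearMap.id_apply, smul_smul]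
      congr 1
      rw [← Units.val_mul, ← Int.negOnePow_add]
      congr 2
      ring

lemma iSup_bgr (X Y : A.Ob) : ⨆ d, A.bgr X Y d = ⊤ := by
  rw [eq_top_iff]
  rintro t -
  refine A.bar_cons_induction (P := fun X t => t ∈ ⨆ d, A.bgr X Y d) ?_ ?_ ?_ ?_ t
  · intro X; exact Submodule.zero_mem _
  · intro X s t hs ht; exact Submodule.add_mem _ hs ht
  · intro c; exact Submodule.smul_mem _ c (Submodule.mem_iSup_of_mem 0 (one_mem_bgr Y))
  · intro X Z x t ht
    have : (⨆ d, A.bgr Z Y d) ≤ (⨆ d, A.bgr X Y d).comap (A.consT x) := by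
      apply iSup_le
      intro j t ht
      rw [Submodule.mem_comap]
      induction x using A.hom_induction with
      | zero => simp
      | add x y hx hy => rw [map_add]; exact Submodule.add_mem _ hx hy
      | homog i x hx => exact Submodule.mem_iSup_of_mem (i + j) (consT_mem_bgr rfl hx ht)
    exact this ht

lemma bar_hom_ext_of_degree {X Y : A.Ob} {M : Type w} [AddCommGroup M] [Module k M]
    {φ ψ : A.Bar X Y →ₗ[k] M} (h : ∀ d, ∀ t ∈ A.bgr X Y d, φ t = ψ t) : φ = ψ := by
  have : (⨆ d, A.bgr X Y d) ≤ LinearMap.eqLocus φ ψ := iSup_le h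
  rw [iSup_bgr] at this
  ext t
  exact this Submodule.mem_top

/-! ### Lengths -/

-- Cutting preserves the total number of factors. With `N = ⊥` this is the main tool for showing
-- that a sum over cuts vanishes for reasons of length.
variable (A) in
lemma sweep_mem_of_length {X Y : A.Ob} {T : Type w} [AddCommGroup T] [Module k T]
    {N : Submodule k T} {β : ∀ Z, A.Bar X Z →ₗ[k] A.Bar Z Y →ₗ[k] T} {p : ObPath X Y}
    (h : ∀ Z (q : ObPath X Z) (q' : ObPath Z Y), q.length + q'.length = p.length →
      ∀ s t, β Z (A.ι q s) (A.ι q' t) ∈ N) (t : A.Tens p) : A.sweep β (A.ι p t) ∈ N := by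
  induction p with
  | nil X =>
    obtain ⟨c, rfl⟩ := (A.tensNil X).surjective t
    rw [ι_nil, map_smul, sweep_one]
    exact N.smul_mem c (h X (.nil X) (.nil X) rfl _ _)
  | @cons X Z Y p ih =>
    obtain ⟨t, rfl⟩ := (A.tensCons X p).surjective t
    induction t using TensorProduct.induction_on with
    | zero => simp
    | add s t hs ht => simp only [map_add]; exact N.add_mem hs ht
    | tmul x t =>
      rw [← consT_ι, sweep_cons]
      refine N.add_mem ?_ ?_
      · rw [consT_ι]
        exact h X (.nil X) (.cons X p) (by simp [ObPath.length]) _ _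
      · apply ih
        intro W q q' hq s t
        rw [LinearMap.comp_apply, consT_ι]
        exact h W (.cons X q) q' (by simp only [ObPath.length]; omega) _ _

/-- The value of `sweep β` when only the last summand of the cut contributes. -/
lemma sweep_eq_last {X Y : A.Ob} {T : Type w} [AddCommGroup T] [Module k T]
    {β : ∀ Z, A.Bar X Z →ₗ[k] A.Bar Z Y →ₗ[k] T} {p : ObPath X Y}
    (h : ∀ Z (q : ObPath X Z) (q' : ObPath Z Y), q.length < p.length →
      ∀ s t, β Z (A.ι q s) (A.ι q' t) = 0) (t : A.Tens p) :
    A.sweep β (A.ι p t) = β Y (A.ι p t) (A.one Y) := by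
  induction p with
  | nil X =>
    obtain ⟨c, rfl⟩ := (A.tensNil X).surjective t
    rw [ι_nil, map_smul, map_smul, sweep_one, LinearMap.smul_apply]
  | @cons X Z Y p ih =>
    obtain ⟨t, rfl⟩ := (A.tensCons X p).surjective t
    induction t using TensorProduct.induction_on with
    | zero => simp
    | add s t hs ht => simp only [map_add, LinearMap.add_apply, hs, ht]
    | tmul x t =>
      rw [← consT_ι, sweep_cons, ih, consT_ι]
      · rw [one, h X (.nil X) (.cons X p) (by simp [ObPath.length]), zero_add, ← consT_ι]; rfl
      · intro W q q' hq s t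
        rw [LinearMap.comp_apply, consT_ι]
        exact h W (.cons X q) q' (by simp only [ObPath.length]; omega) _ _

/-- The value of `sweep β` when only the first summand of the cut contributes. -/
lemma sweep_eq_first {X Y : A.Ob} {T : Type w} [AddCommGroup T] [Module k T]
    {β : ∀ Z, A.Bar X Z →ₗ[k] A.Bar Z Y →ₗ[k] T} {p : ObPath X Y}
    (h : ∀ Z (q : ObPath X Z) (q' : ObPath Z Y), q'.length < p.length →
      ∀ s t, β Z (A.ι q s) (A.ι q' t) = 0) (t : A.Tens p) :
    A.sweep β (A.ι p t) = β X (A.one X) (A.ι p t) := by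
  cases p with
  | nil X =>
    obtain ⟨c, rfl⟩ := (A.tensNil X).surjective t
    rw [ι_nil, map_smul, map_smul, sweep_one]
  | @cons _ Z _ p =>
    obtain ⟨t, rfl⟩ := (A.tensCons X p).surjective t
    induction t using TensorProduct.induction_on with
    | zero => simp
    | add s t hs ht => simp only [map_add, hs, ht]
    | tmul x t =>
      rw [← consT_ι, sweep_cons, add_eq_left, ← Submodule.mem_bot (R := k)]
      apply A.sweep_mem_of_length
      intro W q q' hq s t
      rw [LinearMap.comp_apply, consT_ι, Submodule.mem_bot]
      exact h W (.cons X q) q' (by simp only [ObPath.length]; omega) _ _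

/-- A family of maps which is reproduced by the action of a family of positive length is zero. -/
lemma eq_zero_of_eq_sweep {C : GradedQuiver.{u, w} k} {F : A.Ob → C.Ob}
    {φ : ∀ X Y, A.Bar X Y →ₗ[k] C.Hom (F X) (F Y)} (hφ : ∀ X, φ X X (A.one X) = 0)
    {M : C.Ob → Type*} [∀ c, AddCommGroup (M c)] [∀ c, Module k (M c)]
    (act : ∀ a b, C.Hom a b →ₗ[k] M b →ₗ[k] M a) {Y : A.Ob} (L : ∀ X, A.Bar X Y →ₗ[k] M (F X))
    (h : ∀ X t, L X t = A.sweep (fun Z => (act _ _).compl₁₂ (φ X Z) (L Z)) t) (X : A.Ob) :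
    L X = 0 := by
  apply A.bar_hom_ext
  intro p t
  rw [LinearMap.zero_apply]
  induction hn : p.length using Nat.strong_induction_on generalizing X with
  | _ n ih =>
    rw [h, ← Submodule.mem_bot (R := k)]
    apply A.sweep_mem_of_length
    intro Z q q' hq s t
    rw [Submodule.mem_bot, LinearMap.compl₁₂_apply]
    -- An empty first piece is killed by `φ`, and any other leaves a strictly shorter second piece,
    -- on which `L` vanishes by induction.
    cases q with
    | nil =>
      obtain ⟨c, rfl⟩ := (A.tensNil _).surjective s
      rw [ι_nil, map_smul, hφ]
      simp
    | cons X q =>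
      rw [ih q'.length (by simp only [ObPath.length] at hq; omega) Z q' t rfl, map_zero]

end GradedQuiver

section Convolution

variable {k : Type u} [CommRing k] {A : GradedQuiver.{u, v} k} {C : GradedQuiver.{u, w} k}
  {F G H I : A.Ob → C.Ob}

lemma GradedQuiver.barSgn_zero_eq (X Y : A.Ob) : A.barSgn 0 X Y = LinearMap.id :=
  LinearMap.ext A.barSgn_zero

/-! ### The convolution product -/

namespace BarMap

lemma ext_apply {φ ψ : BarMap A C F G} (h : ∀ X Y t, φ X Y t = ψ X Y t) : φ = ψ := by
  funext X Y; exact LinearMap.ext (h X Y)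

lemma conv_apply (d : ℤ) (φ : BarMap A C F G) (ψ : BarMap A C G H) (X Y : A.Ob) (t : A.Bar X Y) :
    φ.conv d ψ X Y t = A.sweep (fun Z => (C.mul (F X) (G Z) (H Y)).compl₁₂ (φ X Z)
      (ψ Z Y ∘ₗ A.barSgn d Z Y)) t := by
  classical
  rw [GradedQuiver.sweep, conv, LinearMap.comp_apply, LinearMap.comp_apply]
  congr 1
  apply A.barBar_hom_ext
  intro Z s t
  rw [GradedQuiver.ofPairs_pair]
  simp only [GradedQuiver.pair, LinearMap.compr₂_apply, TensorProduct.mk_apply]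
  erw [DirectSum.toModule_lof]
  simp [GradedQuiver.mul]

lemma toBar_conv_apply (d : ℤ) (r : Comps A C F G) (ψ : BarMap A C G H) (X Y : A.Ob)
    (t : A.Bar X Y) :
    r.toBar.conv d ψ X Y t = A.sweep (fun Z => C.consT.compl₁₂ (r X Z)
      (ψ Z Y ∘ₗ A.barSgn d Z Y)) t := by
  rw [conv_apply]
  apply A.sweep_congr_apply
  intro Z s t
  simp [Comps.toBar, C.inc_mul]

lemma conv_add (d : ℤ) (φ : BarMap A C F G) (ψ ψ' : BarMap A C G H) :
    φ.conv d (ψ + ψ') = φ.conv d ψ + φ.conv d ψ' := by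
  apply ext_apply
  intro X Y t
  simp only [Pi.add_apply, LinearMap.add_apply, conv_apply, ← A.sweep_add]
  apply A.sweep_congr_apply
  intros
  simp

lemma add_conv (d : ℤ) (φ φ' : BarMap A C F G) (ψ : BarMap A C G H) :
    BarMap.conv d (φ + φ') ψ = φ.conv d ψ + φ'.conv d ψ := by
  apply ext_apply
  intro X Y t
  simp only [Pi.add_apply, LinearMap.add_apply, conv_apply, ← A.sweep_add]
  apply A.sweep_congr_apply
  intros
  simp

lemma conv_zero (d : ℤ) (φ : BarMap A C F G) : φ.conv d (0 : BarMap A C G H) = 0 :=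
  (AddMonoidHom.mk' (fun ψ : BarMap A C G H => φ.conv d ψ) (conv_add d φ)).map_zero

lemma conv_sub (d : ℤ) (φ : BarMap A C F G) (ψ ψ' : BarMap A C G H) :
    φ.conv d (ψ - ψ') = φ.conv d ψ - φ.conv d ψ' :=
  (AddMonoidHom.mk' (fun ψ : BarMap A C G H => φ.conv d ψ) (conv_add d φ)).map_sub ψ ψ'

lemma conv_zsmul (d n : ℤ) (φ : BarMap A C F G) (ψ : BarMap A C G H) :
    φ.conv d (n • ψ) = n • φ.conv d ψ :=
  (AddMonoidHom.mk' (fun ψ : BarMap A C G H => φ.conv d ψ) (conv_add d φ)).map_zsmul n ψ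

lemma zero_conv (d : ℤ) (ψ : BarMap A C G H) : BarMap.conv d (0 : BarMap A C F G) ψ = 0 :=
  (AddMonoidHom.mk' (fun φ : BarMap A C F G => φ.conv d ψ) (add_conv d · · ψ)).map_zero

lemma sub_conv (d : ℤ) (φ φ' : BarMap A C F G) (ψ : BarMap A C G H) :
    BarMap.conv d (φ - φ') ψ = φ.conv d ψ - φ'.conv d ψ :=
  (AddMonoidHom.mk' (fun φ : BarMap A C F G => φ.conv d ψ) (add_conv d · · ψ)).map_sub φ φ'

lemma zsmul_conv (d n : ℤ) (φ : BarMap A C F G) (ψ : BarMap A C G H) :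
    BarMap.conv d (n • φ) ψ = n • φ.conv d ψ :=
  (AddMonoidHom.mk' (fun φ : BarMap A C F G => φ.conv d ψ) (add_conv d · · ψ)).map_zsmul n φ

/-- Coassociativity of the cut, together with bookkeeping of signs: in the right-hand side the sign
of weight d falls on a whole tail, is distributed over its two pieces, and joins the sign of weight
e on the last one. The weights are formal exponents here; no homogeneity of the maps is involved. -/
lemma conv_assoc {d e m : ℤ} (h : m = d + e) (φ : BarMap A C F G) (ψ : BarMap A C G H)
    (χ : BarMap A C H I) :
    BarMap.conv m (φ.conv d ψ) χ = φ.conv d (ψ.conv e χ) := by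
  subst h
  apply ext_apply
  intro X Y t
  rw [conv_apply, conv_apply]
  apply A.sweep_assoc (fun Z W => ((C.mul (F X) (G Z) (H W)).compl₁₂ (φ X Z)
      (ψ Z W ∘ₗ A.barSgn d Z W)).compr₂
    ((C.mul _ _ _).compl₂ (χ W Y ∘ₗ A.barSgn (d + e) W Y)))
  · intro W u w
    rw [LinearMap.compl₁₂_apply, conv_apply, ← LinearMap.flip_apply (C.mul _ _ _), A.map_sweep]
    rfl
  · intro Z u v
    rw [LinearMap.compl₁₂_apply, LinearMap.comp_apply, conv_apply, A.sweep_barSgn, A.map_sweep]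
    apply A.sweep_congr_apply
    intro W u v
    simp [C.mul_assoc, add_comm d e, A.barSgn_add]

lemma unit_one (X : A.Ob) : BarMap.unit C F X X (A.one X) = C.one (F X) := by
  rw [unit, GradedQuiver.one, A.ofSummands_ι]
  simp [GradedQuiver.one]

lemma unit_cons {X Z Y : A.Ob} (x : A.Hom X Z) (t : A.Bar Z Y) :
    BarMap.unit C F X Y (A.consT x t) = 0 := by
  induction t using A.bar_induction with
  | zero => simp
  | add s t hs ht => simp [hs, ht]
  | ι p t => rw [A.consT_ι, unit, A.ofSummands_ι]; rfl

/-- The first summand of the cut is picked out by the map `TsA → T⁰sC`. -/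
lemma sweep_unit_left {X Y : A.Ob} {T : Type*} [AddCommGroup T] [Module k T]
    (β : ∀ Z, C.Bar (F X) (F Z) →ₗ[k] A.Bar Z Y →ₗ[k] T) (t : A.Bar X Y) :
    A.sweep (fun Z => β Z ∘ₗ BarMap.unit C F X Z) t = β X (C.one (F X)) t := by
  revert β
  refine A.bar_cons_induction (Y := Y) (P := fun X t =>
    ∀ β : ∀ Z, C.Bar (F X) (F Z) →ₗ[k] A.Bar Z Y →ₗ[k] T,
    A.sweep (fun Z => β Z ∘ₗ BarMap.unit C F X Z) t = β X (C.one (F X)) t) ?_ ?_ ?_ ?_ t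
  · simp
  · intro X s t hs ht β; simp only [map_add, hs, ht]
  · intro c β
    simp only [map_smul, A.sweep_one, LinearMap.comp_apply, unit_one]
  · intro X Z x t _ β
    rw [A.sweep_cons, LinearMap.comp_apply, unit_one, add_eq_left]
    have : (fun W => (β W ∘ₗ BarMap.unit C F X W) ∘ₗ A.consT x) =
        fun W => (0 : A.Bar Z W →ₗ[k] A.Bar W Y →ₗ[k] T) := by
      funext W
      ext s : 1
      simp [unit_cons]
    rw [this]
    have := A.sweep_smul (fun W => (0 : A.Bar Z W →ₗ[k] A.Bar W Y →ₗ[k] T)) (0 : k) t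
    simpa using this

lemma unit_conv (φ : BarMap A C F G) : (BarMap.unit C F).conv 0 φ = φ := by
  apply ext_apply
  intro X Y t
  rw [conv_apply]
  refine (sweep_unit_left (fun Z => (C.mul _ _ _).compl₂ (φ Z Y ∘ₗ A.barSgn 0 Z Y)) t).trans ?_
  simp [C.one_mul, A.barSgn_zero]

/-! ### Maps into `TsC ⊗ TsC` -/

/-- The family `Δ(φ ⊗ ψ) : TsA → TsC ⊗ TsC`, where `φ` has degree `d`. -/
def conv₂ (d : ℤ) (φ : BarMap A C F G) (ψ : BarMap A C G H) (X Y : A.Ob) :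
    A.Bar X Y →ₗ[k] C.BarBar (F X) (H Y) :=
  A.sweep (fun Z => (C.pair (F X) (G Z) (H Y)).compl₁₂ (φ X Z) (ψ Z Y ∘ₗ A.barSgn d Z Y))

lemma conv₂_add (d : ℤ) (φ : BarMap A C F G) (ψ ψ' : BarMap A C G H) :
    φ.conv₂ d (ψ + ψ') = φ.conv₂ d ψ + φ.conv₂ d ψ' := by
  funext X Y
  refine LinearMap.ext fun t => ?_
  simp only [Pi.add_apply, LinearMap.add_apply, conv₂, ← A.sweep_add]
  apply A.sweep_congr_apply
  intros
  simp

lemma add_conv₂ (d : ℤ) (φ φ' : BarMap A C F G) (ψ : BarMap A C G H) :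
    BarMap.conv₂ d (φ + φ') ψ = φ.conv₂ d ψ + φ'.conv₂ d ψ := by
  funext X Y
  refine LinearMap.ext fun t => ?_
  simp only [Pi.add_apply, LinearMap.add_apply, conv₂, ← A.sweep_add]
  apply A.sweep_congr_apply
  intros
  simp

end BarMap

/-- The family `Δ(r ⊗ Ψ)`, followed by the action of `sC` on `TsC ⊗ TsC`. -/
def Comps.act₂ (d : ℤ) (r : Comps A C F G) (Ψ : ∀ X Y : A.Ob, A.Bar X Y →ₗ[k] C.BarBar (G X) (H Y))
    (X Y : A.Ob) : A.Bar X Y →ₗ[k] C.BarBar (F X) (H Y) :=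
  A.sweep (fun Z => C.consTT.compl₁₂ (r X Z) (Ψ Z Y ∘ₗ A.barSgn d Z Y))

lemma Comps.act₂_add (d : ℤ) (r : Comps A C F G)
    (Ψ Ψ' : ∀ X Y : A.Ob, A.Bar X Y →ₗ[k] C.BarBar (G X) (H Y)) :
    r.act₂ d (Ψ + Ψ') = r.act₂ d Ψ + r.act₂ d Ψ' := by
  funext X Y
  refine LinearMap.ext fun t => ?_
  simp only [Pi.add_apply, LinearMap.add_apply, act₂, ← A.sweep_add]
  apply A.sweep_congr_apply
  intros
  simp

lemma Comps.act₂_sub (d : ℤ) (r : Comps A C F G)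
    (Ψ Ψ' : ∀ X Y : A.Ob, A.Bar X Y →ₗ[k] C.BarBar (G X) (H Y)) :
    r.act₂ d (Ψ - Ψ') = r.act₂ d Ψ - r.act₂ d Ψ' :=
  (AddMonoidHom.mk' (fun Ψ : ∀ X Y : A.Ob, A.Bar X Y →ₗ[k] C.BarBar (G X) (H Y) => r.act₂ d Ψ)
    (r.act₂_add d)).map_sub Ψ Ψ'

/-- The comultiplication of the values of a family. -/
def BarMap.cut (Q : BarMap A C F G) (X Y : A.Ob) : A.Bar X Y →ₗ[k] C.BarBar (F X) (G Y) :=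
  C.cut (F X) (G Y) ∘ₗ Q X Y

lemma BarMap.cut_add (Q Q' : BarMap A C F G) : (Q + Q').cut = Q.cut + Q'.cut := by
  funext X Y
  exact LinearMap.comp_add _ _ _

/-- The analogue of `conv_assoc` with the last multiplication left undone, so that the values stay
in TsC ⊗ TsC. -/
lemma Comps.act₂_conv₂ {d e m : ℤ} (h : m = d + e) (r : Comps A C F G) (φ : BarMap A C G H)
    (ψ : BarMap A C H I) :
    r.act₂ d (φ.conv₂ e ψ) = BarMap.conv₂ m (r.toBar.conv d φ) ψ := by
  subst h
  funext X Y
  refine LinearMap.ext fun t => ?_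
  symm
  apply A.sweep_assoc (fun Z W => ((C.consT).compl₁₂ (r X Z)
      (φ Z W ∘ₗ A.barSgn d Z W)).compr₂
    ((C.pair _ _ _).compl₂ (ψ W Y ∘ₗ A.barSgn (d + e) W Y)))
  · intro W u w
    rw [LinearMap.compl₁₂_apply, BarMap.toBar_conv_apply, ← LinearMap.flip_apply (C.pair _ _ _),
      A.map_sweep]
    rfl
  · intro Z u v
    rw [LinearMap.compl₁₂_apply, LinearMap.comp_apply, BarMap.conv₂, A.sweep_barSgn, A.map_sweep]
    apply A.sweep_congr_apply
    intro W u v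
    simp [C.consTT_pair, add_comm d e, A.barSgn_add]

lemma BarMap.unit_conv₂ (Q : BarMap A C F G) (X Y : A.Ob) (t : A.Bar X Y) :
    (BarMap.unit C F).conv₂ 0 Q X Y t = C.oneT _ _ (Q X Y t) := by
  refine (sweep_unit_left (fun Z => (C.pair _ _ _).compl₂ (Q Z Y ∘ₗ A.barSgn 0 Z Y)) t).trans ?_
  simp [C.oneT_apply, A.barSgn_zero]

lemma BarMap.cut_unit : (BarMap.unit C F).cut = (BarMap.unit C F).conv₂ 0 (BarMap.unit C F) := by
  funext X Y
  refine LinearMap.ext fun t => ?_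
  rw [unit_conv₂]
  refine A.bar_cons_induction (P := fun X t => (BarMap.unit C F).cut X Y t =
    C.oneT _ _ (BarMap.unit C F X Y t)) ?_ ?_ ?_ ?_ t
  · simp
  · intro X s t hs ht; simp only [map_add, hs, ht]
  · intro c; simp only [map_smul, cut, LinearMap.comp_apply, unit_one, C.cut_one, C.oneT_apply]
  · intro X Z x t _; simp [cut, unit_cons]

/-- A cut of a tensor that begins with a value of r lies either before this first factor or in the
part produced by Q. -/
lemma BarMap.cut_toBar_conv (d : ℤ) (r : Comps A C F G) (Q : BarMap A C G H) :
    (r.toBar.conv d Q).cut =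
      (BarMap.unit C F).conv₂ 0 (r.toBar.conv d Q) + r.act₂ d Q.cut := by
  funext X Y
  refine LinearMap.ext fun t => ?_
  rw [Pi.add_apply, Pi.add_apply, LinearMap.add_apply, unit_conv₂, cut, LinearMap.comp_apply,
    toBar_conv_apply, A.map_sweep, A.map_sweep, Comps.act₂, ← A.sweep_add]
  apply A.sweep_congr_apply
  intro Z s t
  simp [C.cut_cons, C.oneT_apply, cut]

/-! ### Cocategory homomorphisms -/

/-- `φ = φ₁, φ₂, …` are the components of the cocategory homomorphism `f`, which has degree `0`. -/
structure BarMap.IsHom (f : BarMap A C F F) (φ : Comps A C F F) : Prop where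
  one : ∀ X, φ X X (A.one X) = 0
  eq : f = BarMap.unit C F + φ.toBar.conv 0 f
  degree : ∀ X Y d, ∀ t ∈ A.bgr X Y d, f X Y t ∈ C.bgr (F X) (F Y) d

namespace BarMap.IsHom

variable {f : BarMap A C F F} {φ : Comps A C F F}

lemma conv_eq (hf : f.IsHom φ) (K : BarMap A C F G) :
    f.conv 0 K = K + φ.toBar.conv 0 (f.conv 0 K) := by
  conv_lhs => rw [hf.eq]
  rw [add_conv, unit_conv, conv_assoc (zero_add 0).symm]

/-- The difference of two solutions of L = K + φ * L is reproduced by φ, which needs at least one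
argument; hence it is zero. By `conv_eq` one solution is f * K. This uniqueness replaces explicit
sums over the blocks of f in everything that follows. -/
lemma eq_conv (hf : f.IsHom φ) {K L : BarMap A C F G} (h : L = K + φ.toBar.conv 0 L) :
    L = f.conv 0 K := by
  rw [← sub_eq_zero]
  funext X Y
  refine A.eq_zero_of_eq_sweep (C := C) hf.one (M := fun c => C.Bar c (G Y)) (fun a b => C.consT)
    (fun X => (L - f.conv 0 K) X Y) ?_ X
  intro X t
  have : L - f.conv 0 K = φ.toBar.conv 0 (L - f.conv 0 K) := by
    rw [conv_sub]
    nth_rewrite 1 [h]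
    nth_rewrite 1 [hf.conv_eq K]
    abel
  conv_lhs => rw [this]
  rw [toBar_conv_apply]
  simp only [A.barSgn_zero_eq, LinearMap.comp_id]

/-- The same uniqueness principle for families with values in TsC ⊗ TsC, used to compute
comultiplications. -/
lemma eq_of_eq_act₂ (hf : f.IsHom φ) {K L L' : ∀ X Y, A.Bar X Y →ₗ[k] C.BarBar (F X) (G Y)}
    (h : L = K + φ.act₂ 0 L) (h' : L' = K + φ.act₂ 0 L') : L = L' := by
  rw [← sub_eq_zero]
  funext X Y
  refine A.eq_zero_of_eq_sweep (C := C) hf.one (M := fun c => C.BarBar c (G Y))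
    (fun a b => C.consTT) (fun X => (L - L') X Y) ?_ X
  intro X t
  have : L - L' = φ.act₂ 0 (L - L') := by
    rw [Comps.act₂_sub]
    nth_rewrite 1 [h]
    nth_rewrite 1 [h']
    abel
  conv_lhs => rw [this]
  simp only [Comps.act₂, A.barSgn_zero_eq, LinearMap.comp_id]

lemma map_one (hf : f.IsHom φ) (X : A.Ob) : f X X (A.one X) = C.one (F X) := by
  rw [hf.eq, Pi.add_apply, Pi.add_apply, LinearMap.add_apply, unit_one, toBar_conv_apply,
    A.sweep_one, LinearMap.compl₁₂_apply, hf.one]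
  simp

/-- A cocategory homomorphism preserves the comultiplication. -/
lemma cut (hf : f.IsHom φ) : f.cut = f.conv₂ 0 f := by
  -- Both sides satisfy the recursion given by splitting off the first block of f; its inhomogeneous
  -- term collects the cuts before that block.
  apply hf.eq_of_eq_act₂ (K := (BarMap.unit C F).conv₂ 0 f)
  · conv_lhs => rw [hf.eq]
    rw [cut_add, cut_unit, cut_toBar_conv, ← add_assoc, ← conv₂_add, ← hf.eq]
  · rw [Comps.act₂_conv₂ (zero_add 0).symm, ← add_conv₂, ← hf.eq]

/-- The output of f * (r * Q) can be cut among the blocks of f, up to the place just before r, or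
somewhere behind r. The first kind gives f ⊗ W; `R` is the second kind, characterised by its own
recursion over the blocks of f. -/
lemma cut_conv_add (hf : f.IsHom φ) (d : ℤ) (r : Comps A C F G) (Q : BarMap A C G H)
    {R : ∀ X Y, A.Bar X Y →ₗ[k] C.BarBar (F X) (H Y)}
    (hR : R = r.act₂ d Q.cut + φ.act₂ 0 R) :
    (f.conv 0 (r.toBar.conv d Q)).cut = f.conv₂ 0 (f.conv 0 (r.toBar.conv d Q)) + R := by
  set W := f.conv 0 (r.toBar.conv d Q)
  have hW : W = r.toBar.conv d Q + φ.toBar.conv 0 W := hf.conv_eq _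
  apply hf.eq_of_eq_act₂ (K := (BarMap.unit C F).conv₂ 0 W + r.act₂ d Q.cut)
  · conv_lhs => rw [hW]
    have h := conv₂_add 0 (BarMap.unit C F) (r.toBar.conv d Q) (φ.toBar.conv 0 W)
    rw [← hW] at h
    rw [cut_add, cut_toBar_conv, cut_toBar_conv, h]
    abel
  · rw [Comps.act₂_add, Comps.act₂_conv₂ (zero_add 0).symm]
    nth_rewrite 1 [hR]
    nth_rewrite 1 [hf.eq]
    rw [add_conv₂]
    abel

/-- This is the recursion demanded of `R` in `cut_conv_add`, for every term that the
comultiplication of the tail can contribute. -/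
lemma act₂_conv₂ (hf : f.IsHom φ) {d e m : ℤ} (h : m = d + e) (r : Comps A C F G)
    (Q : BarMap A C G H) (Q' : BarMap A C H I) :
    (f.conv 0 (r.toBar.conv d Q)).conv₂ m Q' =
      r.act₂ d (Q.conv₂ e Q') + φ.act₂ 0 ((f.conv 0 (r.toBar.conv d Q)).conv₂ m Q') := by
  rw [Comps.act₂_conv₂ h, Comps.act₂_conv₂ (zero_add m).symm, ← add_conv₂, ← hf.conv_eq]

end BarMap.IsHom

/-- The inclusion of the components of the identity. -/
def GradedQuiver.proj (A : GradedQuiver.{u, v} k) : Comps A A (fun X => X) (fun X => X) :=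
  fun _ _ => A.ofSummands fun p => match p with
    | .nil _ => 0
    | .cons X (.nil Y) => (TensorProduct.rid k (A.Hom X Y)).toLinearMap ∘ₗ
        (TensorProduct.map LinearMap.id (A.tensNil Y).symm.toLinearMap) ∘ₗ
          (A.tensCons X (.nil Y)).symm.toLinearMap
    | .cons _ (.cons _ _) => 0

lemma GradedQuiver.proj_one (X : A.Ob) : A.proj X X (A.one X) = 0 := by
  rw [proj, one, A.ofSummands_ι]
  rfl

lemma GradedQuiver.proj_cons_one {X Y : A.Ob} (x : A.Hom X Y) :
    A.proj X Y (A.consT x (A.one Y)) = x := by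
  rw [proj, one, A.consT_ι, A.ofSummands_ι]
  simp

lemma GradedQuiver.proj_cons_cons {X Z W Y : A.Ob} (x : A.Hom X Z) (y : A.Hom Z W)
    (t : A.Bar W Y) : A.proj X Y (A.consT x (A.consT y t)) = 0 := by
  induction t using A.bar_induction with
  | zero => simp
  | add s t hs ht => simp only [map_add, hs, ht, add_zero]
  | ι p t => rw [A.consT_ι, A.consT_ι, proj, A.ofSummands_ι]; rfl

/-- It makes the results on homomorphisms and coderivations available for the codifferential itself,
an (id, id)-coderivation. In the recursion only the cut after the first factor contributes, since
`proj` sees only T¹. -/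
lemma BarMap.isHom_ident : (BarMap.ident A).IsHom A.proj where
  one := A.proj_one
  degree _ _ _ _ h := h
  eq := by
    apply ext_apply
    intro X Y t
    rw [Pi.add_apply, Pi.add_apply, LinearMap.add_apply, toBar_conv_apply]
    simp only [ident, A.barSgn_zero_eq, LinearMap.comp_id, LinearMap.id_apply]
    refine A.bar_cons_induction (P := fun X t => t = BarMap.unit A (fun X => X) X Y t +
      A.sweep (fun Z => A.consT.compl₁₂ (A.proj X Z) LinearMap.id) t) ?_ ?_ ?_ ?_ t
    · simp
    · intro X s t hs ht
      simp only [map_add]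
      nth_rewrite 1 [hs, ht]
      abel
    · intro c
      simp only [map_smul, A.sweep_one, unit_one, LinearMap.compl₁₂_apply, A.proj_one]
      simp
    · intro X Z x t _
      rw [unit_cons, zero_add, A.sweep_cons, LinearMap.compl₁₂_apply, A.proj_one]
      simp only [map_zero, LinearMap.zero_apply, zero_add]
      refine A.bar_cons_induction (P := fun Z t => ∀ x : A.Hom X Z, A.consT x t =
        A.sweep (fun W => A.consT.compl₁₂ (A.proj X W) LinearMap.id ∘ₗ A.consT x) t)
        ?_ ?_ ?_ ?_ t x
      · simp
      · intro X s t hs ht x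
        simp only [map_add, ← hs, ← ht]
      · intro c x
        simp only [map_smul, A.sweep_one, LinearMap.comp_apply, LinearMap.compl₁₂_apply,
          A.proj_cons_one, LinearMap.id_apply]
      · intro Z W y t _ x
        rw [A.sweep_cons, LinearMap.comp_apply, LinearMap.compl₁₂_apply, A.proj_cons_one,
          LinearMap.id_apply, left_eq_add]
        have : (fun V => (A.consT.compl₁₂ (A.proj X V) LinearMap.id ∘ₗ A.consT x) ∘ₗ A.consT y) =
            fun V => (0 : A.Bar W V →ₗ[k] A.Bar V Y →ₗ[k] A.Bar X Y) := by
          funext V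
          refine LinearMap.ext fun s => ?_
          refine LinearMap.ext fun t => ?_
          simp [A.proj_cons_cons]
        rw [this]
        have := A.sweep_smul (fun V => (0 : A.Bar W V →ₗ[k] A.Bar V Y →ₗ[k] A.Bar X Y)) (0 : k) t
        simpa using this

/-! ### Degrees -/

/-- The family is homogeneous of degree `d`. -/
def BarMap.HasDeg (φ : BarMap A C F G) (d : ℤ) : Prop :=
  ∀ X Y e, ∀ t ∈ A.bgr X Y e, φ X Y t ∈ C.bgr (F X) (G Y) (e + d)

lemma Comps.HasDegree.apply {r : Comps A C F G} {d : ℤ} (hr : r.HasDegree d) {X Y : A.Ob} {e : ℤ}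
    {t : A.Bar X Y} (ht : t ∈ A.bgr X Y e) : r X Y t ∈ C.sgr (F X) (G Y) (e + d) :=
  A.bgr_le (N := (C.sgr (F X) (G Y) (e + d)).comap (r X Y)) (fun p t ht => hr X Y p e t ht) ht

lemma Comps.HasDegree.toBar {r : Comps A C F G} {d : ℤ} (hr : r.HasDegree d) :
    r.toBar.HasDeg d := by
  intro X Y e t ht
  exact C.consT_mem_bgr (add_zero _) (hr.apply ht) (C.one_mem_bgr _)

lemma BarMap.IsHom.hasDeg {f : BarMap A C F F} {φ : Comps A C F F} (hf : f.IsHom φ) :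
    f.HasDeg 0 := by
  intro X Y e t ht
  rw [add_zero]
  exact hf.degree X Y e t ht

lemma BarMap.HasDeg.barSgn {φ : BarMap A C F G} {d : ℤ} (hφ : φ.HasDeg d) (m : ℤ) (X Y : A.Ob) :
    C.barSgn m (F X) (G Y) ∘ₗ φ X Y = ((m * d).negOnePow : ℤ) • (φ X Y ∘ₗ A.barSgn m X Y) := by
  apply A.bar_hom_ext_of_degree
  intro e t ht
  rw [LinearMap.comp_apply, C.barSgn_of_mem m (hφ X Y e t ht), LinearMap.smul_apply,
    LinearMap.comp_apply, A.barSgn_of_mem m ht, map_zsmul, smul_smul, ← Units.val_mul,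
    ← Int.negOnePow_add]
  congr 3
  ring

lemma GradedQuiver.barSgn_mem_bgr (m : ℤ) {X Y : A.Ob} {d : ℤ} {t : A.Bar X Y}
    (ht : t ∈ A.bgr X Y d) : A.barSgn m X Y t ∈ A.bgr X Y d := by
  rw [A.barSgn_of_mem m ht]
  exact zsmul_mem ht _

lemma BarMap.HasDeg.conv {φ : BarMap A C F G} {ψ : BarMap A C G H} {d e n : ℤ} (hφ : φ.HasDeg d)
    (hψ : ψ.HasDeg e) (m : ℤ) (h : n = d + e) : (φ.conv m ψ).HasDeg n := by
  intro X Y a t ht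
  rw [conv_apply]
  refine A.sweep_mem_of_degree ?_ ht
  intro Z i j hij s hs t ht
  exact C.mul_mem_bgr (by omega) (hφ _ _ _ _ hs) (hψ _ _ _ _ (A.barSgn_mem_bgr m ht))

lemma BarMap.HasDeg.unit : (BarMap.unit (A := A) C F).HasDeg 0 := by
  intro X Y d t ht
  rw [add_zero]
  refine A.bgr_le (N := (C.bgr (F X) (F Y) d).comap (BarMap.unit C F X Y)) ?_ ht
  intro p t ht
  rw [Submodule.mem_comap, BarMap.unit, A.ofSummands_ι]
  cases p with
  | nil X =>
    apply C.ι_mem_bgr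
    by_cases hd : d = 0
    · simp [hd, GradedQuiver.tgr]
    · rw [GradedQuiver.tgr, if_neg hd, Submodule.mem_bot] at ht
      simp [ht]
  | cons X p => exact Submodule.zero_mem _

/-! ### Components of compositions -/

lemma GradedQuiver.ofPairs_conv₂ {X Y : A.Ob} {T : Type*} [AddCommGroup T] [Module k T] (d : ℤ)
    (φ : BarMap A C F G) (ψ : BarMap A C G H)
    (β : ∀ c, C.Bar (F X) c →ₗ[k] C.Bar c (H Y) →ₗ[k] T) (t : A.Bar X Y) :
    C.ofPairs β (φ.conv₂ d ψ X Y t) = A.sweep (fun Z => (β (G Z)).compl₁₂ (φ X Z)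
      (ψ Z Y ∘ₗ A.barSgn d Z Y)) t := by
  rw [BarMap.conv₂, A.map_sweep]
  apply A.sweep_congr_apply
  intro Z s t
  rw [LinearMap.compr₂_apply, LinearMap.compl₁₂_apply, LinearMap.compl₁₂_apply, C.ofPairs_pair]

end Convolution

/-! ### Composition with the codifferentials of source and target -/

section Differentials

variable {k : Type u} [CommRing k] {B : AInfCat.{u, v} k} {C : AInfCat.{u, w} k}
  {F G H I : B.Ob → C.Ob}

lemma Int.val_negOnePow_add (d e : ℤ) :
    ((d + e).negOnePow : ℤ) = (d.negOnePow : ℤ) * (e.negOnePow : ℤ) := by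
  rw [Int.negOnePow_add, Units.val_mul]

lemma Int.val_negOnePow_add_one (d : ℤ) : ((d + 1).negOnePow : ℤ) = -(d.negOnePow : ℤ) := by
  rw [Int.negOnePow_succ, Units.val_neg]

lemma Int.val_negOnePow_eq (d : ℤ) : (d.negOnePow : ℤ) = 1 ∨ (d.negOnePow : ℤ) = -1 := by
  rcases Int.units_eq_one_or d.negOnePow with h | h <;> simp [h]

lemma GradedQuiver.sweep_eq_zero {A : GradedQuiver.{u, v} k} {X Y : A.Ob} {T : Type*}
    [AddCommGroup T] [Module k T] {β : ∀ Z, A.Bar X Z →ₗ[k] A.Bar Z Y →ₗ[k] T}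
    (h : ∀ Z s t, β Z s t = 0) (t : A.Bar X Y) : A.sweep β t = 0 := by
  have := A.sweep_smul β (0 : k) t
  rw [zero_smul] at this
  rw [← this]
  apply A.sweep_congr_apply
  intro Z s t
  rw [h, zero_smul]
  rfl

/-- `qb : TsB → sC`. -/
def BarMap.postB (Q : BarMap B.toGradedQuiver C.toGradedQuiver F G) :
    Comps B.toGradedQuiver C.toGradedQuiver F G := fun X Y => C.b (F X) (G Y) ∘ₗ Q X Y

/-- `qb : TsB → TsC`. -/
def BarMap.postCodiff (Q : BarMap B.toGradedQuiver C.toGradedQuiver F G) :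
    BarMap B.toGradedQuiver C.toGradedQuiver F G := fun X Y => C.codiff (F X) (G Y) ∘ₗ Q X Y

/-- `bq : TsB → TsC`. -/
def BarMap.preCodiff (Q : BarMap B.toGradedQuiver C.toGradedQuiver F G) :
    BarMap B.toGradedQuiver C.toGradedQuiver F G := fun X Y => Q X Y ∘ₗ B.codiff X Y

/-- `bq : TsB → sC`. -/
def Comps.preCodiff (Q : Comps B.toGradedQuiver C.toGradedQuiver F G) :
    Comps B.toGradedQuiver C.toGradedQuiver F G := fun X Y => Q X Y ∘ₗ B.codiff X Y

lemma Comps.toBar_preCodiff (r : Comps B.toGradedQuiver C.toGradedQuiver F G) :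
    r.preCodiff.toBar = r.toBar.preCodiff := rfl

/-- The summands `bₙ ⊗ 1^{⊗t}` of the codifferential. -/
def AInfCat.headB (C : AInfCat.{u, w} k) :
    BarMap C.toGradedQuiver C.toGradedQuiver (fun X => X) (fun X => X) :=
  BarMap.conv 1 C.b.toBar (BarMap.ident _)

lemma AInfCat.codiff_eq (C : AInfCat.{u, w} k) :
    C.codiff = (BarMap.ident _).conv 0 C.headB := rfl

/-- `q (b ⊗ 1)`. -/
def BarMap.postHead (Q : BarMap B.toGradedQuiver C.toGradedQuiver F G) :
    BarMap B.toGradedQuiver C.toGradedQuiver F G := fun X Y => C.headB (F X) (G Y) ∘ₗ Q X Y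

/-- The pairing computing `b ⊗ 1`. -/
def AInfCat.headPairing (C : AInfCat.{u, w} k) (X Y Z : C.Ob) :
    C.Bar X Z →ₗ[k] C.Bar Z Y →ₗ[k] C.Bar X Y :=
  (C.mul X Z Y).compl₁₂ (C.b.toBar X Z) (C.barSgn 1 Z Y)

lemma BarMap.postHead_apply (Q : BarMap B.toGradedQuiver C.toGradedQuiver F G) (X Y : B.Ob)
    (t : B.Bar X Y) : Q.postHead X Y t = C.ofPairs (C.headPairing (F X) (G Y)) (Q.cut X Y t) :=
  BarMap.conv_apply (A := C.toGradedQuiver) (C := C.toGradedQuiver) 1 C.b.toBar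
    (BarMap.ident _) (F X) (G Y) (Q X Y t)

/-- The map on `TsC ⊗ TsC`-valued families induced by `b ⊗ 1`. -/
def AInfCat.headMap (Ψ : ∀ X Y : B.Ob, B.Bar X Y →ₗ[k] C.BarBar (F X) (G Y)) :
    BarMap B.toGradedQuiver C.toGradedQuiver F G :=
  fun X Y => C.ofPairs (C.headPairing (F X) (G Y)) ∘ₗ Ψ X Y

lemma BarMap.postHead_eq (Q : BarMap B.toGradedQuiver C.toGradedQuiver F G) :
    Q.postHead = AInfCat.headMap Q.cut :=
  ext_apply Q.postHead_apply

lemma AInfCat.headMap_add (Ψ Ψ' : ∀ X Y : B.Ob, B.Bar X Y →ₗ[k] C.BarBar (F X) (G Y)) :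
    AInfCat.headMap (Ψ + Ψ') = AInfCat.headMap Ψ + AInfCat.headMap Ψ' := by
  funext X Y
  exact LinearMap.comp_add _ _ _

/-- The sign of b ⊗ 1 is governed by the degree of the value of Q', which exceeds that of its
argument by e. The excess gives (-1)^e, and the rest raises the weight d to d + 1. -/
lemma AInfCat.headMap_conv₂ {e : ℤ} (d : ℤ) (Q : BarMap B.toGradedQuiver C.toGradedQuiver F G)
    {Q' : BarMap B.toGradedQuiver C.toGradedQuiver G H} (h : Q'.HasDeg e) :
    AInfCat.headMap (Q.conv₂ d Q') = (e.negOnePow : ℤ) • Q.postB.toBar.conv (d + 1) Q' := by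
  apply BarMap.ext_apply
  intro X Y t
  rw [headMap, LinearMap.comp_apply, GradedQuiver.ofPairs_conv₂, Pi.smul_apply, Pi.smul_apply,
    LinearMap.smul_apply, BarMap.conv_apply, ← GradedQuiver.sweep_smul]
  apply GradedQuiver.sweep_congr_apply
  intro Z s t
  have := LinearMap.congr_fun (h.barSgn 1 Z Y) (B.barSgn d Z Y t)
  rw [LinearMap.comp_apply] at this
  simp only [headPairing, LinearMap.compl₁₂_apply, LinearMap.smul_apply, LinearMap.comp_apply, this,
    _root_.one_mul, map_zsmul, add_comm d 1, B.barSgn_add]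
  rfl

/-! ### The codifferential of the target -/

lemma AInfCat.headB_one (C : AInfCat.{u, w} k) (X : C.Ob) : C.headB X X (C.one X) = 0 := by
  rw [headB, BarMap.toBar_conv_apply, GradedQuiver.sweep_one, LinearMap.compl₁₂_apply, C.b_zero]
  simp

lemma AInfCat.codiff_one (C : AInfCat.{u, w} k) (X : C.Ob) : C.codiff X X (C.one X) = 0 := by
  rw [codiff_eq, BarMap.conv_apply, GradedQuiver.sweep_one, LinearMap.compl₁₂_apply,
    LinearMap.comp_apply, C.barSgn_one, C.headB_one]
  simp

/-- Either the operation bₙ starts at the first factor or x stays outside it. Operators act on the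
right, so 1 ⊗ b contributes no sign. -/
lemma AInfCat.codiff_cons (C : AInfCat.{u, w} k) {X Z Y : C.Ob} (x : C.Hom X Z) (t : C.Bar Z Y) :
    C.codiff X Y (C.consT x t) = C.headB X Y (C.consT x t) + C.consT x (C.codiff Z Y t) := by
  rw [codiff_eq, BarMap.conv_apply, BarMap.conv_apply, GradedQuiver.sweep_cons,
    GradedQuiver.map_sweep]
  simp only [LinearMap.compl₁₂_apply, BarMap.ident, LinearMap.id_apply, C.one_mul,
    LinearMap.comp_apply, C.barSgn_zero]
  congr 1
  apply GradedQuiver.sweep_congr_apply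
  intro W s t
  simp [C.cons_mul]

namespace BarMap

lemma postCodiff_add (Q Q' : BarMap B.toGradedQuiver C.toGradedQuiver F G) :
    (Q + Q').postCodiff = Q.postCodiff + Q'.postCodiff := by
  funext X Y
  exact LinearMap.comp_add _ _ _

lemma postHead_add (Q Q' : BarMap B.toGradedQuiver C.toGradedQuiver F G) :
    (Q + Q').postHead = Q.postHead + Q'.postHead := by
  funext X Y
  exact LinearMap.comp_add _ _ _

lemma preCodiff_add (Q Q' : BarMap B.toGradedQuiver C.toGradedQuiver F G) :
    (Q + Q').preCodiff = Q.preCodiff + Q'.preCodiff := by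
  funext X Y
  exact LinearMap.add_comp _ _ _

lemma postCodiff_toBar_conv (d : ℤ) (r : Comps B.toGradedQuiver C.toGradedQuiver F G)
    (Q : BarMap B.toGradedQuiver C.toGradedQuiver G H) :
    (r.toBar.conv d Q).postCodiff =
      (r.toBar.conv d Q).postHead + r.toBar.conv d Q.postCodiff := by
  apply ext_apply
  intro X Y t
  rw [Pi.add_apply, Pi.add_apply, LinearMap.add_apply, postCodiff, postHead, LinearMap.comp_apply,
    LinearMap.comp_apply, toBar_conv_apply, toBar_conv_apply, GradedQuiver.map_sweep,
    GradedQuiver.map_sweep, ← GradedQuiver.sweep_add]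
  apply GradedQuiver.sweep_congr_apply
  intro Z s t
  simp only [LinearMap.compr₂_apply, LinearMap.compl₁₂_apply, LinearMap.add_apply,
    LinearMap.comp_apply, C.codiff_cons, postCodiff]

lemma postCodiff_unit : (BarMap.unit (A := B.toGradedQuiver) C.toGradedQuiver F).postCodiff = 0 := by
  apply ext_apply
  intro X Y t
  refine B.bar_cons_induction (P := fun X t =>
    (BarMap.unit C.toGradedQuiver F).postCodiff X Y t = 0) ?_ ?_ ?_ ?_ t
  · simp
  · intro X s t hs ht; rw [map_add, hs, ht, add_zero]
  · intro c; rw [map_smul, postCodiff, LinearMap.comp_apply, unit_one, C.codiff_one, smul_zero]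
  · intro X Z x t _; rw [postCodiff, LinearMap.comp_apply, unit_cons, map_zero]

lemma postHead_unit : (BarMap.unit (A := B.toGradedQuiver) C.toGradedQuiver F).postHead = 0 := by
  apply ext_apply
  intro X Y t
  refine B.bar_cons_induction (P := fun X t =>
    (BarMap.unit C.toGradedQuiver F).postHead X Y t = 0) ?_ ?_ ?_ ?_ t
  · simp
  · intro X s t hs ht; rw [map_add, hs, ht, add_zero]
  · intro c; rw [map_smul, postHead, LinearMap.comp_apply, unit_one, C.headB_one, smul_zero]
  · intro X Z x t _; rw [postHead, LinearMap.comp_apply, unit_cons, map_zero]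

variable {f : BarMap B.toGradedQuiver C.toGradedQuiver F F}
  {φ : Comps B.toGradedQuiver C.toGradedQuiver F F}
  {g : BarMap B.toGradedQuiver C.toGradedQuiver G G}
  {ψ : Comps B.toGradedQuiver C.toGradedQuiver G G}
  {h : BarMap B.toGradedQuiver C.toGradedQuiver H H}
  {χ : Comps B.toGradedQuiver C.toGradedQuiver H H}
  {l : BarMap B.toGradedQuiver C.toGradedQuiver I I}
  {ω : Comps B.toGradedQuiver C.toGradedQuiver I I}

/-- Apply the codifferential to the recursion W = r * Q + φ * W. The terms where b starts at the
first factor add up to `W.postHead`, and what remains is again a recursion over the blocks of f.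
Computing Wb is thereby reduced to computing W(b ⊗ 1), which the comultiplication of W determines.
-/
lemma IsHom.postCodiff_conv (hf : f.IsHom φ) (d : ℤ)
    (r : Comps B.toGradedQuiver C.toGradedQuiver F G)
    (Q : BarMap B.toGradedQuiver C.toGradedQuiver G H) :
    (f.conv 0 (r.toBar.conv d Q)).postCodiff =
      f.conv 0 ((f.conv 0 (r.toBar.conv d Q)).postHead + r.toBar.conv d Q.postCodiff) := by
  set W := f.conv 0 (r.toBar.conv d Q)
  have hW : W = r.toBar.conv d Q + φ.toBar.conv 0 W := hf.conv_eq _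
  apply hf.eq_conv
  nth_rewrite 1 [hW]
  nth_rewrite 2 [hW]
  rw [postCodiff_add, postHead_add, postCodiff_toBar_conv, postCodiff_toBar_conv]
  abel

/-- The operation b consumes an initial segment of the output of f. As f preserves cuts, both this
segment and the remainder are outputs of f. -/
lemma IsHom.postHead (hf : f.IsHom φ) : f.postHead = f.postB.toBar.conv 1 f := by
  rw [postHead_eq, hf.cut, AInfCat.headMap_conv₂ 0 f hf.hasDeg]
  simp

lemma IsHom.postCodiff (hf : f.IsHom φ) : f.postCodiff = f.conv 0 (f.postB.toBar.conv 1 f) := by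
  rw [← hf.postHead]
  apply hf.eq_conv
  nth_rewrite 1 [hf.eq]
  nth_rewrite 2 [hf.eq]
  rw [postCodiff_add, postHead_add, postCodiff_unit, postHead_unit, postCodiff_toBar_conv]
  abel

end BarMap

/-! ### The codifferential of the source -/

lemma Comps.HasDegree.coder {A : GradedQuiver.{u, v} k} {D : GradedQuiver.{u, w} k}
    {F G : A.Ob → D.Ob} {f : BarMap A D F F} {g : BarMap A D G G} (hf : f.HasDeg 0)
    (hg : g.HasDeg 0) {r : Comps A D F G} {d : ℤ} (hr : r.HasDegree d) :
    (r.coder f d g).HasDeg d :=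
  hf.conv (hr.toBar.conv hg d (add_zero d).symm) 0 (zero_add d).symm

lemma AInfCat.codiff_hasDeg (C : AInfCat.{u, w} k) : C.codiff.HasDeg 1 :=
  C.b_degree.coder BarMap.isHom_ident.hasDeg BarMap.isHom_ident.hasDeg

/-- The comultiplication of a coderivation. -/
lemma BarMap.IsHom.cut_coder {A : GradedQuiver.{u, v} k} {D : GradedQuiver.{u, w} k}
    {F G : A.Ob → D.Ob} {f : BarMap A D F F} {g : BarMap A D G G} {φ : Comps A D F F}
    {ψ : Comps A D G G} (hf : f.IsHom φ) (hg : g.IsHom ψ) (d : ℤ) (r : Comps A D F G) :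
    (r.coder f d g).cut = f.conv₂ 0 (r.coder f d g) + (r.coder f d g).conv₂ d g := by
  apply hf.cut_conv_add
  rw [hg.cut]
  exact hf.act₂_conv₂ (add_zero d).symm r g g

namespace BarMap

/-- The source codifferential is a coderivation, so it acts on either piece of the cut. Acting on
the second piece, it raises the degree on which the sign of weight d depends by one, whence (-1)^d.
Acting on the first, it brings the Koszul sign of the second piece, whence d + 1. -/
lemma preCodiff_conv (d : ℤ) (Q : BarMap B.toGradedQuiver C.toGradedQuiver F G)
    (Q' : BarMap B.toGradedQuiver C.toGradedQuiver G H) :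
    (Q.conv d Q').preCodiff =
      (d.negOnePow : ℤ) • Q.conv d Q'.preCodiff + Q.preCodiff.conv (d + 1) Q' := by
  apply ext_apply
  intro X Y t
  have hcut := congr_fun₂ (isHom_ident.cut_coder isHom_ident 1 B.b) X Y
  have hcut := LinearMap.congr_fun hcut t
  rw [preCodiff, LinearMap.comp_apply, conv_apply, GradedQuiver.sweep, LinearMap.comp_apply]
  erw [hcut]
  simp only [Pi.add_apply, LinearMap.add_apply, map_add]
  erw [GradedQuiver.ofPairs_conv₂, GradedQuiver.ofPairs_conv₂]
  congr 1
  · rw [Pi.smul_apply, Pi.smul_apply, LinearMap.smul_apply, conv_apply, ← GradedQuiver.sweep_smul]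
    apply GradedQuiver.sweep_congr_apply
    intro Z s t
    have := LinearMap.congr_fun (B.codiff_hasDeg.barSgn d Z Y) t
    rw [LinearMap.comp_apply, _root_.mul_one] at this
    simp only [LinearMap.compl₁₂_apply, LinearMap.smul_apply, LinearMap.comp_apply, ident,
      B.barSgn_zero, LinearMap.id_apply]
    erw [this]
    simp only [LinearMap.smul_apply, map_zsmul]
    rfl
  · rw [conv_apply]
    apply GradedQuiver.sweep_congr_apply
    intro Z s t
    simp only [LinearMap.compl₁₂_apply, LinearMap.comp_apply, B.barSgn_add]
    rfl

/-- Every summand of the codifferential contains an output of some bₙ, so nothing reaches T⁰. -/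
lemma preCodiff_unit : (BarMap.unit (A := B.toGradedQuiver) C.toGradedQuiver F).preCodiff = 0 := by
  have key : ∀ (d : ℤ) (r : Comps B.toGradedQuiver B.toGradedQuiver (fun X => X) (fun X => X))
      (Q : BarMap B.toGradedQuiver B.toGradedQuiver (fun X => X) (fun X => X)) (X Y : B.Ob)
      (t : B.Bar X Y), BarMap.unit C.toGradedQuiver F X Y (r.toBar.conv d Q X Y t) = 0 := by
    intro d r Q X Y t
    rw [toBar_conv_apply, GradedQuiver.map_sweep]
    apply GradedQuiver.sweep_eq_zero
    intro Z s t
    simp [unit_cons]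
  apply ext_apply
  intro X Y t
  rw [preCodiff, LinearMap.comp_apply, AInfCat.codiff_eq, isHom_ident.conv_eq, Pi.add_apply,
    Pi.add_apply, LinearMap.add_apply, map_add, AInfCat.headB, key, key, add_zero]
  rfl

end BarMap

/-- Nested applications of b cancel by the defining equation `b_sq`; applications to disjoint
segments occur twice, with opposite signs. -/
lemma AInfCat.codiff_codiff (C : AInfCat.{u, w} k) (X Y : C.Ob) :
    C.codiff X Y ∘ₗ C.codiff X Y = 0 := by
  have h₁ : C.headB.preCodiff = - BarMap.conv 1 C.b.toBar C.codiff := by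
    have : C.b.preCodiff.toBar = 0 := by
      funext X Y
      rw [Comps.toBar]
      have : C.b.preCodiff X Y = 0 := C.b_sq X Y
      rw [this, LinearMap.comp_zero]
      rfl
    rw [headB, BarMap.preCodiff_conv, ← Comps.toBar_preCodiff, this, BarMap.zero_conv, add_zero]
    simp
    rfl
  have h₂ : C.codiff.conv 1 C.headB = (BarMap.ident _).conv 0 (BarMap.conv 1 C.b.toBar C.codiff) := by
    nth_rewrite 1 [codiff_eq, headB]
    rw [BarMap.conv_assoc (zero_add 1).symm, BarMap.conv_assoc (add_zero 1).symm]
    rfl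
  have : C.codiff.preCodiff = 0 := by
    conv_lhs => rw [codiff_eq]
    rw [BarMap.preCodiff_conv, h₁]
    have h₃ : (BarMap.ident C.toGradedQuiver).preCodiff = C.codiff := rfl
    have h₄ := BarMap.conv_sub 0 (BarMap.ident C.toGradedQuiver) 0 (BarMap.conv 1 C.b.toBar C.codiff)
    rw [BarMap.conv_zero, zero_sub, zero_sub] at h₄
    rw [h₃, zero_add, h₂, h₄]
    simp
  exact congr_fun₂ this X Y

/-! ### Functors -/

/-- `φ` are the components of the `A∞`-functor `f`. -/
structure BarMap.IsFunctor (f : BarMap B.toGradedQuiver C.toGradedQuiver F F)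
    (φ : Comps B.toGradedQuiver C.toGradedQuiver F F) : Prop extends f.IsHom φ where
  comm : f.postB = φ.preCodiff

/-- The functor equation is imposed on components only. It propagates to the whole homomorphism
because fb and bf solve the same recursion. -/
lemma BarMap.IsFunctor.preCodiff_eq {f : BarMap B.toGradedQuiver C.toGradedQuiver F F}
    {φ : Comps B.toGradedQuiver C.toGradedQuiver F F} (hf : f.IsFunctor φ) :
    f.preCodiff = f.postCodiff := by
  rw [hf.toIsHom.postCodiff]
  apply hf.toIsHom.eq_conv
  conv_lhs => rw [hf.eq]
  rw [preCodiff_add, preCodiff_unit, preCodiff_conv, hf.comm, Comps.toBar_preCodiff]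
  simp
  abel

/-- `qb - (-1)^d bq : TsB → TsC`. -/
def BarMap.comm (d : ℤ) (Q : BarMap B.toGradedQuiver C.toGradedQuiver F G) :
    BarMap B.toGradedQuiver C.toGradedQuiver F G :=
  Q.postCodiff - (d.negOnePow : ℤ) • Q.preCodiff

lemma BarMap.postB_postCodiff (Q : BarMap B.toGradedQuiver C.toGradedQuiver F G) :
    Q.postCodiff.postB = 0 := by
  funext X Y
  rw [postB, postCodiff, ← LinearMap.comp_assoc]
  have : C.b (F X) (G Y) ∘ₗ C.codiff (F X) (G Y) = 0 := C.b_sq _ _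
  rw [this, LinearMap.zero_comp]
  rfl

/-- The component of b² = 0 removes the term Qb², leaving only the one in which a codifferential
precedes Q. -/
lemma BarMap.postB_comm (d : ℤ) (Q : BarMap B.toGradedQuiver C.toGradedQuiver F G) :
    (Q.comm d).postB = - ((d.negOnePow : ℤ) • Q.postB.preCodiff) := by
  funext X Y
  have := congr_fun₂ Q.postB_postCodiff X Y
  change C.b _ _ ∘ₗ (Q.postCodiff X Y - (d.negOnePow : ℤ) • Q.preCodiff X Y) = _
  rw [LinearMap.comp_sub]
  change Q.postCodiff.postB X Y - _ = _
  rw [this, Pi.zero_apply, Pi.zero_apply, zero_sub, LinearMap.comp_smul]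
  rfl

end Differentials

/-! ### The differential B₁ and the composition B₂ -/

section Transformations

variable {k : Type u} [CommRing k] {B : AInfCat.{u, v} k} {C : AInfCat.{u, w} k}
  {F G H I : B.Ob → C.Ob}
  {f : BarMap B.toGradedQuiver C.toGradedQuiver F F}
  {φ : Comps B.toGradedQuiver C.toGradedQuiver F F}
  {g : BarMap B.toGradedQuiver C.toGradedQuiver G G}
  {ψ : Comps B.toGradedQuiver C.toGradedQuiver G G}
  {h : BarMap B.toGradedQuiver C.toGradedQuiver H H}
  {χ : Comps B.toGradedQuiver C.toGradedQuiver H H}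
  {l : BarMap B.toGradedQuiver C.toGradedQuiver I I}
  {ω : Comps B.toGradedQuiver C.toGradedQuiver I I}

lemma Int.val_negOnePow_neg_two : ((-2 : ℤ).negOnePow : ℤ) = 1 := by
  rw [Int.negOnePow_even (-2) ⟨-1, rfl⟩, Units.val_one]

lemma Comps.toBar_add (r r' : Comps B.toGradedQuiver C.toGradedQuiver F G) :
    (r + r').toBar = r.toBar + r'.toBar := by
  funext X Y
  exact LinearMap.comp_add _ _ _

lemma Comps.toBar_sub (r r' : Comps B.toGradedQuiver C.toGradedQuiver F G) :
    (r - r').toBar = r.toBar - r'.toBar := by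
  funext X Y
  exact LinearMap.comp_sub _ _ _

lemma Comps.toBar_zsmul (n : ℤ) (r : Comps B.toGradedQuiver C.toGradedQuiver F G) :
    (n • r).toBar = n • r.toBar := by
  funext X Y
  exact LinearMap.comp_smul _ _ _

lemma transfB₁_eq (d : ℤ) (r : Comps B.toGradedQuiver C.toGradedQuiver F G) :
    transfB₁ f g d r = (r.coder f d g).postB - (d.negOnePow : ℤ) • r.preCodiff := rfl

lemma BarMap.postB_add (Q Q' : BarMap B.toGradedQuiver C.toGradedQuiver F G) :
    (Q + Q').postB = Q.postB + Q'.postB := by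
  funext X Y
  exact LinearMap.comp_add _ _ _

lemma BarMap.postB_sub (Q Q' : BarMap B.toGradedQuiver C.toGradedQuiver F G) :
    (Q - Q').postB = Q.postB - Q'.postB := by
  funext X Y
  exact LinearMap.comp_sub _ _ _

lemma BarMap.postB_zsmul (n : ℤ) (Q : BarMap B.toGradedQuiver C.toGradedQuiver F G) :
    (n • Q).postB = n • Q.postB := by
  funext X Y
  exact LinearMap.comp_smul _ _ _

lemma Comps.preCodiff_sub (r r' : Comps B.toGradedQuiver C.toGradedQuiver F G) :
    (r - r').preCodiff = r.preCodiff - r'.preCodiff := by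
  funext X Y
  exact LinearMap.sub_comp _ _ _

lemma Comps.preCodiff_zsmul (n : ℤ) (r : Comps B.toGradedQuiver C.toGradedQuiver F G) :
    (n • r).preCodiff = n • r.preCodiff := by
  funext X Y
  exact LinearMap.smul_comp _ _ _

lemma Comps.preCodiff_preCodiff (r : Comps B.toGradedQuiver C.toGradedQuiver F G) :
    r.preCodiff.preCodiff = 0 := by
  funext X Y
  change (r X Y ∘ₗ B.codiff X Y) ∘ₗ B.codiff X Y = 0
  rw [LinearMap.comp_assoc, B.codiff_codiff, LinearMap.comp_zero]

namespace BarMap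

lemma IsFunctor.comm_eq_zero (hf : f.IsFunctor φ) : f.comm 0 = 0 := by
  simp [BarMap.comm, hf.preCodiff_eq]

/-- The commutator of the codifferential with `∑ f_{a α} ⊗ r_j ⊗ Q`. -/
lemma IsFunctor.comm_conv (hf : f.IsFunctor φ) (d e : ℤ)
    (r : Comps B.toGradedQuiver C.toGradedQuiver F G)
    (Q : BarMap B.toGradedQuiver C.toGradedQuiver G H) {R : BarMap _ _ F H}
    (hR : (f.conv 0 (r.toBar.conv d Q)).postHead =
      ((d + e).negOnePow : ℤ) • f.postB.toBar.conv 1 (f.conv 0 (r.toBar.conv d Q)) + R) :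
    (f.conv 0 (r.toBar.conv d Q)).comm (d + e) =
      f.conv 0 (r.toBar.conv d (Q.comm e)) +
        f.conv 0 (R - ((d + e).negOnePow : ℤ) • r.preCodiff.toBar.conv (d + 1) Q) := by
  -- The source codifferential acting on the arguments of f equals the target one acting on its
  -- outputs. This term cancels the first summand of `hR`, in which b does not reach r.
  have h₁ : f.preCodiff.conv (0 + 1) (r.toBar.conv d Q) =
      f.conv 0 (f.postB.toBar.conv 1 (f.conv 0 (r.toBar.conv d Q))) := by
    rw [hf.preCodiff_eq, hf.toIsHom.postCodiff, conv_assoc rfl, conv_assoc (add_zero 1).symm]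
  rw [BarMap.comm, BarMap.comm, hf.toIsHom.postCodiff_conv, hR, preCodiff_conv, preCodiff_conv, h₁,
    Comps.toBar_preCodiff]
  simp only [conv_add, conv_sub, conv_zsmul, Int.val_negOnePow_add, smul_add, smul_smul]
  -- Only the parities of d and e enter, so four cases remain.
  rcases Int.val_negOnePow_eq d with hd | hd <;> rcases Int.val_negOnePow_eq e with he | he <;>
    · simp [hd, he]
      abel

/-- The three terms correspond to a cut before r, between r and p, and after p. -/
lemma IsHom.cut_theta (hf : f.IsHom φ) (hg : g.IsHom ψ) (hh : h.IsHom χ) (d e : ℤ)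
    (r : Comps B.toGradedQuiver C.toGradedQuiver F G)
    (p : Comps B.toGradedQuiver C.toGradedQuiver G H) :
    (thetaMap f d r g e p h).cut = f.conv₂ 0 (thetaMap f d r g e p h) +
      ((r.coder f d g).conv₂ d (p.coder g e h) + (thetaMap f d r g e p h).conv₂ (d + e) h) := by
  apply hf.cut_conv_add
  have h₁ : (r.coder f d g).conv₂ d (p.coder g e h) = r.act₂ d (g.conv₂ 0 (p.coder g e h)) +
      φ.act₂ 0 ((r.coder f d g).conv₂ d (p.coder g e h)) :=
    hf.act₂_conv₂ (add_zero d).symm r g (p.coder g e h)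
  have h₂ : (thetaMap f d r g e p h).conv₂ (d + e) h = r.act₂ d ((p.coder g e h).conv₂ e h) +
      φ.act₂ 0 ((thetaMap f d r g e p h).conv₂ (d + e) h) :=
    hf.act₂_conv₂ (d := d) (e := e) rfl r (p.coder g e h) h
  have h₃ : (BarMap.conv 0 g (BarMap.conv e p.toBar h)).cut =
    g.conv₂ 0 (p.coder g e h) + (p.coder g e h).conv₂ e h := hg.cut_coder hh e p
  rw [h₃, Comps.act₂_add, Comps.act₂_add]
  exact (congrArg₂ (· + ·) h₁ h₂).trans (add_add_add_comm _ _ _ _)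

end BarMap

/-- The composite of three coderivations, the sum of all
`f_{a α} ⊗ r_j ⊗ g_{c β} ⊗ p_t ⊗ h_{e γ} ⊗ q_i ⊗ l_{m δ}`. -/
def thetaMap₃ (f : BarMap B.toGradedQuiver C.toGradedQuiver F F) (d : ℤ)
    (r : Comps B.toGradedQuiver C.toGradedQuiver F G)
    (g : BarMap B.toGradedQuiver C.toGradedQuiver G G) (e : ℤ)
    (p : Comps B.toGradedQuiver C.toGradedQuiver G H)
    (h : BarMap B.toGradedQuiver C.toGradedQuiver H H) (a : ℤ)
    (q : Comps B.toGradedQuiver C.toGradedQuiver H I)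
    (l : BarMap B.toGradedQuiver C.toGradedQuiver I I) :
    BarMap B.toGradedQuiver C.toGradedQuiver F I :=
  f.conv 0 (r.toBar.conv d (thetaMap g e p h a q l))

namespace BarMap

lemma IsHom.cut_theta₃ (hf : f.IsHom φ) (hg : g.IsHom ψ) (hh : h.IsHom χ) (hl : l.IsHom ω)
    (d e a : ℤ)
    (r : Comps B.toGradedQuiver C.toGradedQuiver F G)
    (p : Comps B.toGradedQuiver C.toGradedQuiver G H)
    (q : Comps B.toGradedQuiver C.toGradedQuiver H I) :
    (thetaMap₃ f d r g e p h a q l).cut = f.conv₂ 0 (thetaMap₃ f d r g e p h a q l) +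
      ((r.coder f d g).conv₂ d (thetaMap g e p h a q l) +
        ((thetaMap f d r g e p h).conv₂ (d + e) (q.coder h a l) +
        (thetaMap₃ f d r g e p h a q l).conv₂ (d + (e + a)) l)) := by
  apply hf.cut_conv_add
  have h₁ : (r.coder f d g).conv₂ d (thetaMap g e p h a q l) =
      r.act₂ d (g.conv₂ 0 (thetaMap g e p h a q l)) +
        φ.act₂ 0 ((r.coder f d g).conv₂ d (thetaMap g e p h a q l)) :=
    hf.act₂_conv₂ (add_zero d).symm r g (thetaMap g e p h a q l)
  have h₂ : (thetaMap f d r g e p h).conv₂ (d + e) (q.coder h a l) =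
      r.act₂ d ((p.coder g e h).conv₂ e (q.coder h a l)) +
        φ.act₂ 0 ((thetaMap f d r g e p h).conv₂ (d + e) (q.coder h a l)) :=
    hf.act₂_conv₂ (d := d) (e := e) rfl r (p.coder g e h) (q.coder h a l)
  have h₃ : (thetaMap₃ f d r g e p h a q l).conv₂ (d + (e + a)) l =
      r.act₂ d ((thetaMap g e p h a q l).conv₂ (e + a) l) +
        φ.act₂ 0 ((thetaMap₃ f d r g e p h a q l).conv₂ (d + (e + a)) l) :=
    hf.act₂_conv₂ (d := d) (e := e + a) rfl r (thetaMap g e p h a q l) l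
  rw [hg.cut_theta hh hl, Comps.act₂_add, Comps.act₂_add, Comps.act₂_add, Comps.act₂_add]
  refine (congrArg₂ (· + ·) h₁ (congrArg₂ (· + ·) h₂ h₃)).trans ?_
  exact (congrArg₂ (· + ·) rfl (add_add_add_comm _ _ _ _)).trans (add_add_add_comm _ _ _ _)

lemma HasDeg.theta {A : GradedQuiver.{u, v} k} {D : GradedQuiver.{u, w} k}
    {F G H : A.Ob → D.Ob} {f : BarMap A D F F} {g : BarMap A D G G} {h : BarMap A D H H}
    (hf : f.HasDeg 0) (hg : g.HasDeg 0) (hh : h.HasDeg 0) {r : Comps A D F G} {p : Comps A D G H}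
    {d e n : ℤ} (hr : r.HasDegree d) (hp : p.HasDegree e) (hn : n = d + e) :
    (thetaMap f d r g e p h).HasDeg n :=
  hf.conv (hr.toBar.conv (hp.coder hg hh) d hn) 0 (zero_add n).symm

lemma IsFunctor.comm_coder (hf : f.IsFunctor φ) (hg : g.IsFunctor ψ) {d : ℤ}
    {r : Comps B.toGradedQuiver C.toGradedQuiver F G} (hr : r.HasDegree d) :
    (r.coder f d g).comm d = (transfB₁ f g d r).coder f (d + 1) g := by
  have key := hf.comm_conv d 0 r g (R := (r.coder f d g).postB.toBar.conv (d + 1) g) (by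
    change (r.coder f d g).postHead = _
    rw [postHead_eq, hf.toIsHom.cut_coder hg.toIsHom, AInfCat.headMap_add,
      AInfCat.headMap_conv₂ 0 f (hr.coder hf.hasDeg hg.hasDeg),
      AInfCat.headMap_conv₂ d (r.coder f d g) hg.hasDeg, zero_add, add_zero]
    simp [Comps.coder])
  rw [add_zero, hg.comm_eq_zero, conv_zero, conv_zero, zero_add] at key
  refine key.trans ?_
  simp only [transfB₁_eq, Comps.coder, Comps.toBar_sub, sub_conv, Comps.toBar_zsmul, zsmul_conv]

lemma IsFunctor.comm_theta (hf : f.IsFunctor φ) (hg : g.IsFunctor ψ) (hh : h.IsFunctor χ) {d e : ℤ}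
    {r : Comps B.toGradedQuiver C.toGradedQuiver F G} (hr : r.HasDegree d)
    {p : Comps B.toGradedQuiver C.toGradedQuiver G H} (hp : p.HasDegree e) :
    (thetaMap f d r g e p h).comm (d + e) =
      thetaMap f d r g (e + 1) (transfB₁ g h e p) h +
      ((e.negOnePow : ℤ) • thetaMap f (d + 1) (transfB₁ f g d r) g e p h +
      (thetaMap f d r g e p h).postB.coder f (d + e + 1) h) := by
  have key := hf.comm_conv d e r (p.coder g e h) (R := (e.negOnePow : ℤ) •
      (r.coder f d g).postB.toBar.conv (d + 1) (p.coder g e h) +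
      (thetaMap f d r g e p h).postB.toBar.conv (d + e + 1) h) (by
    change (thetaMap f d r g e p h).postHead = _
    rw [postHead_eq, hf.toIsHom.cut_theta hg.toIsHom hh.toIsHom, AInfCat.headMap_add,
      AInfCat.headMap_add,
      AInfCat.headMap_conv₂ 0 f (HasDeg.theta hf.hasDeg hg.hasDeg hh.hasDeg hr hp rfl),
      AInfCat.headMap_conv₂ _ _ (hp.coder hg.hasDeg hh.hasDeg),
      AInfCat.headMap_conv₂ _ _ hh.hasDeg, zero_add]
    simp [thetaMap, Comps.coder])
  refine key.trans ?_
  rw [hg.comm_coder hh hp]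
  simp only [thetaMap, Comps.coder, transfB₁_eq, Comps.toBar_sub, Comps.toBar_zsmul, sub_conv,
    zsmul_conv, conv_sub, conv_zsmul, conv_add, Int.val_negOnePow_add]
  rcases Int.val_negOnePow_eq d with hd | hd <;> rcases Int.val_negOnePow_eq e with he | he <;>
    · simp [hd, he]
      abel

end BarMap

/-- `B₁² = 0`. -/
lemma transfB₁_transfB₁ (hf : f.IsFunctor φ) (hg : g.IsFunctor ψ) {d : ℤ}
    {r : Comps B.toGradedQuiver C.toGradedQuiver F G} (hr : r.HasDegree d) :
    transfB₁ f g (d + 1) (transfB₁ f g d r) = 0 := by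
  rw [transfB₁_eq, ← hf.comm_coder hg hr, BarMap.postB_comm, transfB₁_eq, Comps.preCodiff_sub,
    Comps.preCodiff_zsmul, Comps.preCodiff_preCodiff, Int.val_negOnePow_add_one]
  simp

/-- The operation `(r ⊗ p)B₂` for coderivations of arbitrary degrees. -/
lemma transfB₁_postB_theta (hf : f.IsFunctor φ) (hg : g.IsFunctor ψ) (hh : h.IsFunctor χ) {d e : ℤ}
    {r : Comps B.toGradedQuiver C.toGradedQuiver F G} (hr : r.HasDegree d)
    {p : Comps B.toGradedQuiver C.toGradedQuiver G H} (hp : p.HasDegree e) :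
    transfB₁ f h (d + e + 1) (thetaMap f d r g e p h).postB =
      - ((thetaMap f d r g (e + 1) (transfB₁ g h e p) h).postB +
        (e.negOnePow : ℤ) • (thetaMap f (d + 1) (transfB₁ f g d r) g e p h).postB) := by
  -- Taking sC-components of the commutator formula, with b² = 0, gives the Leibniz rule for B₁ and
  -- B₂.
  have key := BarMap.postB_comm (d + e) (thetaMap f d r g e p h)
  rw [hf.comm_theta hg hh hr hp, BarMap.postB_add, BarMap.postB_add, BarMap.postB_zsmul] at key
  rw [eq_neg_iff_add_eq_zero] at key
  rw [transfB₁_eq, Int.val_negOnePow_add_one, neg_smul, sub_neg_eq_add, eq_neg_iff_add_eq_zero]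
  refine Eq.trans ?_ key
  abel

lemma thetaMap_zero_left (d e : ℤ) (p : Comps B.toGradedQuiver C.toGradedQuiver G H) :
    thetaMap f d (0 : Comps B.toGradedQuiver C.toGradedQuiver F G) g e p h = 0 := by
  have : (0 : Comps B.toGradedQuiver C.toGradedQuiver F G).toBar = 0 := by
    funext X Y; exact LinearMap.comp_zero _
  rw [thetaMap, this, BarMap.zero_conv, BarMap.conv_zero]

lemma thetaMap_zero_right (d e : ℤ) (r : Comps B.toGradedQuiver C.toGradedQuiver F G) :
    thetaMap f d r g e (0 : Comps B.toGradedQuiver C.toGradedQuiver G H) h = 0 := by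
  have : (0 : Comps B.toGradedQuiver C.toGradedQuiver G H).toBar = 0 := by
    funext X Y; exact LinearMap.comp_zero _
  rw [thetaMap, this, BarMap.zero_conv, BarMap.conv_zero, BarMap.conv_zero, BarMap.conv_zero]

/-- Composition of natural transformations is associative up to the differential of
`(r ⊗ p ⊗ q)B₃`. -/
lemma transfB₂_assoc (hf : f.IsFunctor φ) (hg : g.IsFunctor ψ) (hh : h.IsFunctor χ)
    (hl : l.IsFunctor ω) {r : Comps B.toGradedQuiver C.toGradedQuiver F G} (hr : IsNatTransf f g r)
    {p : Comps B.toGradedQuiver C.toGradedQuiver G H} (hp : IsNatTransf g h p)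
    {q : Comps B.toGradedQuiver C.toGradedQuiver H I} (hq : IsNatTransf h l q) :
    transfB₂ f h l (transfB₂ f g h r p) q - transfB₂ f g l r (transfB₂ g h l p q) =
      transfB₁ f l (-2) (thetaMap₃ f (-1) r g (-1) p h (-1) q l).postB := by
  have hpq : (thetaMap g (-1) p h (-1) q l).HasDeg (-2) :=
    BarMap.HasDeg.theta hg.hasDeg hh.hasDeg hl.hasDeg hp.1 hq.1 rfl
  have hrpq : (thetaMap₃ f (-1) r g (-1) p h (-1) q l).HasDeg (-3) :=
    hf.hasDeg.conv (hr.1.toBar.conv hpq (-1) rfl) 0 rfl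
  -- The summands of `R` are the cases where the initial segment consumed by b ends between r and p,
  -- between p and q, or behind q. Their signs come from the degrees -2, -1 and 0 of what is left
  -- over.
  have key := hf.comm_conv (-1) (-2) r (thetaMap g (-1) p h (-1) q l)
    (R := (r.coder f (-1) g).postB.toBar.conv 0 (thetaMap g (-1) p h (-1) q l) -
      (thetaMap f (-1) r g (-1) p h).postB.toBar.conv (-1) (q.coder h (-1) l) +
      (thetaMap₃ f (-1) r g (-1) p h (-1) q l).postB.toBar.conv (-2) l) (by
    change (thetaMap₃ f (-1) r g (-1) p h (-1) q l).postHead = _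
    rw [BarMap.postHead_eq, hf.toIsHom.cut_theta₃ hg.toIsHom hh.toIsHom hl.toIsHom,
      AInfCat.headMap_add, AInfCat.headMap_add, AInfCat.headMap_add,
      AInfCat.headMap_conv₂ _ _ hrpq, AInfCat.headMap_conv₂ _ _ hpq,
      AInfCat.headMap_conv₂ _ _ (hq.1.coder hh.hasDeg hl.hasDeg),
      AInfCat.headMap_conv₂ _ _ hl.hasDeg]
    norm_num [thetaMap₃, Int.negOnePow]
    abel)
  have hpq' : (thetaMap g (-1) p h (-1) q l).comm (-2) =
      (transfB₂ g h l p q).coder g (-1) l := by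
    have := hg.comm_theta hh hl hp.1 hq.1
    rw [hp.2, hq.2, thetaMap_zero_left, thetaMap_zero_right] at this
    have h₂ : transfB₂ g h l p q = (thetaMap g (-1) p h (-1) q l).postB := rfl
    rw [h₂]
    simpa using this
  rw [hpq'] at key
  have hr2 := hr.2
  rw [transfB₁_eq, sub_eq_zero] at hr2
  have e₁ : (((-1 : ℤ) + -2).negOnePow : ℤ) = -1 := by rw [Int.val_negOnePow_add, Int.val_negOnePow_neg_two]; simp
  have h₁ : (thetaMap₃ f (-1) r g (-1) p h (-1) q l).comm (-1 + -2) =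
      thetaMap f (-1) r g (-1) (transfB₂ g h l p q) l -
        thetaMap f (-1) (transfB₂ f g h r p) h (-1) q l +
        (thetaMap₃ f (-1) r g (-1) p h (-1) q l).postB.coder f (-2) l := by
    refine key.trans ?_
    rw [hr2, Comps.toBar_zsmul, BarMap.zsmul_conv, e₁]
    have h₃ : (-1 : ℤ) + 1 = 0 := rfl
    have h₄ : (thetaMap f (-1) r g (-1) p h).postB = transfB₂ f g h r p := rfl
    rw [h₃, h₄]
    have h₅ : ∀ (a b c : BarMap B.toGradedQuiver C.toGradedQuiver F I),
        ((-1 : ℤ).negOnePow : ℤ) • a - b + c - (-1 : ℤ) • a = c - b := by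
      intro a b c
      simp
      abel
    rw [h₅, BarMap.conv_sub]
    simp only [Comps.coder, thetaMap]
    abel
  have h₂ := congrArg BarMap.postB h₁
  rw [BarMap.postB_comm, e₁, BarMap.postB_add, BarMap.postB_sub] at h₂
  change _ = transfB₂ f g l r (transfB₂ g h l p q) - transfB₂ f h l (transfB₂ f g h r p) q + _ at h₂
  rw [neg_smul, neg_neg, one_smul, ← sub_eq_iff_eq_add] at h₂
  rw [transfB₁_eq, ← neg_sub, ← h₂, Int.val_negOnePow_neg_two, one_smul, neg_sub]

end Transformations

/-! ### Vanishing in low length, and the homomorphism with given components -/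

section Homs

variable {k : Type u} [CommRing k] {A : GradedQuiver.{u, v} k} {C : GradedQuiver.{u, w} k}
  {F G H : A.Ob → C.Ob}

lemma GradedQuiver.sweep_sub_first_mem {X Y : A.Ob} {T : Type*} [AddCommGroup T] [Module k T]
    {N : Submodule k T} {β : ∀ Z, A.Bar X Z →ₗ[k] A.Bar Z Y →ₗ[k] T} {p : ObPath X Y}
    (h : ∀ Z (q : ObPath X Z) (q' : ObPath Z Y), q'.length < p.length →
      ∀ s t, β Z (A.ι q s) (A.ι q' t) ∈ N) (t : A.Tens p) :
    A.sweep β (A.ι p t) - β X (A.one X) (A.ι p t) ∈ N := by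
  cases p with
  | nil X =>
    obtain ⟨c, rfl⟩ := (A.tensNil X).surjective t
    rw [A.ι_nil, map_smul, map_smul, A.sweep_one, sub_self]
    exact N.zero_mem
  | @cons _ Z _ p =>
    obtain ⟨t, rfl⟩ := (A.tensCons X p).surjective t
    induction t using TensorProduct.induction_on with
    | zero => simp
    | add s t hs ht =>
      simp only [map_add]
      rw [add_sub_add_comm]
      exact N.add_mem hs ht
    | tmul x t =>
      rw [← A.consT_ι, A.sweep_cons, add_sub_cancel_left]
      apply A.sweep_mem_of_length
      intro W q q' hq s t
      rw [LinearMap.comp_apply, A.consT_ι]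
      exact h W (.cons X q) q' (by simp only [ObPath.length]; omega) _ _

/-- The family vanishes on `TᵐsA` for `m < n`. -/
def BarMap.VanishesBelow (Q : BarMap A C F G) (n : ℕ) : Prop :=
  ∀ X Y (p : ObPath X Y), p.length < n → ∀ t, Q X Y (A.ι p t) = 0

/-- The components with fewer than `n` arguments vanish. -/
def Comps.VanishesBelow (r : Comps A C F G) (n : ℕ) : Prop :=
  ∀ X Y (p : ObPath X Y), p.length < n → ∀ t, r X Y (A.ι p t) = 0

lemma Comps.apply_nil {φ : Comps A C F F} (h : ∀ X, φ X X (A.one X) = 0) (X : A.Ob)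
    (t : A.Tens (.nil X)) : φ X X (A.ι (.nil X) t) = 0 := by
  obtain ⟨c, rfl⟩ := (A.tensNil X).surjective t
  rw [A.ι_nil, map_smul, h, smul_zero]

lemma BarMap.VanishesBelow.conv {K : BarMap A C G H} {n : ℕ} (hK : K.VanishesBelow n) (d : ℤ)
    (Q : BarMap A C F G) : (Q.conv d K).VanishesBelow n := by
  intro X Y p hp t
  rw [conv_apply, ← Submodule.mem_bot (R := k)]
  apply A.sweep_mem_of_length
  intro Z q q' hq s t
  rw [Submodule.mem_bot, LinearMap.compl₁₂_apply, LinearMap.comp_apply, A.barSgn_ι,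
    hK _ _ _ (by omega), map_zero]

/-- A nonempty family of blocks of f takes at least one argument, leaving K fewer than the n it
needs. -/
lemma BarMap.IsHom.conv_apply_of_vanishesBelow {f : BarMap A C F F} {φ : Comps A C F F}
    (hf : f.IsHom φ) {K : BarMap A C F H} {n : ℕ} (hK : K.VanishesBelow n) {X Y : A.Ob}
    {p : ObPath X Y} (hp : p.length ≤ n) (t : A.Tens p) :
    f.conv 0 K X Y (A.ι p t) = K X Y (A.ι p t) := by
  rw [hf.conv_eq, Pi.add_apply, Pi.add_apply, LinearMap.add_apply, add_eq_left, toBar_conv_apply,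
    ← Submodule.mem_bot (R := k)]
  apply A.sweep_mem_of_length
  intro Z q q' hq s t
  rw [Submodule.mem_bot, LinearMap.compl₁₂_apply, LinearMap.comp_apply, A.barSgn_ι]
  cases q with
  | nil => rw [Comps.apply_nil hf.one]; simp
  | cons X q =>
    rw [hK.conv 0 f _ _ q' (by simp only [ObPath.length] at hq; omega), map_zero]

/-- With at most n arguments available, v must take all of them, and K is left with the empty
tensor. -/
lemma Comps.VanishesBelow.conv_apply {v : Comps A C F G} {n : ℕ} (hv : v.VanishesBelow n) (d : ℤ)
    (K : BarMap A C G H) {X Y : A.Ob} {p : ObPath X Y} (hp : p.length ≤ n) (t : A.Tens p) :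
    v.toBar.conv d K X Y (A.ι p t) = C.consT (v X Y (A.ι p t)) (K Y Y (A.one Y)) := by
  rw [BarMap.toBar_conv_apply, GradedQuiver.sweep_eq_last]
  · rw [LinearMap.compl₁₂_apply, LinearMap.comp_apply, A.barSgn_one]
  · intro Z q q' hq s t
    rw [LinearMap.compl₁₂_apply, hv _ _ _ (by omega)]
    simp

lemma Comps.VanishesBelow.conv {v : Comps A C F G} {n : ℕ} (hv : v.VanishesBelow n) (d : ℤ)
    (K : BarMap A C G H) : (v.toBar.conv d K).VanishesBelow n := by
  intro X Y p hp t
  rw [hv.conv_apply d K hp.le, hv _ _ _ hp]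
  simp

lemma BarMap.conv_sum (d : ℤ) (φ : BarMap A C F G) {ι : Type*} (s : Finset ι)
    (ψ : ι → BarMap A C G H) : φ.conv d (∑ i ∈ s, ψ i) = ∑ i ∈ s, φ.conv d (ψ i) :=
  map_sum (AddMonoidHom.mk' (fun ψ : BarMap A C G H => φ.conv d ψ) (conv_add d φ)) ψ s

namespace Comps

variable {φ : Comps A C F F}

lemma power_eq_zero (hφ : ∀ X, φ X X (A.one X) = 0) (l : ℕ) : (φ.power l).VanishesBelow l := by
  induction l with
  | zero => intro X Y p hp; omega
  | succ l ih =>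
    intro X Y p hp t
    rw [power, BarMap.toBar_conv_apply, ← Submodule.mem_bot (R := k)]
    apply A.sweep_mem_of_length
    intro Z q q' hq s t
    rw [Submodule.mem_bot, LinearMap.compl₁₂_apply, LinearMap.comp_apply, A.barSgn_ι]
    cases q with
    | nil => rw [apply_nil hφ]; simp
    | cons X q =>
      rw [ih _ _ q' (by simp only [ObPath.length] at hq; omega), map_zero]

lemma hom_apply (hφ : ∀ X, φ X X (A.one X) = 0) {X Y : A.Ob} {p : ObPath X Y} {n : ℕ}
    (hn : p.length < n) (t : A.Tens p) :
    φ.hom X Y (A.ι p t) = (∑ l ∈ Finset.range n, φ.power l) X Y (A.ι p t) := by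
  rw [hom, A.ofSummands_ι, Finset.sum_apply, Finset.sum_apply, LinearMap.sum_apply,
    LinearMap.sum_apply]
  simp only [LinearMap.comp_apply]
  apply Finset.sum_subset
  · intro l hl
    rw [Finset.mem_range] at *
    omega
  · intro l _ hl
    rw [Finset.mem_range] at hl
    exact power_eq_zero hφ l _ _ p (by omega) t

/-- As φ₀ = 0, the truncation in `Comps.hom` may be placed at any bound above the length. Using one
bound for f and the next one for φ * f, the term l = 0 is the unit and each further power is φ times
its predecessor. -/
lemma hom_eq (hφ : ∀ X, φ X X (A.one X) = 0) :
    φ.hom = BarMap.unit C F + φ.toBar.conv 0 φ.hom := by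
  funext X Y
  apply A.bar_hom_ext
  intro p t
  have h : φ.toBar.conv 0 φ.hom X Y (A.ι p t) =
      φ.toBar.conv 0 (∑ l ∈ Finset.range (p.length + 1), φ.power l) X Y (A.ι p t) := by
    rw [← sub_eq_zero, ← LinearMap.sub_apply, ← Pi.sub_apply, ← Pi.sub_apply, ← BarMap.conv_sub]
    have hv : (φ.hom - ∑ l ∈ Finset.range (p.length + 1), φ.power l).VanishesBelow
        (p.length + 1) := by
      intro X Y q hq t
      rw [Pi.sub_apply, Pi.sub_apply, LinearMap.sub_apply, hom_apply hφ hq, sub_self]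
    exact hv.conv 0 _ X Y p (Nat.lt_succ_self _) t
  rw [Pi.add_apply, Pi.add_apply, LinearMap.add_apply, h, BarMap.conv_sum,
    hom_apply hφ (n := p.length + 1 + 1) (by omega), Finset.sum_range_succ', add_comm]
  rfl

lemma hom_hasDeg (hd : φ.HasDegree 0) : φ.hom.HasDeg 0 := by
  have hp : ∀ l, (φ.power l).HasDeg 0 := by
    intro l
    induction l with
    | zero => exact BarMap.HasDeg.unit
    | succ l ih => exact hd.toBar.conv ih 0 (add_zero 0).symm
  intro X Y d t ht
  refine A.bgr_le (N := (C.bgr (F X) (F Y) (d + 0)).comap (φ.hom X Y)) ?_ ht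
  intro p t ht
  rw [Submodule.mem_comap, hom, A.ofSummands_ι, LinearMap.sum_apply]
  exact Submodule.sum_mem _ fun l _ => hp l X Y d _ (A.ι_mem_bgr ht)

lemma isHom_hom (hφ : ∀ X, φ X X (A.one X) = 0) (hd : φ.HasDegree 0) : φ.hom.IsHom φ where
  one := hφ
  eq := hom_eq hφ
  degree X Y d t ht := by simpa using hom_hasDeg hd X Y d t ht

lemma HasDegree.sgn {r : Comps A C F G} {d : ℤ} (hr : r.HasDegree d) (m : ℤ) {X Y : A.Ob}
    (t : A.Bar X Y) :
    C.sgn m (F X) (G Y) (r X Y t) = ((m * d).negOnePow : ℤ) • r X Y (A.barSgn m X Y t) := by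
  have : C.sgn m (F X) (G Y) ∘ₗ r X Y = ((m * d).negOnePow : ℤ) • (r X Y ∘ₗ A.barSgn m X Y) := by
    apply A.bar_hom_ext_of_degree
    intro e t ht
    rw [LinearMap.comp_apply, C.sgn_of_mem m (hr.apply ht), LinearMap.smul_apply,
      LinearMap.comp_apply, A.barSgn_of_mem m ht, map_zsmul, smul_smul, ← Units.val_mul,
      ← Int.negOnePow_add]
    congr 3
    ring
  exact LinearMap.congr_fun this t

lemma HasDegree.add {r r' : Comps A C F G} {d : ℤ} (h : r.HasDegree d) (h' : r'.HasDegree d) :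
    (r + r').HasDegree d :=
  fun X Y p e x hx => Submodule.add_mem _ (h X Y p e x hx) (h' X Y p e x hx)

lemma HasDegree.sub {r r' : Comps A C F G} {d : ℤ} (h : r.HasDegree d) (h' : r'.HasDegree d) :
    (r - r').HasDegree d :=
  fun X Y p e x hx => Submodule.sub_mem _ (h X Y p e x hx) (h' X Y p e x hx)

lemma HasDegree.neg {r : Comps A C F G} {d : ℤ} (h : r.HasDegree d) : (-r).HasDegree d :=
  fun X Y p e x hx => Submodule.neg_mem _ (h X Y p e x hx)

lemma HasDegree.zero (d : ℤ) : (0 : Comps A C F G).HasDegree d :=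
  fun _ _ _ _ _ _ => Submodule.zero_mem _

lemma HasDegree.zsmul {r : Comps A C F G} {d : ℤ} (h : r.HasDegree d) (n : ℤ) :
    (n • r).HasDegree d :=
  fun X Y p e x hx => zsmul_mem (h X Y p e x hx) n

end Comps

end Homs

/-! ### Leading terms of B₁ and B₂ for the filtration by length -/

section LeadingTerms

variable {k : Type u} [CommRing k] {B : AInfCat.{u, v} k} {C : AInfCat.{u, w} k}
  {F G H : B.Ob → C.Ob}
  {f : BarMap B.toGradedQuiver C.toGradedQuiver F F}
  {φ : Comps B.toGradedQuiver C.toGradedQuiver F F}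
  {g : BarMap B.toGradedQuiver C.toGradedQuiver G G}
  {ψ : Comps B.toGradedQuiver C.toGradedQuiver G G}
  {h : BarMap B.toGradedQuiver C.toGradedQuiver H H}
  {χ : Comps B.toGradedQuiver C.toGradedQuiver H H}

lemma AInfFunctor.isFunctor (f : AInfFunctor B C F) : f.hom.IsFunctor f.comps where
  toIsHom := Comps.isHom_hom f.zero f.degree
  comm := by funext X Y; exact f.comm X Y

lemma BarMap.HasDeg.postB {Q : BarMap B.toGradedQuiver C.toGradedQuiver F G} {d n : ℤ}
    (hQ : Q.HasDeg d) (hn : n = d + 1) : Q.postB.HasDegree n := by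
  intro X Y p e x hx
  have := C.b_degree.apply (hQ X Y e _ (B.ι_mem_bgr hx))
  rw [hn, ← add_assoc]
  exact this

lemma Comps.HasDegree.preCodiff {r : Comps B.toGradedQuiver C.toGradedQuiver F G} {d n : ℤ}
    (hr : r.HasDegree d) (hn : n = d + 1) : r.preCodiff.HasDegree n := by
  intro X Y p e x hx
  have := hr.apply (B.codiff_hasDeg X Y e _ (B.ι_mem_bgr hx))
  rw [hn, add_comm d, ← add_assoc]
  exact this

lemma Comps.HasDegree.transfB₁ {r : Comps B.toGradedQuiver C.toGradedQuiver F G} {d n : ℤ}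
    (hr : r.HasDegree d) (hf : f.HasDeg 0) (hg : g.HasDeg 0) (hn : n = d + 1) :
    (transfB₁ f g d r).HasDegree n :=
  ((hr.coder hf hg).postB hn).sub ((hr.preCodiff hn).zsmul _)

/-- The span of the tensors with fewer than `n` factors. -/
def GradedQuiver.shorter (A : GradedQuiver.{u, v} k) (X Y : A.Ob) (n : ℕ) :
    Submodule k (A.Bar X Y) :=
  ⨆ p : {p : ObPath X Y // p.length < n}, LinearMap.range (A.ι p.1)

lemma GradedQuiver.ι_mem_shorter (A : GradedQuiver.{u, v} k) {X Y : A.Ob} {p : ObPath X Y} {n : ℕ}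
    (hp : p.length < n) (t : A.Tens p) : A.ι p t ∈ A.shorter X Y n :=
  Submodule.mem_iSup_of_mem (⟨p, hp⟩ : {p : ObPath X Y // p.length < n}) ⟨t, rfl⟩

lemma GradedQuiver.consT_mem_shorter (A : GradedQuiver.{u, v} k) {X Z Y : A.Ob} (x : A.Hom X Z)
    {n : ℕ} {t : A.Bar Z Y} (ht : t ∈ A.shorter Z Y n) : A.consT x t ∈ A.shorter X Y (n + 1) := by
  have : A.shorter Z Y n ≤ (A.shorter X Y (n + 1)).comap (A.consT x) := by
    apply iSup_le
    rintro ⟨p, hp⟩ _ ⟨t, rfl⟩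
    rw [Submodule.mem_comap, A.consT_ι]
    exact A.ι_mem_shorter (by simp only [ObPath.length]; omega) _
  exact this ht

lemma Comps.VanishesBelow.apply_shorter {r : Comps B.toGradedQuiver C.toGradedQuiver F G} {n : ℕ}
    (hr : r.VanishesBelow n) {X Y : B.Ob} {t : B.Bar X Y} (ht : t ∈ B.shorter X Y n) :
    r X Y t = 0 := by
  have : B.shorter X Y n ≤ LinearMap.ker (r X Y) := by
    apply iSup_le
    rintro ⟨p, hp⟩ _ ⟨t, rfl⟩
    exact hr X Y p hp t
  exact this ht

/-- Since b₀ = 0 and bₙ replaces n factors by one, only b₁ keeps the number of factors; all other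
terms are shorter. -/
lemma AInfCat.codiff_ι_sub_mem (B : AInfCat.{u, v} k) {X Y : B.Ob} (p : ObPath X Y)
    (t : B.Tens p) :
    B.codiff X Y (B.ι p t) - B.ι p (B.tensD p t) ∈ B.shorter X Y p.length := by
  refine B.tens_induction (P := fun {X} p t => B.codiff X Y (B.ι p t) - B.ι p (B.tensD p t) ∈
    B.shorter X Y p.length) ?_ ?_ ?_ ?_ p t
  · intro X p; simp
  · intro X p s t hs ht
    simp only [map_add]
    rw [add_sub_add_comm]
    exact Submodule.add_mem _ hs ht
  · intro c
    rw [B.ι_nil, map_smul, B.codiff_one, tensD]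
    simp
  · intro X Z x p t ht
    -- Among the operations that start at x, only b₁ takes x alone; a longer segment shortens the
    -- tensor.
    have h₁ : B.headB X Y (B.consT x (B.ι p t)) - B.consT (B.b₁ X Z x) (B.barSgn 1 Z Y (B.ι p t)) ∈
        B.shorter X Y (p.length + 1) := by
      rw [headB, BarMap.toBar_conv_apply, GradedQuiver.sweep_cons, LinearMap.compl₁₂_apply,
        B.b_zero, map_zero, LinearMap.zero_apply, zero_add]
      refine GradedQuiver.sweep_sub_first_mem (β := fun W => (B.consT.compl₁₂ (B.b X W)
        (BarMap.ident B.toGradedQuiver W Y ∘ₗ B.barSgn 1 W Y)) ∘ₗ B.consT x) ?_ t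
      intro W q q' hq s t
      rw [LinearMap.comp_apply, LinearMap.compl₁₂_apply, LinearMap.comp_apply, B.barSgn_ι]
      change B.consT _ (B.ι q' _) ∈ _
      rw [B.consT_ι]
      exact B.ι_mem_shorter (by simp only [ObPath.length]; omega) _
    have h₂ := B.consT_mem_shorter x ht
    have h₃ : B.ι (.cons X p) (B.tensD (.cons X p) (B.tensCons X p (x ⊗ₜ t))) =
        B.consT (B.b₁ X Z x) (B.barSgn 1 Z Y (B.ι p t)) + B.consT x (B.ι p (B.tensD p t)) := by
      rw [B.barSgn_ι, B.consT_ι, B.consT_ι, ← map_add, ← map_add, tensD, LinearEquiv.conj_apply]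
      simp
    rw [← B.consT_ι, B.consT_ι, h₃, ← B.consT_ι, B.codiff_cons, add_sub_add_comm, ← map_sub]
    exact Submodule.add_mem _ h₁ h₂

/-- The leading term of `vB₁`. -/
lemma transfB₁_comp_ι (hf : f.IsHom φ) (hg : g.IsHom ψ) (d : ℤ)
    {v : Comps B.toGradedQuiver C.toGradedQuiver F G} {n : ℕ} (hv : v.VanishesBelow n) {X Y : B.Ob}
    {p : ObPath X Y} (hp : p.length ≤ n) :
    transfB₁ f g d v X Y ∘ₗ B.ι p = homD C p (F X) (G Y) d (v X Y ∘ₗ B.ι p) := by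
  refine LinearMap.ext fun t => ?_
  -- All arguments go to v, so f and g contribute empty factors and the output is a single factor,
  -- on which b acts as b₁.
  have h₁ : v.coder f d g X Y (B.ι p t) = C.inc _ _ (v X Y (B.ι p t)) := by
    rw [Comps.coder, hf.conv_apply_of_vanishesBelow (hv.conv d g) hp, hv.conv_apply d g hp,
      hg.map_one]
    rfl
  have h₂ : v X Y (B.codiff X Y (B.ι p t)) = v X Y (B.ι p (B.tensD p t)) := by
    rw [← sub_eq_zero, ← map_sub]
    have hv' : v.VanishesBelow p.length := fun X Y q hq => hv X Y q (hq.trans_le hp)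
    exact hv'.apply_shorter (B.codiff_ι_sub_mem p t)
  simp only [transfB₁, homD, LinearMap.comp_apply, LinearMap.sub_apply, LinearMap.smul_apply, h₁, h₂,
    AInfCat.b₁]

/-- The leading term of `p ↦ (r ⊗ p)B₂`. -/
lemma postB_theta_left_comp_ι (hf : f.IsHom φ) (hg : g.IsHom ψ) (hh : h.IsHom χ)
    (r : Comps B.toGradedQuiver C.toGradedQuiver F G) {e : ℤ}
    {v : Comps B.toGradedQuiver C.toGradedQuiver G H} (he : v.HasDegree e)
    {n : ℕ} (hv : v.VanishesBelow n) {X Y : B.Ob} {p : ObPath X Y} (hp : p.length ≤ n) :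
    (thetaMap f (-1) r g e v h).postB X Y ∘ₗ B.ι p =
      (e.negOnePow : ℤ) • ((C.b₂ (F X) (G X) (H Y) (r X X (B.one X)) ∘ₗ C.sgn (-1) (G X) (H Y)) ∘ₗ
        (v X Y ∘ₗ B.ι p)) := by
  refine LinearMap.ext fun t => ?_
  have hc : (v.coder g e h).VanishesBelow n := (hv.conv e h).conv 0 g
  have h₁ : thetaMap f (-1) r g e v h X Y (B.ι p t) =
      C.consT (r X X (B.one X)) (C.inc _ _ (v X Y (B.barSgn (-1) X Y (B.ι p t)))) := by
    rw [thetaMap]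
    change f.conv 0 (r.toBar.conv (-1) (v.coder g e h)) X Y _ = _
    rw [hf.conv_apply_of_vanishesBelow (hc.conv (-1) r.toBar) hp, BarMap.toBar_conv_apply,
      GradedQuiver.sweep_eq_first]
    · rw [LinearMap.compl₁₂_apply, LinearMap.comp_apply, B.barSgn_ι, Comps.coder,
        hg.conv_apply_of_vanishesBelow (hv.conv e h) hp, hv.conv_apply e h hp, hh.map_one]
      rfl
    · intro Z q q' hq s t
      rw [LinearMap.compl₁₂_apply, LinearMap.comp_apply, B.barSgn_ι, hc _ _ _ (by omega), map_zero]
  -- In (r₀ ⊗ 1) the Koszul sign depends on the degree of the value of v; in the composite it was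
  -- taken on the argument. The two differ by (-1)^e, which is the factor in the statement.
  have h₂ := he.sgn (-1) (B.ι p t)
  rw [neg_one_mul, Int.negOnePow_neg] at h₂
  simp only [LinearMap.comp_apply, LinearMap.smul_apply, h₂, map_zsmul, smul_smul, BarMap.postB, h₁]
  have : (e.negOnePow : ℤ) * (e.negOnePow : ℤ) = 1 := by
    rcases Int.val_negOnePow_eq e with h | h <;> simp [h]
  rw [this, one_smul]
  rfl

/-- The leading term of `r ↦ (r ⊗ p)B₂`. -/
lemma postB_theta_right_comp_ι (hf : f.IsHom φ) (hg : g.IsHom ψ) (hh : h.IsHom χ) (e d : ℤ)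
    {v : Comps B.toGradedQuiver C.toGradedQuiver F G}
    (q : Comps B.toGradedQuiver C.toGradedQuiver G H)
    {n : ℕ} (hv : v.VanishesBelow n) {X Y : B.Ob} {p : ObPath X Y} (hp : p.length ≤ n) :
    (thetaMap f e v g d q h).postB X Y ∘ₗ B.ι p =
      (C.b₂ (F X) (G Y) (H Y)).flip (q Y Y (B.one Y)) ∘ₗ (v X Y ∘ₗ B.ι p) := by
  refine LinearMap.ext fun t => ?_
  have h₂ : q.coder g d h Y Y (B.one Y) = C.inc _ _ (q Y Y (B.one Y)) := by
    have hn : q.VanishesBelow 0 := fun X Y p hp => by omega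
    have := hn.conv_apply d h (p := .nil Y) (by simp [ObPath.length]) (B.tensNil Y 1)
    rw [Comps.coder, GradedQuiver.one, hg.conv_apply_of_vanishesBelow (hn.conv d h)
      (by simp [ObPath.length]), this, hh.map_one]
    rfl
  have h₁ : thetaMap f e v g d q h X Y (B.ι p t) =
      C.consT (v X Y (B.ι p t)) (C.inc _ _ (q Y Y (B.one Y))) := by
    rw [thetaMap]
    change f.conv 0 (v.toBar.conv e (q.coder g d h)) X Y _ = _
    rw [hf.conv_apply_of_vanishesBelow (hv.conv e _) hp, hv.conv_apply e _ hp, h₂]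
  simp only [LinearMap.comp_apply, BarMap.postB, h₁]
  rfl

end LeadingTerms

/-! ### Successive approximation -/

section Filtered

/-- Successive approximation in complete filtered groups. -/
theorem exists_eq_of_filtration {V₀ V₁ : Type*} [AddCommGroup V₀] [AddCommGroup V₁] (D : V₀ →+ V₁)
    (F₀ : ℕ → AddSubgroup V₀) (F₁ : ℕ → AddSubgroup V₁) (Z : AddSubgroup V₁)
    (hD : ∀ n, ∀ a ∈ F₀ n, D a ∈ F₁ n) (hDZ : ∀ n, ∀ a ∈ F₀ n, D a ∈ Z)
    (step : ∀ n, ∀ y ∈ F₁ n, y ∈ Z → ∃ a ∈ F₀ n, y - D a ∈ F₁ (n + 1))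
    (complete : ∀ a : ℕ → V₀, (∀ n, a n ∈ F₀ n) →
      ∃ s ∈ F₀ 0, ∀ n, s - ∑ m ∈ Finset.range n, a m ∈ F₀ n)
    (sep : ∀ y, (∀ n, y ∈ F₁ n) → y = 0) :
    ∀ y ∈ F₁ 0, y ∈ Z → ∃ a ∈ F₀ 0, y = D a := by
  intro y hy hyZ
  choose! st hst hst' using step
  -- The successive remainders of y, carried together with their filtration level and membership in
  -- `Z`, which the next correction requires.
  let seq : ∀ n, {y : V₁ // y ∈ F₁ n ∧ y ∈ Z} := fun n => Nat.rec ⟨y, hy, hyZ⟩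
    (fun n y => ⟨y.1 - D (st n y.1), hst' n _ y.2.1 y.2.2,
      Z.sub_mem y.2.2 (hDZ n _ (hst n _ y.2.1 y.2.2))⟩) n
  obtain ⟨s, hs, hs'⟩ := complete (fun n => st n (seq n).1)
    (fun n => hst n _ (seq n).2.1 (seq n).2.2)
  refine ⟨s, hs, ?_⟩
  have hseq : ∀ n, (seq n).1 = y - D (∑ m ∈ Finset.range n, st m (seq m).1) := by
    intro n
    induction n with
    | zero => simp [seq]
    | succ n ih =>
      rw [Finset.sum_range_succ, map_add, ← sub_sub, ← ih]
  rw [← sub_eq_zero]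
  apply sep
  intro n
  have := (F₁ n).sub_mem (seq n).2.1 (hD n _ (hs' n))
  rwa [hseq, map_sub, sub_sub_sub_cancel_right] at this

end Filtered

/-! ### The filtration by the number of arguments -/

section Components

variable {k : Type u} [CommRing k] {A : GradedQuiver.{u, v} k} {C : GradedQuiver.{u, w} k}
  {F G H : A.Ob → C.Ob}

/-- The components of degree `d` with at least `n` arguments. -/
def Comps.filtration (A : GradedQuiver.{u, v} k) (C : GradedQuiver.{u, w} k) (F G : A.Ob → C.Ob)
    (d : ℤ) (n : ℕ) : AddSubgroup (Comps A C F G) where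
  carrier := {r | r.HasDegree d ∧ r.VanishesBelow n}
  add_mem' {r r'} h h' := ⟨h.1.add h'.1, fun X Y p hp t => by
    rw [Pi.add_apply, Pi.add_apply, LinearMap.add_apply, h.2 _ _ _ hp, h'.2 _ _ _ hp, add_zero]⟩
  zero_mem' := ⟨Comps.HasDegree.zero d, fun _ _ _ _ _ => rfl⟩
  neg_mem' {r} h := ⟨h.1.neg, fun X Y p hp t => by
    rw [Pi.neg_apply, Pi.neg_apply, LinearMap.neg_apply, h.2 _ _ _ hp, neg_zero]⟩

/-- The family of components given by maps on the tensor products over sequences of length `n`. -/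
def Comps.ofLength (n : ℕ) (y : ∀ X Y (p : ObPath X Y), A.Tens p →ₗ[k] C.Hom (F X) (G Y)) :
    Comps A C F G := fun X Y => A.ofSummands fun p => if p.length = n then y X Y p else 0

lemma Comps.ofLength_comp_ι (n : ℕ) (y : ∀ X Y (p : ObPath X Y), A.Tens p →ₗ[k] C.Hom (F X) (G Y))
    {X Y : A.Ob} {p : ObPath X Y} (hp : p.length = n) :
    (Comps.ofLength n y : Comps A C F G) X Y ∘ₗ A.ι p = y X Y p := by
  refine LinearMap.ext fun t => ?_
  rw [ofLength, LinearMap.comp_apply, A.ofSummands_ι, if_pos hp]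

lemma Comps.ofLength_mem {n : ℕ} {d : ℤ}
    {y : ∀ X Y (p : ObPath X Y), A.Tens p →ₗ[k] C.Hom (F X) (G Y)}
    (hy : ∀ X Y (p : ObPath X Y), ∀ e, ∀ x ∈ A.tgr p e, y X Y p x ∈ C.sgr (F X) (G Y) (e + d)) :
    (Comps.ofLength n y : Comps A C F G) ∈ Comps.filtration A C F G d n := by
  refine ⟨fun X Y p e x hx => ?_, fun X Y p hp t => ?_⟩
  · rw [ofLength, A.ofSummands_ι]
    split_ifs
    · exact hy X Y p e x hx
    · exact Submodule.zero_mem _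
  · rw [ofLength, A.ofSummands_ι, if_neg hp.ne, LinearMap.zero_apply]

lemma Comps.mem_filtration_succ {d : ℤ} {n : ℕ} {r : Comps A C F G}
    (h : r ∈ Comps.filtration A C F G d n)
    (h' : ∀ X Y (p : ObPath X Y), p.length = n → r X Y ∘ₗ A.ι p = 0) :
    r ∈ Comps.filtration A C F G d (n + 1) := by
  refine ⟨h.1, fun X Y p hp t => ?_⟩
  rcases Nat.lt_succ_iff_lt_or_eq.1 hp with hp | hp
  · exact h.2 X Y p hp t
  · exact LinearMap.congr_fun (h' X Y p hp) t

/-- On tensors of length ℓ only the terms a₀, …, a_ℓ can be nonzero, so the infinite sum is finite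
on each summand. -/
lemma Comps.filtration_complete {d : ℤ} {a : ℕ → Comps A C F G}
    (ha : ∀ n, a n ∈ Comps.filtration A C F G d n) :
    ∃ s ∈ Comps.filtration A C F G d 0, ∀ n,
      s - ∑ m ∈ Finset.range n, a m ∈ Comps.filtration A C F G d n := by
  have key : ∀ n X Y (p : ObPath X Y), p.length < n → ∀ t,
      (∑ m ∈ Finset.range n, a m) X Y (A.ι p t) =
      (∑ m ∈ Finset.range (p.length + 1), a m) X Y (A.ι p t) := by
    intro n X Y p hp t
    simp only [Finset.sum_apply, LinearMap.sum_apply]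
    symm
    apply Finset.sum_subset
    · intro l hl
      rw [Finset.mem_range] at *
      omega
    · intro l _ hl
      rw [Finset.mem_range] at hl
      exact (ha l).2 _ _ p (by omega) t
  have hdeg : ∀ n, (∑ m ∈ Finset.range n, a m).HasDegree d := by
    intro n
    induction n with
    | zero => exact Comps.HasDegree.zero d
    | succ n ih => rw [Finset.sum_range_succ]; exact ih.add (ha n).1
  let s : Comps A C F G := fun X Y => A.ofSummands fun p =>
    (∑ m ∈ Finset.range (p.length + 1), a m) X Y ∘ₗ A.ι p
  have hs : s.HasDegree d := by
    intro X Y p e x hx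
    rw [A.ofSummands_ι]
    exact hdeg _ X Y p e x hx
  refine ⟨s, ⟨hs, fun X Y p hp => by omega⟩, fun n => ⟨hs.sub (hdeg n), fun X Y p hp t => ?_⟩⟩
  rw [Pi.sub_apply, Pi.sub_apply, LinearMap.sub_apply, key n X Y p hp, A.ofSummands_ι,
    LinearMap.comp_apply, sub_self]

lemma Comps.eq_zero_of_mem_filtration {d : ℤ} {r : Comps A C F G}
    (h : ∀ n, r ∈ Comps.filtration A C F G d n) : r = 0 := by
  funext X Y
  apply A.bar_hom_ext
  intro p t
  exact (h (p.length + 1)).2 X Y p (Nat.lt_succ_self _) t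

end Components

/-! ### Acyclicity of the cone of a filtered quasi-isomorphism -/

section Cone

variable {k : Type u} [CommRing k] {B : AInfCat.{u, v} k} {C : AInfCat.{u, w} k}
  {S S' T T' : B.Ob → C.Ob}
  {s : BarMap B.toGradedQuiver C.toGradedQuiver S S}
  {σ : Comps B.toGradedQuiver C.toGradedQuiver S S}
  {s' : BarMap B.toGradedQuiver C.toGradedQuiver S' S'}
  {σ' : Comps B.toGradedQuiver C.toGradedQuiver S' S'}
  {t : BarMap B.toGradedQuiver C.toGradedQuiver T T}
  {τ : Comps B.toGradedQuiver C.toGradedQuiver T T}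
  {t' : BarMap B.toGradedQuiver C.toGradedQuiver T' T'}
  {τ' : Comps B.toGradedQuiver C.toGradedQuiver T' T'}

lemma transfB₁_add (d : ℤ) (v v' : Comps B.toGradedQuiver C.toGradedQuiver S S') :
    transfB₁ s s' d (v + v') = transfB₁ s s' d v + transfB₁ s s' d v' := by
  have h : (v + v').preCodiff = v.preCodiff + v'.preCodiff := by
    funext X Y
    exact LinearMap.add_comp _ _ _
  simp only [transfB₁_eq, Comps.coder, Comps.toBar_add, BarMap.add_conv, BarMap.conv_add,
    BarMap.postB_add, h, smul_add]
  abel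

/-- `B₁` as a homomorphism of groups. -/
def transfB₁Hom (s : BarMap B.toGradedQuiver C.toGradedQuiver S S)
    (s' : BarMap B.toGradedQuiver C.toGradedQuiver S' S') (d : ℤ) :
    Comps B.toGradedQuiver C.toGradedQuiver S S' →+ Comps B.toGradedQuiver C.toGradedQuiver S S' :=
  AddMonoidHom.mk' (transfB₁ s s' d) (transfB₁_add d)

lemma homD_zsmul {X₀ Xₙ : B.Ob} (N : ObPath X₀ Xₙ) (U V : C.Ob) (d n : ℤ)
    (y : B.Tens N →ₗ[k] C.Hom U V) : homD C N U V d (n • y) = n • homD C N U V d y := by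
  simp only [homD, LinearMap.comp_smul, LinearMap.smul_comp, smul_sub]
  rw [smul_comm]

lemma homD_zero {X₀ Xₙ : B.Ob} (N : ObPath X₀ Xₙ) (U V : C.Ob) (d : ℤ) :
    homD C N U V d (0 : B.Tens N →ₗ[k] C.Hom U V) = 0 := by
  simp [homD]

lemma homDeg_zsmul {X₀ Xₙ : B.Ob} {N : ObPath X₀ Xₙ} {U V : C.Ob} {d : ℤ} (n : ℤ)
    {y : B.Tens N →ₗ[k] C.Hom U V} (hy : y ∈ homDeg C N U V d) : n • y ∈ homDeg C N U V d :=
  fun e x hx => zsmul_mem (hy e x hx) n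

lemma zero_mem_homDeg {X₀ Xₙ : B.Ob} (N : ObPath X₀ Xₙ) (U V : C.Ob) (d : ℤ) :
    (0 : B.Tens N →ₗ[k] C.Hom U V) ∈ homDeg C N U V d :=
  fun _ _ _ => Submodule.zero_mem _

lemma transfB₁_mem_filtration (hs : s.IsHom σ) (hs' : s'.IsHom σ') {d d₁ : ℤ} (h₁ : d₁ = d + 1)
    {n : ℕ} {v : Comps B.toGradedQuiver C.toGradedQuiver S S'}
    (hv : v ∈ Comps.filtration _ _ S S' d n) :
    transfB₁ s s' d v ∈ Comps.filtration _ _ S S' d₁ n := by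
  refine ⟨hv.1.transfB₁ hs.hasDeg hs'.hasDeg h₁, fun X Y p hp t => ?_⟩
  have h := transfB₁_comp_ι hs hs' d hv.2 hp.le
  have h₀ : v X Y ∘ₗ B.ι p = 0 := LinearMap.ext fun t => hv.2 X Y p hp t
  rw [h₀, homD_zero] at h
  exact LinearMap.congr_fun h t

/-- Let `L` be a chain map up to sign between complexes of coderivations which preserves the
filtration by the number of arguments and induces quasi-isomorphisms on the graded pieces. Then
the cone of `L` is acyclic. -/
theorem exists_of_cone_cycle (hs : s.IsFunctor σ) (hs' : s'.IsFunctor σ') (ht : t.IsFunctor τ)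
    (ht' : t'.IsFunctor τ') (a : ∀ X Y, C.Hom (S X) (S' Y) →ₗ[k] C.Hom (T X) (T' Y))
    (hqis : ∀ X Y (p : ObPath X Y), IsHomQuasiIso C p (a X Y)) {d d₁ d₂ : ℤ} (h₁ : d₁ = d + 1)
    (h₂ : d₂ = d₁ + 1)
    (L₀ L₁ : Comps B.toGradedQuiver C.toGradedQuiver S S' →+
      Comps B.toGradedQuiver C.toGradedQuiver T T')
    (hdeg : ∀ v, v.HasDegree d₁ → (L₀ v).HasDegree d₁) {u₀ u₁ : ℤ} (hu₀ : u₀ * u₀ = 1)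
    (hu₁ : u₁ * u₁ = 1)
    (hlead₀ : ∀ v n, v.HasDegree d₁ → v.VanishesBelow n → ∀ X Y (p : ObPath X Y), p.length ≤ n →
      L₀ v X Y ∘ₗ B.ι p = u₀ • (a X Y ∘ₗ (v X Y ∘ₗ B.ι p)))
    (hlead₁ : ∀ v n, v.HasDegree d₂ → v.VanishesBelow n → ∀ X Y (p : ObPath X Y), p.length ≤ n →
      L₁ v X Y ∘ₗ B.ι p = u₁ • (a X Y ∘ₗ (v X Y ∘ₗ B.ι p)))
    (hcomm : ∀ v, v.HasDegree d₁ → L₁ (transfB₁ s s' d₁ v) + transfB₁ t t' d₁ (L₀ v) = 0)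
    {x : Comps B.toGradedQuiver C.toGradedQuiver S S'} (hx : x.HasDegree d₂)
    {y : Comps B.toGradedQuiver C.toGradedQuiver T T'} (hy : y.HasDegree d₁)
    (hxd : transfB₁ s s' d₂ x = 0) (hxy : L₁ x + transfB₁ t t' d₁ y = 0) :
    ∃ v w, v.HasDegree d₁ ∧ w.HasDegree d ∧ x = transfB₁ s s' d₁ v ∧
      y = L₀ v + transfB₁ t t' d w := by
  let CS := Comps B.toGradedQuiver C.toGradedQuiver S S'
  let CT := Comps B.toGradedQuiver C.toGradedQuiver T T'
  -- The differential of the cone; `Z` is the kernel of the next one. The sign in `hcomm` makes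
  -- their composite zero without further signs.
  let D : CS × CT →+ CS × CT :=
    ((transfB₁Hom s s' d₁).comp (AddMonoidHom.fst CS CT)).prod
      (L₀.comp (AddMonoidHom.fst CS CT) + (transfB₁Hom t t' d).comp (AddMonoidHom.snd CS CT))
  let F₀ : ℕ → AddSubgroup (CS × CT) := fun n =>
    (Comps.filtration _ _ S S' d₁ n).prod (Comps.filtration _ _ T T' d n)
  let F₁ : ℕ → AddSubgroup (CS × CT) := fun n =>
    (Comps.filtration _ _ S S' d₂ n).prod (Comps.filtration _ _ T T' d₁ n)
  let Z : AddSubgroup (CS × CT) := (((transfB₁Hom s s' d₂).comp (AddMonoidHom.fst CS CT)).prod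
      (L₁.comp (AddMonoidHom.fst CS CT) +
        (transfB₁Hom t t' d₁).comp (AddMonoidHom.snd CS CT))).ker
  have hDapp : ∀ v w, D (v, w) = (transfB₁ s s' d₁ v, L₀ v + transfB₁ t t' d w) := fun _ _ => rfl
  have hZ : ∀ v w, (v, w) ∈ Z ↔ transfB₁ s s' d₂ v = 0 ∧ L₁ v + transfB₁ t t' d₁ w = 0 :=
    fun _ _ => Prod.ext_iff
  have hL₀ : ∀ n, ∀ v ∈ Comps.filtration _ _ S S' d₁ n, L₀ v ∈ Comps.filtration _ _ T T' d₁ n := by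
    intro n v hv
    refine ⟨hdeg v hv.1, fun X Y p hp t => ?_⟩
    have h := hlead₀ v n hv.1 hv.2 X Y p hp.le
    have h₀ : v X Y ∘ₗ B.ι p = 0 := LinearMap.ext fun t => hv.2 X Y p hp t
    rw [h₀, LinearMap.comp_zero, smul_zero] at h
    exact LinearMap.congr_fun h t
  have hD : ∀ n, ∀ a ∈ F₀ n, D a ∈ F₁ n := by
    rintro n ⟨v, w⟩ ⟨hv, hw⟩
    exact ⟨transfB₁_mem_filtration hs.toIsHom hs'.toIsHom h₂ hv, AddSubgroup.add_mem _ (hL₀ n v hv)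
      (transfB₁_mem_filtration ht.toIsHom ht'.toIsHom h₁ hw)⟩
  have hDZ : ∀ n, ∀ a ∈ F₀ n, D a ∈ Z := by
    rintro n ⟨v, w⟩ ⟨hv, hw⟩
    rw [hDapp, hZ]
    constructor
    · rw [h₂]
      exact transfB₁_transfB₁ hs hs' hv.1
    · have := transfB₁_transfB₁ ht ht' hw.1
      rw [← h₁] at this
      rw [transfB₁_add, this, add_zero, hcomm v hv.1]
  have surj : ∀ X Y (p : ObPath X Y), ∀ y ∈ homDeg C p (T X) (T' Y) d₁,
      homD C p (T X) (T' Y) d₁ y = 0 →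
      ∃ x ∈ homDeg C p (S X) (S' Y) d₁, homD C p (S X) (S' Y) d₁ x = 0 ∧
        ∃ z ∈ homDeg C p (T X) (T' Y) d, a X Y ∘ₗ x - y = homD C p (T X) (T' Y) d z := by
    intro X Y p
    have := (hqis X Y p d₁).1
    rwa [h₁, add_sub_cancel_right, ← h₁] at this
  have inj : ∀ X Y (p : ObPath X Y), ∀ x ∈ homDeg C p (S X) (S' Y) d₂,
      homD C p (S X) (S' Y) d₂ x = 0 →
      (∃ z ∈ homDeg C p (T X) (T' Y) d₁, a X Y ∘ₗ x = homD C p (T X) (T' Y) d₁ z) →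
        ∃ y ∈ homDeg C p (S X) (S' Y) d₁, x = homD C p (S X) (S' Y) d₁ y := by
    intro X Y p
    have := (hqis X Y p d₂).2
    rwa [h₂, add_sub_cancel_right, ← h₂] at this
  -- The n-th components are removed in two rounds. Injectivity on cohomology shows that the leading
  -- term of x is a boundary. After subtracting it the leading term of y is a cycle, and
  -- surjectivity writes it as the image of a cycle plus a boundary; that cycle leaves the leading
  -- term of x untouched.
  have step : ∀ n, ∀ y ∈ F₁ n, y ∈ Z → ∃ a ∈ F₀ n, y - D a ∈ F₁ (n + 1) := by
    rintro n ⟨x, y⟩ ⟨hx, hy⟩ hxyZ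
    have hxyZ' := (hZ x y).1 hxyZ
    have hv : ∀ X Y (p : ObPath X Y), ∃ v ∈ homDeg C p (S X) (S' Y) d₁,
        p.length = n → x X Y ∘ₗ B.ι p = homD C p (S X) (S' Y) d₁ v := by
      intro X Y p
      by_cases hp : p.length = n
      -- The cone equation reads u₁ • (a ∘ x) = -dy on leading terms. Since u₁² = 1, the element
      -- -u₁y bounds a ∘ x.
      · obtain ⟨v, hv, hv'⟩ := inj X Y p (x X Y ∘ₗ B.ι p) (hx.1 X Y p) (by
          rw [← transfB₁_comp_ι hs.toIsHom hs'.toIsHom d₂ hx.2 hp.le, hxyZ'.1]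
          exact LinearMap.zero_comp _) ⟨(-u₁) • (y X Y ∘ₗ B.ι p), homDeg_zsmul _ (hy.1 X Y p), by
            have h := congrArg (fun r : CT => r X Y ∘ₗ B.ι p) hxyZ'.2
            change L₁ x X Y ∘ₗ B.ι p + transfB₁ t t' d₁ y X Y ∘ₗ B.ι p = 0 at h
            rw [hlead₁ x n hx.1 hx.2 X Y p hp.le,
              transfB₁_comp_ι ht.toIsHom ht'.toIsHom d₁ hy.2 hp.le, ← eq_neg_iff_add_eq_zero] at h
            rw [homD_zsmul, neg_smul, ← smul_neg, ← h, smul_smul, hu₁, one_smul]⟩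
        exact ⟨v, hv, fun _ => hv'⟩
      · exact ⟨0, zero_mem_homDeg _ _ _ _, fun h => absurd h hp⟩
    choose v hv hv' using hv
    have hV : (Comps.ofLength n v : CS) ∈ Comps.filtration _ _ S S' d₁ n := Comps.ofLength_mem hv
    have hV0 : ((Comps.ofLength n v : CS), (0 : CT)) ∈ F₀ n := ⟨hV, AddSubgroup.zero_mem _⟩
    set V : CS := Comps.ofLength n v with hVdef
    have hx₁ : x - transfB₁ s s' d₁ V ∈ Comps.filtration _ _ S S' d₂ (n + 1) := by
      apply Comps.mem_filtration_succ
      · exact AddSubgroup.sub_mem _ hx (transfB₁_mem_filtration hs.toIsHom hs'.toIsHom h₂ hV)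
      · intro X Y p hp
        have h := transfB₁_comp_ι hs.toIsHom hs'.toIsHom d₁ hV.2 hp.le
        rw [hVdef, Comps.ofLength_comp_ι n v hp, ← hv' X Y p hp, ← hVdef] at h
        change (x X Y - transfB₁ s s' d₁ V X Y) ∘ₗ B.ι p = 0
        rw [LinearMap.sub_comp, h, sub_self]
    have hy₁ : y - L₀ V ∈ Comps.filtration _ _ T T' d₁ n :=
      AddSubgroup.sub_mem _ hy (hL₀ n V hV)
    have hxy₁ : (x - transfB₁ s s' d₁ V, y - L₀ V) ∈ Z := by
      have := Z.sub_mem hxyZ (hDZ n _ hV0)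
      rw [hDapp] at this
      have h0 : transfB₁ t t' d 0 = 0 := (transfB₁Hom t t' d).map_zero
      rwa [h0, add_zero] at this
    generalize hx₁def : x - transfB₁ s s' d₁ V = x₁ at hx₁ hxy₁
    generalize hy₁def : y - L₀ V = y₁ at hy₁ hxy₁
    -- The remaining x₁ starts in length n + 1, so the cone equation in length n says that the
    -- leading term of y₁ is a cycle. Paths of other lengths get zero as a default, to allow a
    -- choice over all paths at once.
    have hz : ∀ X Y (p : ObPath X Y), ∃ v ∈ homDeg C p (S X) (S' Y) d₁,
        ∃ w ∈ homDeg C p (T X) (T' Y) d, p.length = n →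
          homD C p (S X) (S' Y) d₁ v = 0 ∧
          a X Y ∘ₗ v - y₁ X Y ∘ₗ B.ι p = homD C p (T X) (T' Y) d w := by
      intro X Y p
      by_cases hp : p.length = n
      · obtain ⟨v, hv, hv', w, hw, hw'⟩ := surj X Y p (y₁ X Y ∘ₗ B.ι p) (hy₁.1 X Y p) (by
          have h := congrArg (fun r : CT => r X Y ∘ₗ B.ι p) ((hZ _ _).1 hxy₁).2
          change L₁ x₁ X Y ∘ₗ B.ι p + transfB₁ t t' d₁ y₁ X Y ∘ₗ B.ι p = 0 at h
          have h0 : x₁ X Y ∘ₗ B.ι p = 0 :=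
            LinearMap.ext fun t => hx₁.2 X Y p (by omega) t
          rwa [hlead₁ x₁ (n + 1) hx₁.1 hx₁.2 X Y p (by omega), h0, LinearMap.comp_zero, smul_zero,
            zero_add, transfB₁_comp_ι ht.toIsHom ht'.toIsHom d₁ hy₁.2 hp.le] at h)
        exact ⟨v, hv, w, hw, fun _ => ⟨hv', hw'⟩⟩
      · exact ⟨0, zero_mem_homDeg _ _ _ _, 0, zero_mem_homDeg _ _ _ _, fun h => absurd h hp⟩
    choose v₂ hv₂ w hw hvw using hz
    -- The factor u₀ offsets the sign in the leading term of L₀. The boundary w enters with -1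
    -- because surjectivity supplies a ∘ v₂ - y₁ = dw.
    have hV₂ : (Comps.ofLength n (fun X Y p => u₀ • v₂ X Y p) : CS) ∈
        Comps.filtration _ _ S S' d₁ n :=
      Comps.ofLength_mem fun X Y p => homDeg_zsmul u₀ (hv₂ X Y p)
    have hW : (Comps.ofLength n (fun X Y p => (-1 : ℤ) • w X Y p) : CT) ∈
        Comps.filtration _ _ T T' d n :=
      Comps.ofLength_mem fun X Y p => homDeg_zsmul (-1) (hw X Y p)
    set V₂ : CS := Comps.ofLength n (fun X Y p => u₀ • v₂ X Y p) with hV₂def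
    set W : CT := Comps.ofLength n (fun X Y p => (-1 : ℤ) • w X Y p) with hWdef
    refine ⟨(V + V₂, W), ⟨AddSubgroup.add_mem _ hV hV₂, hW⟩, ?_⟩
    have e : (x, y) - D (V + V₂, W) =
        (x₁ - transfB₁ s s' d₁ V₂, y₁ - (L₀ V₂ + transfB₁ t t' d W)) := by
      rw [hDapp, transfB₁_add, map_add, ← hx₁def, ← hy₁def, Prod.mk_sub_mk]
      congr 1 <;> abel
    rw [e]
    refine ⟨?_, ?_⟩
    · refine AddSubgroup.sub_mem _ hx₁ (Comps.mem_filtration_succ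
        (transfB₁_mem_filtration hs.toIsHom hs'.toIsHom h₂ hV₂) ?_)
      intro X Y p hp
      rw [transfB₁_comp_ι hs.toIsHom hs'.toIsHom d₁ hV₂.2 hp.le, hV₂def,
        Comps.ofLength_comp_ι n _ hp, homD_zsmul, (hvw X Y p hp).1, smul_zero]
    · refine Comps.mem_filtration_succ (AddSubgroup.sub_mem _ hy₁ (AddSubgroup.add_mem _
        (hL₀ n _ hV₂) (transfB₁_mem_filtration ht.toIsHom ht'.toIsHom h₁ hW))) ?_
      intro X Y p hp
      change (y₁ X Y - (L₀ V₂ X Y + transfB₁ t t' d W X Y)) ∘ₗ B.ι p = 0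
      rw [LinearMap.sub_comp, LinearMap.add_comp, hlead₀ V₂ n hV₂.1 hV₂.2 X Y p hp.le,
        transfB₁_comp_ι ht.toIsHom ht'.toIsHom d hW.2 hp.le, hV₂def, hWdef,
        Comps.ofLength_comp_ι n _ hp, Comps.ofLength_comp_ι n _ hp, homD_zsmul, LinearMap.comp_smul,
        smul_smul, hu₀, one_smul, ← (hvw X Y p hp).2]
      simp
  have complete : ∀ a : ℕ → CS × CT, (∀ n, a n ∈ F₀ n) →
      ∃ s ∈ F₀ 0, ∀ n, s - ∑ m ∈ Finset.range n, a m ∈ F₀ n := by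
    intro a ha
    obtain ⟨s₁, hs₁, hs₁'⟩ := Comps.filtration_complete (fun n => (ha n).1)
    obtain ⟨s₂, hs₂, hs₂'⟩ := Comps.filtration_complete (fun n => (ha n).2)
    refine ⟨(s₁, s₂), ⟨hs₁, hs₂⟩, fun n => ⟨?_, ?_⟩⟩
    · rw [Prod.fst_sub, Prod.fst_sum]
      exact hs₁' n
    · rw [Prod.snd_sub, Prod.snd_sum]
      exact hs₂' n
  have sep : ∀ y : CS × CT, (∀ n, y ∈ F₁ n) → y = 0 := fun y hy =>
    Prod.ext (Comps.eq_zero_of_mem_filtration fun n => (hy n).1)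
      (Comps.eq_zero_of_mem_filtration fun n => (hy n).2)
  obtain ⟨⟨v, w⟩, ⟨hv, hw⟩, h⟩ := exists_eq_of_filtration D F₀ F₁ Z hD hDZ step complete sep (x, y)
    ⟨⟨hx, fun X Y p hp => by omega⟩, ⟨hy, fun X Y p hp => by omega⟩⟩ ((hZ x y).2 ⟨hxd, hxy⟩)
  rw [hDapp, Prod.mk.injEq] at h
  exact ⟨v, w, hv.1, hw.1, h.1, h.2⟩

end Cone

/-! ### Restriction of transformations along a functor -/

section Pullback

variable {k : Type u} [CommRing k]

/-- The restriction of a family along a cocategory homomorphism. -/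
def BarMap.pull {A : GradedQuiver.{u, v} k} {C : GradedQuiver.{u, w} k} {G : A.Ob → C.Ob}
    (g : BarMap A C G G) (Q : BarMap C C (fun X => X) (fun X => X)) : BarMap A C G G :=
  fun X Y => Q (G X) (G Y) ∘ₗ g X Y

/-- The restriction of components along a cocategory homomorphism. -/
def Comps.pull {A : GradedQuiver.{u, v} k} {C : GradedQuiver.{u, w} k} {G : A.Ob → C.Ob}
    (g : BarMap A C G G) (r : Comps C C (fun X => X) (fun X => X)) : Comps A C G G :=
  fun X Y => r (G X) (G Y) ∘ₗ g X Y

/-- A cocategory homomorphism preserves cuts and has degree 0, so restriction along it is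
multiplicative for convolution without signs. -/
lemma BarMap.IsHom.pull_conv {A : GradedQuiver.{u, v} k} {C : GradedQuiver.{u, w} k}
    {G : A.Ob → C.Ob} {g : BarMap A C G G} {ψ : Comps A C G G} (hg : g.IsHom ψ) (d : ℤ)
    (Q Q' : BarMap C C (fun X => X) (fun X => X)) :
    BarMap.pull g (Q.conv d Q') = BarMap.conv d (BarMap.pull g Q) (BarMap.pull g Q') := by
  apply BarMap.ext_apply
  intro X Y t
  rw [pull, LinearMap.comp_apply, conv_apply, conv_apply, GradedQuiver.sweep, LinearMap.comp_apply]
  have hcut : C.cut (G X) (G Y) (g X Y t) = g.conv₂ 0 g X Y t :=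
    LinearMap.congr_fun (congr_fun₂ hg.cut X Y) t
  rw [hcut, GradedQuiver.ofPairs_conv₂]
  apply GradedQuiver.sweep_congr_apply
  intro Z s t
  have := LinearMap.congr_fun (hg.hasDeg.barSgn d Z Y) t
  simp only [mul_zero, Int.negOnePow_zero, Units.val_one, one_smul, LinearMap.comp_apply] at this
  simp only [LinearMap.compl₁₂_apply, LinearMap.comp_apply, A.barSgn_zero, pull, this]

lemma Comps.HasDegree.pull {A : GradedQuiver.{u, v} k} {C : GradedQuiver.{u, w} k}
    {G : A.Ob → C.Ob} {g : BarMap A C G G} (hg : g.HasDeg 0)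
    {r : Comps C C (fun X => X) (fun X => X)} {d : ℤ} (hr : r.HasDegree d) :
    (Comps.pull g r).HasDegree d := by
  intro X Y p e x hx
  have := hg X Y e _ (A.ι_mem_bgr hx)
  rw [add_zero] at this
  exact hr.apply this

variable {B : AInfCat.{u, v} k} {C : AInfCat.{u, w} k} {G : B.Ob → C.Ob}
  {g : BarMap B.toGradedQuiver C.toGradedQuiver G G}
  {ψ : Comps B.toGradedQuiver C.toGradedQuiver G G}

/-- Restriction carries the (id, id)-coderivation to a (g, g)-coderivation by `pull_conv`, and gb =
bg moves the codifferential of C to that of B. -/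
lemma BarMap.IsFunctor.pull_transfB₁ (hg : g.IsFunctor ψ) (d : ℤ)
    (r : Comps C.toGradedQuiver C.toGradedQuiver (fun X => X) (fun X => X)) :
    Comps.pull g (transfB₁ (B := C) (BarMap.ident _) (BarMap.ident _) d r) =
      transfB₁ g g d (Comps.pull g r) := by
  have h₁ : BarMap.pull g (r.coder (BarMap.ident _) d (BarMap.ident _)) =
      (Comps.pull g r).coder g d g := by
    rw [Comps.coder, hg.toIsHom.pull_conv, hg.toIsHom.pull_conv]
    rfl
  rw [transfB₁_eq, transfB₁_eq, ← h₁]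
  have h₃ : Comps.pull g r.preCodiff = (Comps.pull g r).preCodiff := by
    funext X Y
    have h₂ : C.codiff (G X) (G Y) ∘ₗ g X Y = g X Y ∘ₗ B.codiff X Y :=
      (congr_fun₂ hg.preCodiff_eq X Y).symm
    change (r (G X) (G Y) ∘ₗ C.codiff (G X) (G Y)) ∘ₗ g X Y = (r (G X) (G Y) ∘ₗ g X Y) ∘ₗ _
    rw [LinearMap.comp_assoc, LinearMap.comp_assoc, h₂]
  rw [← h₃]
  rfl

lemma BarMap.IsHom.pull_transfB₂ (hg : g.IsHom ψ)
    (r p : Comps C.toGradedQuiver C.toGradedQuiver (fun X => X) (fun X => X)) :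
    Comps.pull g (transfB₂ (B := C) (BarMap.ident _) (BarMap.ident _) (BarMap.ident _) r p) =
      transfB₂ g g g (Comps.pull g r) (Comps.pull g p) := by
  have h₁ : BarMap.pull g (thetaMap (BarMap.ident _) (-1) r (BarMap.ident _) (-1) p
      (BarMap.ident _)) = thetaMap g (-1) (Comps.pull g r) g (-1) (Comps.pull g p) g := by
    rw [thetaMap, hg.pull_conv, hg.pull_conv, hg.pull_conv, hg.pull_conv]
    rfl
  have h₂ : transfB₂ g g g (Comps.pull g r) (Comps.pull g p) =
    (thetaMap g (-1) (Comps.pull g r) g (-1) (Comps.pull g p) g).postB := rfl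
  rw [h₂, ← h₁]
  rfl

end Pullback

/-! ### Homotopy equivalences induce quasi-isomorphisms on Hom complexes -/

section HomComplex

variable {k : Type u} [CommRing k] {B : AInfCat.{u, v} k} {C : AInfCat.{u, w} k}

lemma homD_sub {X Y : B.Ob} (N : ObPath X Y) {U V : C.Ob} (d : ℤ) (y z : B.Tens N →ₗ[k] C.Hom U V) :
    homD C N U V d (y - z) = homD C N U V d y - homD C N U V d z := by
  simp only [homD, LinearMap.comp_sub, LinearMap.sub_comp, smul_sub]
  abel

lemma homD_comp {X Y : B.Ob} (N : ObPath X Y) {U V : C.Ob} (d : ℤ) (y : B.Tens N →ₗ[k] C.Hom U V)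
    {c : C.Hom U V →ₗ[k] C.Hom U V} (hc : C.b₁ U V ∘ₗ c = c ∘ₗ C.b₁ U V) :
    homD C N U V d (c ∘ₗ y) = c ∘ₗ homD C N U V d y := by
  rw [homD, homD, ← LinearMap.comp_assoc, hc, LinearMap.comp_sub, LinearMap.comp_smul,
    LinearMap.comp_assoc, LinearMap.comp_assoc]

/-- For a cycle y the relation yb₁ = (-1)^d by turns the source term of the differential of h ∘ y
into h ∘ b₁ ∘ y; the sign (-1)^{d-1} makes it positive. -/
lemma homD_comp_homotopy {X Y : B.Ob} (N : ObPath X Y) {U V : C.Ob} (d : ℤ)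
    {y : B.Tens N →ₗ[k] C.Hom U V} (hy : homD C N U V d y = 0) (h : C.Hom U V →ₗ[k] C.Hom U V) :
    homD C N U V (d - 1) (h ∘ₗ y) = (h ∘ₗ C.b₁ U V + C.b₁ U V ∘ₗ h) ∘ₗ y := by
  rw [homD, sub_eq_zero] at hy
  have : ((d - 1).negOnePow : ℤ) = -(d.negOnePow : ℤ) := by
    rw [← neg_inj, neg_neg, ← Int.val_negOnePow_add_one, sub_add_cancel]
  rw [homD, this, neg_smul, sub_neg_eq_add, LinearMap.add_comp, LinearMap.comp_assoc,
    LinearMap.comp_assoc, LinearMap.comp_assoc, hy, LinearMap.comp_smul, add_comm]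

lemma comp_mem_homDeg {X Y : B.Ob} {N : ObPath X Y} {U V : C.Ob} {d n : ℤ}
    {y : B.Tens N →ₗ[k] C.Hom U V} (hy : y ∈ homDeg C N U V d) {c : C.Hom U V →ₗ[k] C.Hom U V}
    {m : ℤ} (hc : ∀ d, ∀ x ∈ C.sgr U V d, c x ∈ C.sgr U V (d + m)) (h : n = d + m) :
    c ∘ₗ y ∈ homDeg C N U V n := by
  intro e x hx
  rw [h, ← add_assoc]
  exact hc _ _ (hy e x hx)

lemma IsHtpyInvertible.isHomQuasiIso {U V : C.Ob} {a : C.Hom U V →ₗ[k] C.Hom U V}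
    (ha : IsHtpyInvertible C a) {X Y : B.Ob} (N : ObPath X Y) : IsHomQuasiIso C N a := by
  obtain ⟨-, -, c, h, h', hc, hcb, hh, hh', hca, hac⟩ := ha
  have hc' : ∀ d, ∀ x ∈ C.sgr U V d, c x ∈ C.sgr U V (d + 0) := fun d x hx => by
    rw [add_zero]; exact hc d x hx
  intro d
  constructor
  · intro y hy hyd
    refine ⟨c ∘ₗ y, comp_mem_homDeg hy hc' (add_zero d).symm, ?_, h' ∘ₗ y,
      comp_mem_homDeg hy hh' rfl, ?_⟩
    · rw [homD_comp N d y hcb, hyd, LinearMap.comp_zero]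
    · rw [homD_comp_homotopy N d hyd, ← hac, LinearMap.sub_comp, LinearMap.comp_assoc,
        LinearMap.id_comp]
  · rintro x hx hxd ⟨z, hz, hxz⟩
    -- If a ∘ x = dz, then c ∘ a ∘ x = d(c ∘ z), while c ∘ a ∘ x - x = d(h ∘ x) as x is a cycle.
    refine ⟨c ∘ₗ z - h ∘ₗ x, ?_, ?_⟩
    · intro e t ht
      exact Submodule.sub_mem _ (comp_mem_homDeg hz hc' (add_zero _).symm e t ht)
        (comp_mem_homDeg hx hh rfl e t ht)
    · rw [homD_sub, homD_comp N _ z hcb, ← hxz, homD_comp_homotopy N d hxd, ← hca,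
        LinearMap.sub_comp, LinearMap.comp_assoc, LinearMap.id_comp, sub_sub_cancel]

end HomComplex

/-! ### Composition modulo equivalence and cancellation -/

section TwoCategory

variable {k : Type u} [CommRing k] {B : AInfCat.{u, v} k} {C : AInfCat.{u, w} k}
  {F G H : B.Ob → C.Ob}
  {f : BarMap B.toGradedQuiver C.toGradedQuiver F F}
  {φ : Comps B.toGradedQuiver C.toGradedQuiver F F}
  {g : BarMap B.toGradedQuiver C.toGradedQuiver G G}
  {ψ : Comps B.toGradedQuiver C.toGradedQuiver G G}
  {h : BarMap B.toGradedQuiver C.toGradedQuiver H H}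
  {χ : Comps B.toGradedQuiver C.toGradedQuiver H H}

lemma IsNatTransf.sub {r r' : Comps B.toGradedQuiver C.toGradedQuiver F G}
    (hr : IsNatTransf f g r) (hr' : IsNatTransf f g r') : IsNatTransf f g (r - r') :=
  ⟨hr.1.sub hr'.1, by
    have := (transfB₁Hom f g (-1)).map_sub r r'
    change transfB₁ f g (-1) (r - r') = transfB₁ f g (-1) r - transfB₁ f g (-1) r' at this
    rw [this, hr.2, hr'.2, sub_zero]⟩

lemma TransfEquiv.symm {r r' : Comps B.toGradedQuiver C.toGradedQuiver F G}
    (e : TransfEquiv f g r r') : TransfEquiv f g r' r := by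
  obtain ⟨v, hv, e⟩ := e
  exact ⟨-v, hv.neg, by rw [← neg_sub, e]; exact ((transfB₁Hom f g (-2)).map_neg v).symm⟩

lemma TransfEquiv.trans {r r' r'' : Comps B.toGradedQuiver C.toGradedQuiver F G}
    (e : TransfEquiv f g r r') (e' : TransfEquiv f g r' r'') : TransfEquiv f g r r'' := by
  obtain ⟨v, hv, e⟩ := e
  obtain ⟨v', hv', e'⟩ := e'
  exact ⟨v + v', hv.add hv', by rw [transfB₁_add, ← e, ← e', sub_add_sub_cancel]⟩

/-- The map `p ↦ (r ⊗ p)B₂` on coderivations of degree `e`, where `r` has degree `-1`. -/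
def mulLeft (f : BarMap B.toGradedQuiver C.toGradedQuiver F F)
    (g : BarMap B.toGradedQuiver C.toGradedQuiver G G)
    (h : BarMap B.toGradedQuiver C.toGradedQuiver H H)
    (r : Comps B.toGradedQuiver C.toGradedQuiver F G) (e : ℤ) :
    Comps B.toGradedQuiver C.toGradedQuiver G H →+
      Comps B.toGradedQuiver C.toGradedQuiver F H :=
  AddMonoidHom.mk' (fun p => (thetaMap f (-1) r g e p h).postB) fun p p' => by
    simp only [thetaMap]
    rw [Comps.toBar_add, BarMap.add_conv, BarMap.conv_add, BarMap.conv_add, BarMap.conv_add,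
      BarMap.postB_add]

/-- The map `r ↦ (r ⊗ p)B₂` on coderivations of degree `e`, where `p` has degree `-1`. -/
def mulRight (f : BarMap B.toGradedQuiver C.toGradedQuiver F F)
    (g : BarMap B.toGradedQuiver C.toGradedQuiver G G)
    (h : BarMap B.toGradedQuiver C.toGradedQuiver H H)
    (p : Comps B.toGradedQuiver C.toGradedQuiver G H) (e : ℤ) :
    Comps B.toGradedQuiver C.toGradedQuiver F G →+
      Comps B.toGradedQuiver C.toGradedQuiver F H :=
  AddMonoidHom.mk' (fun r => (thetaMap f e r g (-1) p h).postB) fun r r' => by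
    simp only [thetaMap]
    rw [Comps.toBar_add, BarMap.add_conv, BarMap.conv_add, BarMap.postB_add]

lemma mulLeft_apply (r : Comps B.toGradedQuiver C.toGradedQuiver F G) (e : ℤ)
    (p : Comps B.toGradedQuiver C.toGradedQuiver G H) :
    mulLeft f g h r e p = (thetaMap f (-1) r g e p h).postB := rfl

lemma mulRight_apply (p : Comps B.toGradedQuiver C.toGradedQuiver G H) (e : ℤ)
    (r : Comps B.toGradedQuiver C.toGradedQuiver F G) :
    mulRight f g h p e r = (thetaMap f e r g (-1) p h).postB := rfl

lemma mulLeft_neg_one (r : Comps B.toGradedQuiver C.toGradedQuiver F G)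
    (p : Comps B.toGradedQuiver C.toGradedQuiver G H) :
    mulLeft f g h r (-1) p = transfB₂ f g h r p := rfl

lemma mulRight_neg_one (p : Comps B.toGradedQuiver C.toGradedQuiver G H)
    (r : Comps B.toGradedQuiver C.toGradedQuiver F G) :
    mulRight f g h p (-1) r = transfB₂ f g h r p := rfl

/-- The Leibniz rule with rB₁ = 0. The anticommutation is exactly the form that the cone requires.
-/
lemma mulLeft_transfB₁ (hf : f.IsFunctor φ) (hg : g.IsFunctor ψ) (hh : h.IsFunctor χ)
    {r : Comps B.toGradedQuiver C.toGradedQuiver F G} (hr : IsNatTransf f g r) {d e : ℤ}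
    (he : e = d + 1) {v : Comps B.toGradedQuiver C.toGradedQuiver G H} (hv : v.HasDegree d) :
    mulLeft f g h r e (transfB₁ g h d v) + transfB₁ f h d (mulLeft f g h r d v) = 0 := by
  subst he
  have := transfB₁_postB_theta hf hg hh hr.1 hv
  rw [hr.2, thetaMap_zero_left, neg_add_cancel_comm] at this
  rw [mulLeft_apply, mulLeft_apply, this]
  have h0 : (0 : BarMap B.toGradedQuiver C.toGradedQuiver F H).postB = 0 := by
    funext X Y; exact LinearMap.comp_zero _
  rw [h0, smul_zero, add_zero, add_neg_cancel]

/-- The Leibniz rule with pB₁ = 0. Here the sign (-1)^{-1} attached to the degree of p cancels the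
overall minus, so right multiplication commutes with B₁. -/
lemma mulRight_transfB₁ (hf : f.IsFunctor φ) (hg : g.IsFunctor ψ) (hh : h.IsFunctor χ)
    {p : Comps B.toGradedQuiver C.toGradedQuiver G H} (hp : IsNatTransf g h p) {d e : ℤ}
    (he : e = d + 1) {v : Comps B.toGradedQuiver C.toGradedQuiver F G} (hv : v.HasDegree d) :
    mulRight f g h p e (transfB₁ f g d v) = transfB₁ f h d (mulRight f g h p d v) := by
  subst he
  have := transfB₁_postB_theta hf hg hh hv hp.1
  rw [hp.2, thetaMap_zero_right, neg_add_cancel_right] at this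
  rw [mulRight_apply, mulRight_apply, this]
  have h0 : (0 : BarMap B.toGradedQuiver C.toGradedQuiver F H).postB = 0 := by
    funext X Y; exact LinearMap.comp_zero _
  rw [h0]
  simp

lemma mulLeft_hasDegree (hf : f.IsFunctor φ) (hg : g.IsFunctor ψ) (hh : h.IsFunctor χ)
    {r : Comps B.toGradedQuiver C.toGradedQuiver F G} (hr : IsNatTransf f g r) {d : ℤ}
    {v : Comps B.toGradedQuiver C.toGradedQuiver G H} (hv : v.HasDegree d) :
    (mulLeft f g h r d v).HasDegree d :=
  (BarMap.HasDeg.theta hf.hasDeg hg.hasDeg hh.hasDeg hr.1 hv rfl).postB (by ring)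

lemma mulRight_hasDegree (hf : f.IsFunctor φ) (hg : g.IsFunctor ψ) (hh : h.IsFunctor χ)
    {p : Comps B.toGradedQuiver C.toGradedQuiver G H} (hp : IsNatTransf g h p) {d : ℤ}
    {v : Comps B.toGradedQuiver C.toGradedQuiver F G} (hv : v.HasDegree d) :
    (mulRight f g h p d v).HasDegree d :=
  (BarMap.HasDeg.theta hf.hasDeg hg.hasDeg hh.hasDeg hv hp.1 rfl).postB (by ring)

lemma IsNatTransf.comp (hf : f.IsFunctor φ) (hg : g.IsFunctor ψ) (hh : h.IsFunctor χ)
    {r : Comps B.toGradedQuiver C.toGradedQuiver F G} (hr : IsNatTransf f g r)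
    {p : Comps B.toGradedQuiver C.toGradedQuiver G H} (hp : IsNatTransf g h p) :
    IsNatTransf f h (transfB₂ f g h r p) := by
  refine ⟨mulLeft_hasDegree hf hg hh hr hp.1, ?_⟩
  have := mulLeft_transfB₁ hf hg hh hr (d := -1) (e := 0) rfl hp.1
  rwa [hp.2, map_zero, zero_add] at this

lemma TransfEquiv.mul_left (hf : f.IsFunctor φ) (hg : g.IsFunctor ψ) (hh : h.IsFunctor χ)
    {r : Comps B.toGradedQuiver C.toGradedQuiver F G} (hr : IsNatTransf f g r)
    {p p' : Comps B.toGradedQuiver C.toGradedQuiver G H} (e : TransfEquiv g h p p') :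
    TransfEquiv f h (transfB₂ f g h r p) (transfB₂ f g h r p') := by
  obtain ⟨v, hv, e⟩ := e
  apply TransfEquiv.symm
  refine ⟨mulLeft f g h r (-2) v, mulLeft_hasDegree hf hg hh hr hv, ?_⟩
  have := mulLeft_transfB₁ hf hg hh hr (d := -2) (e := -1) rfl hv
  rw [← e, map_sub, mulLeft_neg_one, mulLeft_neg_one] at this
  rw [← neg_sub, eq_comm, eq_neg_iff_add_eq_zero, add_comm, this]

lemma TransfEquiv.mul_right (hf : f.IsFunctor φ) (hg : g.IsFunctor ψ) (hh : h.IsFunctor χ)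
    {p : Comps B.toGradedQuiver C.toGradedQuiver G H} (hp : IsNatTransf g h p)
    {r r' : Comps B.toGradedQuiver C.toGradedQuiver F G} (e : TransfEquiv f g r r') :
    TransfEquiv f h (transfB₂ f g h r p) (transfB₂ f g h r' p) := by
  obtain ⟨v, hv, e⟩ := e
  refine ⟨mulRight f g h p (-2) v, mulRight_hasDegree hf hg hh hp hv, ?_⟩
  have := mulRight_transfB₁ hf hg hh hp (d := -2) (e := -1) rfl hv
  rwa [← e, map_sub, mulRight_neg_one, mulRight_neg_one] at this

lemma TransfEquiv.assoc {I : B.Ob → C.Ob} {l : BarMap B.toGradedQuiver C.toGradedQuiver I I}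
    {ω : Comps B.toGradedQuiver C.toGradedQuiver I I} (hf : f.IsFunctor φ) (hg : g.IsFunctor ψ)
    (hh : h.IsFunctor χ) (hl : l.IsFunctor ω)
    {r : Comps B.toGradedQuiver C.toGradedQuiver F G} (hr : IsNatTransf f g r)
    {p : Comps B.toGradedQuiver C.toGradedQuiver G H} (hp : IsNatTransf g h p)
    {q : Comps B.toGradedQuiver C.toGradedQuiver H I} (hq : IsNatTransf h l q) :
    TransfEquiv f l (transfB₂ f h l (transfB₂ f g h r p) q)
      (transfB₂ f g l r (transfB₂ g h l p q)) := by
  refine ⟨_, ?_, transfB₂_assoc hf hg hh hl hr hp hq⟩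
  have hpq : (thetaMap g (-1) p h (-1) q l).HasDeg (-2) :=
    BarMap.HasDeg.theta hg.hasDeg hh.hasDeg hl.hasDeg hp.1 hq.1 rfl
  have hrpq : (thetaMap₃ f (-1) r g (-1) p h (-1) q l).HasDeg (-3) :=
    hf.hasDeg.conv (hr.1.toBar.conv hpq (-1) rfl) 0 rfl
  exact hrpq.postB rfl

/-- The cone of `p ↦ (r ⊗ p)B₂` is acyclic. -/
lemma exists_of_mulLeft (hf : f.IsFunctor φ) (hg : g.IsFunctor ψ) (hh : h.IsFunctor χ)
    {r : Comps B.toGradedQuiver C.toGradedQuiver F G} (hr : IsNatTransf f g r)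
    (hqis : ∀ X Y (p : ObPath X Y), IsHomQuasiIso C p
      (C.b₂ (F X) (G X) (H Y) (r X X (B.one X)) ∘ₗ C.sgn (-1) (G X) (H Y)))
    {d d₁ d₂ : ℤ} (h₁ : d₁ = d + 1) (h₂ : d₂ = d₁ + 1)
    {x : Comps B.toGradedQuiver C.toGradedQuiver G H} (hx : x.HasDegree d₂)
    {y : Comps B.toGradedQuiver C.toGradedQuiver F H} (hy : y.HasDegree d₁)
    (hxd : transfB₁ g h d₂ x = 0) (hxy : mulLeft f g h r d₂ x + transfB₁ f h d₁ y = 0) :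
    ∃ v w, v.HasDegree d₁ ∧ w.HasDegree d ∧ x = transfB₁ g h d₁ v ∧
      y = mulLeft f g h r d₁ v + transfB₁ f h d w := by
  have hu : ∀ d : ℤ, (d.negOnePow : ℤ) * (d.negOnePow : ℤ) = 1 := fun d => by
    rcases Int.val_negOnePow_eq d with h | h <;> simp [h]
  exact exists_of_cone_cycle hg hh hf hh _ hqis h₁ h₂ (mulLeft f g h r d₁) (mulLeft f g h r d₂)
    (fun v hv => mulLeft_hasDegree hf hg hh hr hv) (hu d₁) (hu d₂)
    (fun v n hv hn X Y p hp =>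
      postB_theta_left_comp_ι hf.toIsHom hg.toIsHom hh.toIsHom r hv hn hp)
    (fun v n hv hn X Y p hp =>
      postB_theta_left_comp_ι hf.toIsHom hg.toIsHom hh.toIsHom r hv hn hp)
    (fun v hv => mulLeft_transfB₁ hf hg hh hr h₂ hv) hx hy hxd hxy

/-- The pair (0, r') is a cycle of the cone since r'B₁ = 0. A pair (p, w) bounding it consists of a
natural p and a w with r' = r·p + wB₁. -/
lemma exists_transfB₂_equiv (hf : f.IsFunctor φ) (hg : g.IsFunctor ψ) (hh : h.IsFunctor χ)
    {r : Comps B.toGradedQuiver C.toGradedQuiver F G} (hr : IsNatTransf f g r)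
    (hqis : ∀ X Y (p : ObPath X Y), IsHomQuasiIso C p
      (C.b₂ (F X) (G X) (H Y) (r X X (B.one X)) ∘ₗ C.sgn (-1) (G X) (H Y)))
    {r' : Comps B.toGradedQuiver C.toGradedQuiver F H} (hr' : IsNatTransf f h r') :
    ∃ p, IsNatTransf g h p ∧ TransfEquiv f h (transfB₂ f g h r p) r' := by
  obtain ⟨p, w, hp, hw, hp', e⟩ := exists_of_mulLeft hf hg hh hr hqis (d := -2) (d₁ := -1)
    (d₂ := 0) rfl rfl (Comps.HasDegree.zero 0) hr'.1 (transfB₁Hom g h 0).map_zero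
    (by rw [map_zero, hr'.2, zero_add])
  refine ⟨p, ⟨hp, hp'.symm⟩, TransfEquiv.symm ⟨w, hw, ?_⟩⟩
  rw [e, mulLeft_neg_one, add_sub_cancel_left]

/-- If r·q - r·p = yB₁, then (p - q, y) is a cycle of the cone; the first entry of a pair bounding
it realises p ≡ q. -/
lemma TransfEquiv.of_mul_left (hf : f.IsFunctor φ) (hg : g.IsFunctor ψ) (hh : h.IsFunctor χ)
    {r : Comps B.toGradedQuiver C.toGradedQuiver F G} (hr : IsNatTransf f g r)
    (hqis : ∀ X Y (p : ObPath X Y), IsHomQuasiIso C p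
      (C.b₂ (F X) (G X) (H Y) (r X X (B.one X)) ∘ₗ C.sgn (-1) (G X) (H Y)))
    {p q : Comps B.toGradedQuiver C.toGradedQuiver G H} (hp : IsNatTransf g h p)
    (hq : IsNatTransf g h q)
    (e : TransfEquiv f h (transfB₂ f g h r p) (transfB₂ f g h r q)) : TransfEquiv g h p q := by
  obtain ⟨y, hy, e⟩ := e.symm
  obtain ⟨v, w, hv, -, hpq, -⟩ := exists_of_mulLeft hf hg hh hr hqis (d := -3) (d₁ := -2)
    (d₂ := -1) rfl rfl (hp.sub hq).1 hy (hp.sub hq).2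
    (by rw [← e, map_sub, mulLeft_neg_one, mulLeft_neg_one]; abel)
  exact ⟨v, hv, hpq⟩

/-- The cone argument for multiplication by q from the right. Since this commutes with B₁, its
negative is used in degree -2 to obtain the anticommutation, hence u₀ = -1 and u₁ = 1. -/
lemma TransfEquiv.of_mul_right (hf : f.IsFunctor φ) (hg : g.IsFunctor ψ) (hh : h.IsFunctor χ)
    {q : Comps B.toGradedQuiver C.toGradedQuiver G H} (hq : IsNatTransf g h q)
    (hqis : ∀ X Y (p : ObPath X Y), IsHomQuasiIso C p
      ((C.b₂ (F X) (G Y) (H Y)).flip (q Y Y (B.one Y))))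
    {r r' : Comps B.toGradedQuiver C.toGradedQuiver F G} (hr : IsNatTransf f g r)
    (hr' : IsNatTransf f g r')
    (e : TransfEquiv f h (transfB₂ f g h r q) (transfB₂ f g h r' q)) : TransfEquiv f g r r' := by
  obtain ⟨y, hy, e⟩ := e.symm
  obtain ⟨v, w, hv, -, hpq, -⟩ := exists_of_cone_cycle hf hg hf hh _ hqis (d := -3) (d₁ := -2)
    (d₂ := -1) rfl rfl (-mulRight f g h q (-2)) (mulRight f g h q (-1))
    (fun v hv => (mulRight_hasDegree hf hg hh hq hv).neg) (u₀ := -1) (u₁ := 1) rfl rfl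
    (fun v n hv hn X Y p hp => by
      rw [← postB_theta_right_comp_ι hf.toIsHom hg.toIsHom hh.toIsHom (-2) (-1) q hn hp,
        neg_one_smul]
      rfl)
    (fun v n hv hn X Y p hp => by
      rw [one_smul]
      exact postB_theta_right_comp_ι hf.toIsHom hg.toIsHom hh.toIsHom (-1) (-1) q hn hp)
    (fun v hv => by
      have h₁ := mulRight_transfB₁ hf hg hh hq (d := -2) (e := -1) rfl hv
      have h₂ := (transfB₁Hom f h (-2)).map_neg (mulRight f g h q (-2) v)
      rw [h₁]
      change _ + transfB₁Hom f h (-2) (-(mulRight f g h q (-2) v)) = 0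
      rw [h₂]
      exact add_neg_cancel _)
    (hr.sub hr').1 hy (hr.sub hr').2
    (by rw [← e, map_sub, mulRight_neg_one, mulRight_neg_one]; abel)
  exact ⟨v, hv, hpq⟩

end TwoCategory

/-! ### The unit transformation restricted along a functor -/

section Units

variable {k : Type u} [CommRing k] {B : AInfCat.{u, v} k} {C : AInfCat.{u, w} k}
  {F G : B.Ob → C.Ob}

lemma isNatTransf_whisker (g : AInfFunctor B C G)
    {i : Comps C.toGradedQuiver C.toGradedQuiver (fun X => X) (fun X => X)}
    (hi : IsUnitTransf C i) : IsNatTransf g.hom g.hom (whisker g i) := by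
  refine ⟨hi.1.1.pull g.isFunctor.hasDeg, ?_⟩
  have := g.isFunctor.pull_transfB₁ (-1) i
  rw [hi.1.2] at this
  refine this.symm.trans ?_
  funext X Y
  exact LinearMap.zero_comp _

/-- The transformation `gi` is a right unit. -/
lemma transfB₂_whisker_equiv {f : BarMap B.toGradedQuiver C.toGradedQuiver F F}
    {φ : Comps B.toGradedQuiver C.toGradedQuiver F F} (hf : f.IsFunctor φ) (g : AInfFunctor B C G)
    {i : Comps C.toGradedQuiver C.toGradedQuiver (fun X => X) (fun X => X)}
    (hi : IsUnitTransf C i) {r : Comps B.toGradedQuiver C.toGradedQuiver F G}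
    (hr : IsNatTransf f g.hom r) :
    TransfEquiv f g.hom (transfB₂ f g.hom g.hom r (whisker g i)) r := by
  have hg := g.isFunctor
  have hgi := isNatTransf_whisker g hi
  have idem : TransfEquiv g.hom g.hom
      (transfB₂ g.hom g.hom g.hom (whisker g i) (whisker g i)) (whisker g i) := by
    obtain ⟨v, hv, e⟩ := hi.2.1
    refine ⟨Comps.pull g.hom v, hv.pull hg.hasDeg, ?_⟩
    rw [← hg.pull_transfB₁, ← e]
    have := hg.toIsHom.pull_transfB₂ i i
    change transfB₂ g.hom g.hom g.hom (Comps.pull g.hom i) (Comps.pull g.hom i) -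
      Comps.pull g.hom i = _
    rw [← this]
    funext X Y
    exact (LinearMap.sub_comp _ _ _).symm
  -- Idempotency gives (r·g𝐢)·g𝐢 ≡ r·(g𝐢·g𝐢) ≡ r·g𝐢. The factor g𝐢 can be cancelled on the right
  -- because its 0-th component is 𝐢₀ at the objects in the image of g.
  refine TransfEquiv.of_mul_right hf hg hg hgi (fun X Y p => ?_) (hr.comp hf hg hg hgi) hr
    ((TransfEquiv.assoc hf hg hg hg hr hgi hgi).trans (idem.mul_left hf hg hg hr))
  have : whisker g i Y Y (B.one Y) = i (G Y) (G Y) (C.one (G Y)) := by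
    rw [whisker, LinearMap.comp_apply, hg.map_one]
  rw [this]
  exact (hi.2.2 (F X) (G Y)).2.isHomQuasiIso p

end Units

end

theorem mainTheorem10 {k : Type u} [CommRing k] (B : AInfCat.{u, v} k) (C : AInfCat.{u, w} k)
    (F G : B.Ob → C.Ob) (f : AInfFunctor B C F)
    (rX : ∀ X : B.Ob, C.Hom (F X) (G X))
    (hdeg : ∀ X, rX X ∈ C.gr (F X) (G X) 0)
    (hcyc : ∀ X, C.b₁ (F X) (G X) (rX X) = 0)
    (hqis : ∀ (X Y X₀ Xₙ : B.Ob) (N : ObPath X₀ Xₙ),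
      IsHomQuasiIso C N (C.b₂ (F X) (G X) (G Y) (rX X) ∘ₗ C.sgn (-1) (G X) (G Y)))
    (g g' : AInfFunctor B C G)
    (r r' : Comps B.toGradedQuiver C.toGradedQuiver F G)
    (hr : IsNatTransf f.hom g.hom r) (hr' : IsNatTransf f.hom g'.hom r')
    (hr₀ : ∀ X, r X X (B.one X) = rX X) (hr₀' : ∀ X, r' X X (B.one X) = rX X) :
    (∃ p : Comps B.toGradedQuiver C.toGradedQuiver G G, IsNatTransf g.hom g'.hom p ∧
      TransfEquiv f.hom g'.hom (transfB₂ f.hom g.hom g'.hom r p) r') ∧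
    (∀ p q : Comps B.toGradedQuiver C.toGradedQuiver G G,
      IsNatTransf g.hom g'.hom p → IsNatTransf g.hom g'.hom q →
      TransfEquiv f.hom g'.hom (transfB₂ f.hom g.hom g'.hom r p) r' →
      TransfEquiv f.hom g'.hom (transfB₂ f.hom g.hom g'.hom r q) r' →
      TransfEquiv g.hom g'.hom p q) ∧
    (∀ i : Comps C.toGradedQuiver C.toGradedQuiver (fun X => X) (fun X => X),
      IsUnitTransf C i →
      ∀ p : Comps B.toGradedQuiver C.toGradedQuiver G G, IsNatTransf g.hom g'.hom p →
      TransfEquiv f.hom g'.hom (transfB₂ f.hom g.hom g'.hom r p) r' →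
      ∃ t : Comps B.toGradedQuiver C.toGradedQuiver G G, IsNatTransf g'.hom g.hom t ∧
        TransfEquiv g.hom g.hom (transfB₂ g.hom g'.hom g.hom p t) (whisker g i) ∧
        TransfEquiv g'.hom g'.hom (transfB₂ g'.hom g.hom g'.hom t p) (whisker g' i)) := by
  have hqis' : ∀ (s : Comps B.toGradedQuiver C.toGradedQuiver F G),
      (∀ X, s X X (B.one X) = rX X) → ∀ X Y (p : ObPath X Y), IsHomQuasiIso C p
        (C.b₂ (F X) (G X) (G Y) (s X X (B.one X)) ∘ₗ C.sgn (-1) (G X) (G Y)) := by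
    intro s hs X Y p
    rw [hs]
    exact hqis X Y X Y p
  have hf := f.isFunctor
  have hg := g.isFunctor
  have hg' := g'.isFunctor
  refine ⟨exists_transfB₂_equiv hf hg hg' hr (hqis' r hr₀) hr',
    fun p q hp hq ep eq => (ep.trans eq.symm).of_mul_left hf hg hg' hr (hqis' r hr₀) hp hq, ?_⟩
  intro i hi p hp ep
  -- The situation is symmetric in (g, r) and (g', r'), as both transformations have the same 0-th
  -- component; existence with the roles exchanged yields r'·t ≡ r.
  obtain ⟨t, ht, et⟩ := exists_transfB₂_equiv hf hg' hg hr' (hqis' r' hr₀') hr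
  refine ⟨t, ht, ?_, ?_⟩
  -- After cancelling r it remains to see r·(p·t) ≡ (r·p)·t ≡ r'·t ≡ r ≡ r·g𝐢.
  · refine TransfEquiv.of_mul_left hf hg hg hr (hqis' r hr₀) (hp.comp hg hg' hg ht)
      (isNatTransf_whisker g hi) ?_
    exact (((TransfEquiv.assoc hf hg hg' hg hr hp ht).symm.trans
      (ep.mul_right hf hg' hg ht)).trans et).trans (transfB₂_whisker_equiv hf g hi hr).symm
  -- Here r' is cancelled: r'·(t·p) ≡ (r'·t)·p ≡ r·p ≡ r' ≡ r'·g'𝐢.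
  · refine TransfEquiv.of_mul_left hf hg' hg' hr' (hqis' r' hr₀') (ht.comp hg' hg hg' hp)
      (isNatTransf_whisker g' hi) ?_
    exact (((TransfEquiv.assoc hf hg' hg hg' hr' ht hp).symm.trans
      (et.mul_right hf hg hg' hp)).trans ep).trans (transfB₂_whisker_equiv hf g' hi hr').symm
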